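/- Let $\varepsilon\in\{1,-1\}$ and let $\rho_1,\rho_2\in H^1(\mathbb R)$ be complex valued (continuous representatives); if $\varepsilon=-1$, assume in addition that $|\rho_1(\lambda)|^2+|\rho_2(\lambda)|^2<1$ for all $\lambda\in\mathbb R$. Put $\sigma=\mathrm{diag}(-1,1,1)$ and $$V(\lambda)=\begin{pmatrix}1+\varepsilon|\rho_1(\lambda)|^2+\varepsilon|\rho_2(\lambda)|^2&\varepsilon\overline{\rho_1(\lambda)}&\varepsilon\overline{\rho_2(\lambda)}\\ \rho_1(\lambda)&1&0\\ \rho_2(\lambda)&0&1\end{pmatrix}.$$ For $x\in\mathbb R$ consider the Riemann-Hilbert problem: find a $3\times3$ matrix valued function $M(x,z)$, analytic in $z\in\mathbb C\setminus\mathbb R$, with $M(x,z)\to I$ as $z\to\infty$, which extends continuously to $\mathbb R$ from the upper and from the lower half plane with boundary values $M_\pm(x,\lambda)$ satisfying $$M_+(x,\lambda)=M_-(x,\lambda)\,e^{i\lambda x\sigma}V(\lambda)e^{-i\lambda x\sigma},\qquad \lambda\in\mathbb R.$$ Then for every $x\in\mathbb R$ this problem has a unique solution. For almost every $x\in\mathbb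 R$ the limits $$u(x)=-2i\lim_{z\to\infty}zM(x,z)_{21},\qquad v(x)=-2i\lim_{z\to\infty}zM(x,z)_{31}$$ exist, where $z\to\infty$ non-tangentially in the lower half plane (that is, in every sector $\{\mathrm{Im}\,z<0,\ |\mathrm{Re}\,z|\le c\,|\mathrm{Im}\,z|\}$, $c>0$), and the reconstructed potentials satisfy $u,v\in H^{0,1}(\mathbb R)$, i.e. $u,\,v,\,xu,\,xv\in L^2(\mathbb R)$. -/

import Mathlib

open MeasureTheory Filter Topology

noncomputable section

namespace AKNS

/-- `f : ℝ → ℂ` is (the continuous representative of) an element of the Sobolev space `H¹(ℝ)`: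
`f ∈ L²`, and `f` is absolutely continuous with a derivative `g ∈ L²`. Working with the continuous
representative gives `f` a meaning at every single point. -/
def MemH1 (f : ℝ → ℂ) : Prop :=
  MemLp f 2 volume ∧
    ∃ g : ℝ → ℂ, MemLp g 2 volume ∧ ∀ a b : ℝ, f b - f a = ∫ t in a..b, g t

/-- `f` belongs to the weighted space `H^{0,1}(ℝ)`: `f ∈ L²` and `x f(x) ∈ L²`. -/
def MemH01 (f : ℝ → ℂ) : Prop :=
  MemLp f 2 volume ∧ MemLp (fun x : ℝ => (x : ℂ) * f x) 2 volume

/-- `e^{i t σ}` for `σ = diag(-1, 1, 1)`. -/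
def expSigma (t : ℝ) : Matrix (Fin 3) (Fin 3) ℂ :=
  Matrix.diagonal ![Complex.exp (-(Complex.I * t)), Complex.exp (Complex.I * t),
    Complex.exp (Complex.I * t)]

/-- The jump matrix `V(l)`. -/
def jumpV (ε : ℝ) (ρ₁ ρ₂ : ℝ → ℂ) (l : ℝ) : Matrix (Fin 3) (Fin 3) ℂ :=
  !![1 + (ε : ℂ) * (‖ρ₁ l‖ : ℂ) ^ 2 + (ε : ℂ) * (‖ρ₂ l‖ : ℂ) ^ 2,
      (ε : ℂ) * starRingEnd ℂ (ρ₁ l), (ε : ℂ) * starRingEnd ℂ (ρ₂ l);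
    ρ₁ l, 1, 0;
    ρ₂ l, 0, 1]

/-- `e^{i l x ad σ} V(l) = e^{i l x σ} V(l) e^{-i l x σ}`. -/
def jumpVx (ε : ℝ) (ρ₁ ρ₂ : ℝ → ℂ) (x l : ℝ) : Matrix (Fin 3) (Fin 3) ℂ :=
  expSigma (l * x) * jumpV ε ρ₁ ρ₂ l * expSigma (-(l * x))

/-- `M` solves, at the parameter `x`, the Riemann-Hilbert problem on `ℝ` with jump matrix
`e^{i l x ad σ} V(l)`. Only the values of `M` off the real line matter. -/
structure IsRHPSolution (ε : ℝ) (ρ₁ ρ₂ : ℝ → ℂ) (x : ℝ)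
    (M : ℂ → Matrix (Fin 3) (Fin 3) ℂ) : Prop where
  /-- `M` is analytic on `ℂ ∖ ℝ`. -/
  analytic : ∀ i j : Fin 3, DifferentiableOn ℂ (fun z => M z i j) {z : ℂ | z.im ≠ 0}
  /-- `M(z) → I` as `z → ∞`, uniformly in `ℂ ∖ ℝ`. -/
  normalization : Tendsto M (cocompact ℂ ⊓ 𝓟 {z : ℂ | z.im ≠ 0}) (𝓝 1)
  /-- `M` has continuous boundary values `M₊`, `M₋` from the upper and the lower half plane,
  and `M₊ = M₋ e^{i l x ad σ} V`. -/
  jump : ∃ Mp Mm : ℝ → Matrix (Fin 3) (Fin 3) ℂ,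
    Continuous Mp ∧ Continuous Mm ∧
    (∀ l : ℝ, Tendsto M (𝓝[{z : ℂ | 0 < z.im}] (l : ℂ)) (𝓝 (Mp l))) ∧
    (∀ l : ℝ, Tendsto M (𝓝[{z : ℂ | z.im < 0}] (l : ℂ)) (𝓝 (Mm l))) ∧
    ∀ l : ℝ, Mp l = Mm l * jumpVx ε ρ₁ ρ₂ x l

/-- Non-tangential approach to infinity in the lower half plane, inside the sector
`|Re z| ≤ c |Im z|`. -/
def lowerSectorAtInfinity (c : ℝ) : Filter ℂ :=
  cocompact ℂ ⊓ 𝓟 {z : ℂ | z.im < 0 ∧ |z.re| ≤ c * |z.im|}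

/-- `[u, v] = -2i lim_{z → ∞} [z M₂₁(z), z M₃₁(z)]`, the limit being the non-tangential one
in the lower half plane. -/
def IsReconstructed (M : ℂ → Matrix (Fin 3) (Fin 3) ℂ) (u v : ℂ) : Prop :=
  ∀ c : ℝ, 0 < c →
    Tendsto (fun z : ℂ => -2 * Complex.I * (z * M z 1 0)) (lowerSectorAtInfinity c) (𝓝 u) ∧
    Tendsto (fun z : ℂ => -2 * Complex.I * (z * M z 2 0)) (lowerSectorAtInfinity c) (𝓝 v)

end AKNS

end

/-!
The Riemann-Hilbert problem is a Toeplitz system whose symbol has positive definite real part. Write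
a row of `M` as `e_j + m` from below and `e_j + n` from above the real line. Then `m` and `n` lie in
the Hardy spaces of the two half planes, and the jump condition says that the lower Hardy part of
`m V` is that of `e_j - e_j V`. Since `|ρ|` vanishes at infinity, the smallness condition for
`ε = -1` holds with a uniform margin, so `Re V ≥ c > 0` uniformly in the space variable
(`exists_symV_coercive`). A Lax-Milgram argument solves the system in `L²`; conjugating it with
`κ + d/ds` for a large `κ` changes it by an operator of small norm and yields a solution in `H¹`
(`exists_toeplitz_solution`), whose boundary values are then continuous. Uniqueness is Liouville's
theorem for `N adj(M)`, as `det V = 1` (`IsRHPSolution.unique`).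

Pairing the system with the conjugate of `m` gives the a priori bound `‖m‖ ≤ c⁻¹ ‖e‖` whenever
`m V = (upper Hardy) + e` (`toeplitz_bound`); all the decay follows from it. The Fourier transform
of `e^{2πias} f` is that of `f` moved by `a = x / π`, so for `f ∈ H¹` the Hardy part that is pushed
away from the origin has norm `O(1 / (1 + |a|))` (`IsH1.exists_wave_splitting`).

* For `a ≥ 0` the residual is the lower Hardy part of `e^{2πias} ρ_j`, so `m, n = O(1 / (1 + a))`.
* For `a ≤ 0` the entries `1 + ε|ρ|²`, `ρ_k` are eliminated by passing to the Schur complement of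
  the corner entry; the limiting problem has no oscillation, and its solution gives an approximate
  row whose residual is an upper Hardy part, of norm `O(1 / (1 + |a|))`.

In both cases the jump `n_0 - m_0` of the first entry is `e^{2πias} f + g` with a fixed `f ∈ H¹` and
an integrable `g` such that `∫ g` is a pairing of two small functions, hence `O(1 / (1 + |a|)²)`
(`exists_remainder_nonneg`, `exists_remainder_nonpos`). By an Abelian theorem for the Laplace
transform (`tendsto_mul_lowerExt`) the limit that defines the potential exists as soon as `-a` is a
Lebesgue point of the transform `R` of `f`, and it equals `π⁻¹ (R (-a) + ∫ g)`. As `R` and `ξ R` are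
square integrable, so are `u` and `x u`; measurability follows from the continuous dependence of
`M` on the parameter (`continuous_lowerExt_row`).
-/

open MeasureTheory Filter Topology

noncomputable section

namespace AKNS

open scoped FourierTransform ENNReal SchwartzMap ComplexConjugate

/-! ### Fourier pairs of square integrable functions -/

/-- `F` is the Fourier transform of `f`, both being square integrable. The transform is the one of
`L²`, with kernel `e^{-2πisξ}`; both functions matter up to null sets only. -/
def IsFourierPair (f F : ℝ → ℂ) : Prop :=
  ∃ (hf : MemLp f 2 volume) (hF : MemLp F 2 volume), 𝓕 (hf.toLp f) = hF.toLp F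

namespace IsFourierPair
variable {f g F G : ℝ → ℂ}

theorem left (h : IsFourierPair f F) : MemLp f 2 volume := h.1
theorem right (h : IsFourierPair f F) : MemLp F 2 volume := h.2.1
theorem eq (h : IsFourierPair f F) : 𝓕 (h.left.toLp f) = h.right.toLp F := h.2.2

theorem of_memLp (hf : MemLp f 2 volume) : ∃ F, IsFourierPair f F :=
  ⟨(𝓕 (hf.toLp f) : Lp ℂ 2 (volume : Measure ℝ)), hf, Lp.memLp _, (Lp.toLp_coeFn _ _).symm⟩

theorem of_memLp_right (hF : MemLp F 2 volume) : ∃ f, IsFourierPair f F := by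
  refine ⟨(𝓕⁻ (hF.toLp F) : Lp ℂ 2 (volume : Measure ℝ)), Lp.memLp _, hF, ?_⟩
  rw [Lp.toLp_coeFn]
  exact FourierTransform.fourier_fourierInv_eq _

theorem congr (h : IsFourierPair f F) (hf : f =ᵐ[volume] g) (hF : F =ᵐ[volume] G) :
    IsFourierPair g G := by
  refine ⟨h.left.ae_eq hf, h.right.ae_eq hF, ?_⟩
  rw [← MemLp.toLp_congr h.left _ hf, ← MemLp.toLp_congr h.right _ hF, h.eq]

theorem unique (h : IsFourierPair f F) (h' : IsFourierPair f G) : F =ᵐ[volume] G := by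
  have := h.eq.symm.trans h'.eq
  exact (MemLp.toLp_eq_toLp_iff _ _).1 this

theorem unique_left (h : IsFourierPair f F) (h' : IsFourierPair g F) : f =ᵐ[volume] g := by
  have := h.eq.trans h'.eq.symm
  have h2 := (Lp.fourierTransformₗᵢ ℝ ℂ).injective this
  exact (MemLp.toLp_eq_toLp_iff _ _).1 h2

theorem add (h : IsFourierPair f F) (h' : IsFourierPair g G) :
    IsFourierPair (fun s => f s + g s) (fun s => F s + G s) := by
  refine ⟨h.left.add h'.left, h.right.add h'.right, ?_⟩
  have e1 := MemLp.toLp_add h.left h'.left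
  have e2 := MemLp.toLp_add h.right h'.right
  calc _ = 𝓕 (h.left.toLp f + h'.left.toLp g) := by rw [← e1]; rfl
    _ = _ := by rw [FourierTransform.fourier_add, h.eq, h'.eq, ← e2]; rfl

theorem const_mul (h : IsFourierPair f F) (c : ℂ) :
    IsFourierPair (fun s => c * f s) (fun s => c * F s) := by
  refine ⟨h.left.const_mul c, h.right.const_mul c, ?_⟩
  have e1 := MemLp.toLp_const_smul c h.left
  have e2 := MemLp.toLp_const_smul c h.right
  calc _ = 𝓕 (c • h.left.toLp f) := by rw [← e1]; rfl
    _ = _ := by rw [FourierTransform.fourier_smul, h.eq, ← e2]; rfl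

theorem neg (h : IsFourierPair f F) : IsFourierPair (fun s => -f s) (fun s => -F s) := by
  simpa using h.const_mul (-1)

theorem sub (h : IsFourierPair f F) (h' : IsFourierPair g G) :
    IsFourierPair (fun s => f s - g s) (fun s => F s - G s) := by
  simpa [sub_eq_add_neg] using h.add h'.neg

theorem zero : IsFourierPair (fun _ => 0) (fun _ => 0) := by
  obtain ⟨F, h⟩ := of_memLp (f := fun _ => (0 : ℂ)) MemLp.zero'
  simpa using h.const_mul 0

theorem sum {ι : Type*} (s : Finset ι) {f F : ι → ℝ → ℂ} (h : ∀ i ∈ s, IsFourierPair (f i) (F i)) :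
    IsFourierPair (fun x => ∑ i ∈ s, f i x) (fun x => ∑ i ∈ s, F i x) := by
  classical
  induction s using Finset.induction_on with
  | empty => simpa using zero
  | insert a s ha ih =>
    simp only [Finset.sum_insert ha]
    exact (h a (by simp)).add (ih fun i hi => h i (by simp [hi]))

theorem eLpNorm_eq (h : IsFourierPair f F) : eLpNorm F 2 volume = eLpNorm f 2 volume := by
  have := Lp.norm_fourier_eq (h.left.toLp f)
  rw [h.eq, Lp.norm_toLp, Lp.norm_toLp] at this
  exact (ENNReal.toReal_eq_toReal_iff' h.right.eLpNorm_ne_top h.left.eLpNorm_ne_top).1 this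

theorem integral_conj_mul (h : IsFourierPair f F) (h' : IsFourierPair g G) :
    ∫ s, conj (f s) * g s = ∫ ξ, conj (F ξ) * G ξ := by
  have := Lp.inner_fourier_eq (h.left.toLp f) (h'.left.toLp g)
  rw [h.eq, h'.eq, L2.inner_def, L2.inner_def] at this
  have e1 : ∫ s, conj (f s) * g s =
      ∫ a, inner ℂ ((h.left.toLp f : ℝ → ℂ) a) ((h'.left.toLp g : ℝ → ℂ) a) := by
    apply integral_congr_ae
    filter_upwards [h.left.coeFn_toLp, h'.left.coeFn_toLp] with a h1 h2
    rw [h1, h2]; simp [mul_comm]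
  have e2 : ∫ s, conj (F s) * G s =
      ∫ a, inner ℂ ((h.right.toLp F : ℝ → ℂ) a) ((h'.right.toLp G : ℝ → ℂ) a) := by
    apply integral_congr_ae
    filter_upwards [h.right.coeFn_toLp, h'.right.coeFn_toLp] with a h1 h2
    rw [h1, h2]; simp [mul_comm]
  rw [e1, e2, this]

theorem of_tendsto {fn Fn : ℕ → ℝ → ℂ} (h : ∀ n, IsFourierPair (fn n) (Fn n))
    (hf : MemLp f 2 volume) (hF : MemLp F 2 volume)
    (h1 : Tendsto (fun n => eLpNorm (fn n - f) 2 volume) atTop (𝓝 0))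
    (h2 : Tendsto (fun n => eLpNorm (Fn n - F) 2 volume) atTop (𝓝 0)) : IsFourierPair f F := by
  refine ⟨hf, hF, ?_⟩
  have t1 := (Lp.tendsto_Lp_iff_tendsto_eLpNorm'' fn (fun n => (h n).left) f hf).2 h1
  have t2 := (Lp.tendsto_Lp_iff_tendsto_eLpNorm'' Fn (fun n => (h n).right) F hF).2 h2
  have t3 := ((Lp.fourierTransformₗᵢ ℝ ℂ).continuous.tendsto _).comp t1
  refine tendsto_nhds_unique t3 (t2.congr fun n => ?_)
  exact (h n).eq.symm

/-- Fourier pairs are limits of Fourier pairs of Schwartz functions. -/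
theorem exists_approx (h : IsFourierPair f F) : ∃ φ : ℕ → 𝓢(ℝ, ℂ),
    Tendsto (fun n => eLpNorm (⇑(φ n) - f) 2 volume) atTop (𝓝 0) ∧
    Tendsto (fun n => eLpNorm (𝓕 (⇑(φ n)) - F) 2 volume) atTop (𝓝 0) := by
  have hd := SchwartzMap.denseRange_toLpCLM (E := ℝ) (F := ℂ) (p := 2) (μ := volume)
    (by norm_num)
  obtain ⟨x, hx, hlim⟩ := mem_closure_iff_seq_limit.1 (hd (h.left.toLp f))
  choose φ hφ using hx
  have hφ' : ∀ n, x n = ((φ n).memLp 2 volume).toLp (φ n) := fun n => (hφ n).symm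
  refine ⟨φ, ?_, ?_⟩
  · refine (Lp.tendsto_Lp_iff_tendsto_eLpNorm'' (fun n => ⇑(φ n))
      (fun n => (φ n).memLp 2 volume) f h.left).1 ?_
    exact hlim.congr hφ'
  · have t3 := ((Lp.fourierTransformₗᵢ ℝ ℂ).continuous.tendsto _).comp hlim
    have key : ∀ n, Lp.fourierTransformₗᵢ ℝ ℂ (x n)
        = (((𝓕 (φ n) : 𝓢(ℝ, ℂ)).memLp 2 volume)).toLp (𝓕 (φ n) : 𝓢(ℝ, ℂ)) := by
      intro n
      have := SchwartzMap.toLp_fourier_eq (φ n)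
      rw [hφ' n]
      exact this
    have t4 := t3.congr key
    have e : Lp.fourierTransformₗᵢ ℝ ℂ (h.left.toLp f) = h.right.toLp F := h.eq
    rw [e] at t4
    have := (Lp.tendsto_Lp_iff_tendsto_eLpNorm'' (fun n => ⇑(𝓕 (φ n) : 𝓢(ℝ, ℂ)))
      (fun n => ((𝓕 (φ n) : 𝓢(ℝ, ℂ))).memLp 2 volume) F h.right).1 t4
    simpa [SchwartzMap.fourier_coe] using this

/-- Schwartz functions separate locally integrable functions. -/
theorem ae_eq_of_integral_schwartz_mul (hf : LocallyIntegrable f) (hg : LocallyIntegrable g)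
    (h : ∀ φ : 𝓢(ℝ, ℂ), ∫ x, φ x * f x = ∫ x, φ x * g x)
    (hfi : ∀ φ : 𝓢(ℝ, ℂ), Integrable (fun x => φ x * f x))
    (hgi : ∀ φ : 𝓢(ℝ, ℂ), Integrable (fun x => φ x * g x)) : f =ᵐ[volume] g := by
  have := ae_eq_zero_of_integral_contDiff_smul_eq_zero (hf.sub hg) (fun φ hφ hc => ?_)
  · filter_upwards [this] with x hx
    exact sub_eq_zero.1 hx
  · have hc' : HasCompactSupport (fun x => (φ x : ℂ)) := hc.comp_left (g := fun r : ℝ => (r : ℂ)) (by simp)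
    have hφ' : ContDiff ℝ ((⊤ : ℕ∞) : WithTop ℕ∞) (fun x => (φ x : ℂ)) := Complex.ofRealCLM.contDiff.comp hφ
    have e := h (hc'.toSchwartzMap hφ')
    have i1 := hfi (hc'.toSchwartzMap hφ')
    have i2 := hgi (hc'.toSchwartzMap hφ')
    have e3 := integral_sub i1 i2
    rw [e, sub_self] at e3
    rw [← e3]
    apply integral_congr_ae
    filter_upwards with x
    show φ x • (f x - g x) = (φ x : ℂ) * f x - (φ x : ℂ) * g x
    rw [Complex.real_smul]; ring

/-- On `L¹ ∩ L²` the transform is given by the Fourier integral. -/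
theorem of_integrable (hf : Integrable f) (hf2 : MemLp f 2 volume) : IsFourierPair f (𝓕 f) := by
  obtain ⟨F, h⟩ := of_memLp hf2
  refine h.congr (ae_eq_refl _) ?_
  have hc : Continuous (𝓕 f) := VectorFourier.fourierIntegral_continuous
    Real.continuous_fourierChar (by exact continuous_inner) hf
  refine ae_eq_of_integral_schwartz_mul (h.right.locallyIntegrable (by norm_num))
    hc.locallyIntegrable (fun φ => ?_) (fun φ => ?_) (fun φ => ?_)
  · have e := congrArg (fun T => T φ) (Lp.fourier_toTemperedDistribution_eq (hf2.toLp f))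
    have e' : ∫ x, (𝓕 φ : 𝓢(ℝ, ℂ)) x * f x = ∫ x, φ x * F x := by
      have l : (𝓕 ((hf2.toLp f : Lp ℂ 2 (volume : Measure ℝ)) : 𝓢'(ℝ, ℂ))) φ
        = ∫ x, (𝓕 φ : 𝓢(ℝ, ℂ)) x * f x := by
        rw [TemperedDistribution.fourier_apply, Lp.toTemperedDistribution_apply]
        apply integral_congr_ae
        filter_upwards [hf2.coeFn_toLp] with x hx
        rw [hx]; rfl
      have r : (((𝓕 (hf2.toLp f)) : Lp ℂ 2 (volume : Measure ℝ)) : 𝓢'(ℝ, ℂ)) φ = ∫ x, φ x * F x := by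
        rw [h.eq, Lp.toTemperedDistribution_apply]
        apply integral_congr_ae
        filter_upwards [h.right.coeFn_toLp] with x hx
        rw [hx]; rfl
      rw [← l, ← r]; exact e
    rw [← e']
    have := VectorFourier.integral_fourierIntegral_smul_eq_flip (L := innerₗ ℝ)
      Real.continuous_fourierChar (by exact continuous_inner) (φ.integrable (μ := volume)) hf
    simp only [smul_eq_mul, flip_innerₗ] at this
    rw [SchwartzMap.fourier_coe]
    exact this
  · exact h.right.integrable_mul (φ.memLp 2 volume) |>.congr (by
      filter_upwards with x; simp [mul_comm])
  · have hb : ∀ x, ‖𝓕 f x‖ ≤ ∫ y, ‖f y‖ := fun x =>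
      VectorFourier.norm_fourierIntegral_le_integral_norm _ _ _ _ _
    exact (φ.integrable (μ := volume)).mul_bdd hc.aestronglyMeasurable (ae_of_all _ hb)

/-- Rules for the transform need only be checked on integrable functions: if `A`, `B` are additive
isometries of `L²` intertwined by the transform of Schwartz functions, they are intertwined. -/
theorem transfer (A B : (ℝ → ℂ) → ℝ → ℂ)
    (hA : ∀ f, MemLp f 2 volume → MemLp (A f) 2 volume)
    (hB : ∀ f, MemLp f 2 volume → MemLp (B f) 2 volume)
    (dA : ∀ f g, MemLp f 2 volume → MemLp g 2 volume →
      eLpNorm (A f - A g) 2 volume = eLpNorm (f - g) 2 volume)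
    (dB : ∀ f g, MemLp f 2 volume → MemLp g 2 volume →
      eLpNorm (B f - B g) 2 volume = eLpNorm (f - g) 2 volume)
    (hi : ∀ φ : 𝓢(ℝ, ℂ), Integrable (A φ)) (hAB : ∀ φ : 𝓢(ℝ, ℂ), 𝓕 (A φ) = B (𝓕 ⇑φ))
    (h : IsFourierPair f F) : IsFourierPair (A f) (B F) := by
  obtain ⟨φ, h1, h2⟩ := h.exists_approx
  refine of_tendsto (fn := fun n => A (φ n)) (Fn := fun n => B (𝓕 ⇑(φ n))) (fun n => ?_)
    (hA _ h.left) (hB _ h.right) ?_ ?_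
  · have := of_integrable (hi (φ n)) (hA _ ((φ n).memLp 2 volume))
    rwa [hAB] at this
  · refine h1.congr fun n => (dA _ _ ((φ n).memLp 2 volume) h.left).symm
  · refine h2.congr fun n => (dB _ _ ?_ h.right).symm
    rw [← SchwartzMap.fourier_coe]
    exact (𝓕 (φ n) : 𝓢(ℝ, ℂ)).memLp 2 volume

theorem norm_cexp_two_pi (a s : ℝ) : ‖Complex.exp (2 * Real.pi * Complex.I * a * s)‖ = 1 := by
  have : (2 * Real.pi * Complex.I * a * s : ℂ) = ((2 * Real.pi * a * s : ℝ) : ℂ) * Complex.I := by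
    push_cast; ring
  rw [this, Complex.norm_exp_ofReal_mul_I]

theorem fourier_eq_integral (f : ℝ → ℂ) (ξ : ℝ) :
    𝓕 f ξ = ∫ s : ℝ, Complex.exp (-(2 * Real.pi * Complex.I * ξ * s)) * f s := by
  rw [Real.fourier_eq']
  congr 1; ext s
  simp only [smul_eq_mul]
  congr 2
  simp; ring

theorem memLp_cexp_mul (a : ℝ) (hf : MemLp f 2 volume) :
    MemLp (fun s : ℝ => Complex.exp (2 * Real.pi * Complex.I * a * s) * f s) 2 volume := by
  refine hf.of_le (AEStronglyMeasurable.mul (by fun_prop) hf.1) (ae_of_all _ fun s => ?_)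
  rw [norm_mul, norm_cexp_two_pi, one_mul]

theorem eLpNorm_cexp_mul_sub (a : ℝ) (f g : ℝ → ℂ) :
    eLpNorm ((fun s : ℝ => Complex.exp (2 * Real.pi * Complex.I * a * s) * f s) -
      (fun s : ℝ => Complex.exp (2 * Real.pi * Complex.I * a * s) * g s)) 2 volume
      = eLpNorm (f - g) 2 volume := by
  apply eLpNorm_congr_norm_ae
  filter_upwards with s
  simp only [Pi.sub_apply]
  rw [← mul_sub, norm_mul, norm_cexp_two_pi, one_mul]

theorem eLpNorm_comp_add (f : ℝ → ℂ) (hf : AEStronglyMeasurable f) (a : ℝ) :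
    eLpNorm (fun s => f (s + a)) 2 volume = eLpNorm f 2 volume :=
  eLpNorm_comp_measurePreserving hf (measurePreserving_add_right volume a)

theorem memLp_comp_add (hf : MemLp f 2 volume) (a : ℝ) :
    MemLp (fun s => f (s + a)) 2 volume :=
  hf.comp_measurePreserving (measurePreserving_add_right volume a)

/-- Translation becomes modulation. -/
theorem comp_add (h : IsFourierPair f F) (a : ℝ) : IsFourierPair (fun s => f (s + a))
    (fun ξ : ℝ => Complex.exp (2 * Real.pi * Complex.I * a * ξ) * F ξ) := by
  refine transfer (fun f s => f (s + a))
    (fun F (ξ : ℝ) => Complex.exp (2 * Real.pi * Complex.I * a * ξ) * F ξ)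
    (fun f hf => memLp_comp_add hf a) (fun f hf => memLp_cexp_mul a hf)
    (fun f g hf hg => ?_) (fun f g _ _ => eLpNorm_cexp_mul_sub a f g)
    (fun φ => (φ.integrable (μ := volume)).comp_add_right a) (fun φ => ?_) h
  · exact eLpNorm_comp_add (f - g) (hf.sub hg).1 a
  · ext ξ
    rw [fourier_eq_integral, fourier_eq_integral, ← integral_const_mul,
      ← integral_sub_right_eq_self (μ := volume) (fun s : ℝ =>
        Complex.exp (2 * Real.pi * Complex.I * a * ξ) *
          (Complex.exp (-(2 * Real.pi * Complex.I * ξ * s)) * φ s)) (-a)]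
    congr 1; ext s
    simp only [sub_neg_eq_add, ← mul_assoc, ← Complex.exp_add]
    congr 2; push_cast; ring

/-- Modulation becomes translation. -/
theorem cexp_mul (h : IsFourierPair f F) (a : ℝ) :
    IsFourierPair (fun s : ℝ => Complex.exp (2 * Real.pi * Complex.I * a * s) * f s)
    (fun ξ => F (ξ - a)) := by
  refine transfer (fun f (s : ℝ) => Complex.exp (2 * Real.pi * Complex.I * a * s) * f s)
    (fun F ξ => F (ξ - a))
    (fun f hf => memLp_cexp_mul a hf) (fun f hf => memLp_comp_add hf (-a))
    (fun f g _ _ => eLpNorm_cexp_mul_sub a f g)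
    (fun f g hf hg => ?_) (fun φ => ?_) (fun φ => ?_) h
  · exact eLpNorm_comp_add (f - g) (hf.sub hg).1 (-a)
  · refine (φ.integrable (μ := volume)).bdd_mul (c := 1) (by fun_prop) (ae_of_all _ fun s => ?_)
    rw [norm_cexp_two_pi]
  · ext ξ
    rw [fourier_eq_integral, fourier_eq_integral]
    congr 1; ext s
    simp only [← mul_assoc, ← Complex.exp_add]
    congr 2; push_cast; ring

theorem conj' (h : IsFourierPair f F) :
    IsFourierPair (fun s => conj (f s)) (fun ξ => conj (F (-ξ))) := by
  have hc : ∀ f : ℝ → ℂ, MemLp f 2 volume → MemLp (fun s => conj (f s)) 2 volume := fun f hf =>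
    hf.of_le (Complex.continuous_conj.comp_aestronglyMeasurable hf.1) (ae_of_all _ fun s => by simp)
  have hr : ∀ f : ℝ → ℂ, MemLp f 2 volume → MemLp (fun s => f (-s)) 2 volume := fun f hf =>
    hf.comp_measurePreserving (Measure.measurePreserving_neg volume)
  have hd : ∀ f g : ℝ → ℂ, eLpNorm ((fun s => conj (f s)) - (fun s => conj (g s))) 2 volume
      = eLpNorm (f - g) 2 volume := fun f g => by
    apply eLpNorm_congr_norm_ae
    filter_upwards with s
    simp only [Pi.sub_apply]
    rw [← map_sub, RCLike.norm_conj]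
  refine transfer (fun f s => conj (f s)) (fun F ξ => conj (F (-ξ))) hc
    (fun f hf => hc _ (hr f hf)) (fun f g _ _ => hd f g) (fun f g hf hg => ?_)
    (fun φ => ?_) (fun φ => ?_) h
  · rw [hd (fun ξ => f (-ξ)) (fun ξ => g (-ξ))]
    exact eLpNorm_comp_measurePreserving (hf.sub hg).1 (Measure.measurePreserving_neg volume)
  · exact (φ.integrable (μ := volume)).mono (Complex.continuous_conj.comp_aestronglyMeasurable
      φ.continuous.aestronglyMeasurable) (ae_of_all _ fun s => by simp)
  · ext ξ
    rw [fourier_eq_integral, fourier_eq_integral, ← integral_conj]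
    congr 1; ext s
    rw [map_mul, ← Complex.exp_conj]
    have h2 : conj (2 : ℂ) = 2 := Complex.conj_ofReal 2
    congr 2; simp [Complex.conj_ofReal, h2]

/-- Parseval's identity in bilinear form. -/
theorem integral_mul (h : IsFourierPair f F) (h' : IsFourierPair g G) :
    ∫ s, f s * g s = ∫ ξ, F (-ξ) * G ξ := by
  simpa using h.conj'.integral_conj_mul h'

/-- The transform of a product is the convolution of the transforms. -/
theorem fourier_mul (h : IsFourierPair f F) (h' : IsFourierPair g G) (ξ : ℝ) :
    𝓕 (fun s => f s * g s) ξ = ∫ η, F (ξ - η) * G η := by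
  have := (h.cexp_mul (-ξ)).integral_mul h'
  rw [fourier_eq_integral]
  calc _ = ∫ s : ℝ, Complex.exp (2 * Real.pi * Complex.I * (-ξ : ℝ) * s) * f s * g s := by
        congr 1; ext s; rw [← mul_assoc]; congr 3; push_cast; ring
    _ = _ := this
    _ = _ := by congr 1; ext η; congr 2; ring

/-- An integrable, square integrable `F` is the transform of its inverse Fourier integral. -/
theorem of_integrable_right (hF : Integrable F) (hF2 : MemLp F 2 volume) :
    IsFourierPair (𝓕⁻ F) F := by
  obtain ⟨f, h⟩ := of_memLp_right hF2
  refine h.congr ?_ (ae_eq_refl _)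
  have hc : Continuous (𝓕⁻ F) := by
    have : 𝓕⁻ F = fun w => 𝓕 F (-w) := funext (Real.fourierInv_eq_fourier_neg F)
    rw [this]
    exact (VectorFourier.fourierIntegral_continuous
      Real.continuous_fourierChar (by exact continuous_inner) hF).comp continuous_neg
  have hb : ∀ x, ‖𝓕⁻ F x‖ ≤ ∫ y, ‖F y‖ := fun x => by
    rw [Real.fourierInv_eq_fourier_neg]
    exact VectorFourier.norm_fourierIntegral_le_integral_norm _ _ _ _ _
  refine ae_eq_of_integral_schwartz_mul (h.left.locallyIntegrable (by norm_num))
    hc.locallyIntegrable (fun φ => ?_) (fun φ => ?_) (fun φ => ?_)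
  · have h1 := (of_integrable (φ.integrable (μ := volume)) (φ.memLp 2 volume)).integral_mul h
    have h2 := VectorFourier.integral_fourierIntegral_smul_eq_flip (L := innerₗ ℝ)
      Real.continuous_fourierChar (by exact continuous_inner) (φ.integrable (μ := volume))
      (hF.comp_neg)
    simp only [smul_eq_mul, flip_innerₗ] at h2
    rw [h1, ← integral_neg_eq_self]
    simp only [neg_neg]
    refine Eq.trans h2 ?_
    congr 1; ext x
    congr 1
    rw [Real.fourierInv_eq_fourier_neg]
    show 𝓕 (fun y => F (-y)) x = _
    rw [fourier_eq_integral, fourier_eq_integral, ← integral_neg_eq_self]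
    congr 1; ext s; simp
  · exact h.left.integrable_mul (φ.memLp 2 volume) |>.congr (by
      filter_upwards with x; simp [mul_comm])
  · exact (φ.integrable (μ := volume)).mul_bdd hc.aestronglyMeasurable (ae_of_all _ hb)

end IsFourierPair

/-! ### The norm of `L²` -/

/-- The norm of `L²(ℝ)`, as a real number; it is meaningful for functions in `L²` only. -/
def l2norm (f : ℝ → ℂ) : ℝ := (eLpNorm f 2 volume).toReal

section l2norm
variable {f g F G : ℝ → ℂ}

theorem l2norm_nonneg (f : ℝ → ℂ) : 0 ≤ l2norm f := ENNReal.toReal_nonneg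

theorem l2norm_sq (hf : MemLp f 2 volume) : l2norm f ^ 2 = ∫ s, ‖f s‖ ^ 2 := by
  have h := hf.eLpNorm_eq_integral_rpow_norm (by norm_num) (by norm_num)
  have h0 : 0 ≤ ∫ s, ‖f s‖ ^ 2 := integral_nonneg fun s => by positivity
  rw [l2norm, h]
  simp only [ENNReal.toReal_ofNat, Real.rpow_two]
  rw [ENNReal.toReal_ofReal (by positivity), ← Real.rpow_natCast, ← Real.rpow_mul h0]
  norm_num

theorem l2norm_congr (h : f =ᵐ[volume] g) : l2norm f = l2norm g := by
  rw [l2norm, l2norm, eLpNorm_congr_ae h]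

theorem l2norm_congr_norm (h : ∀ s, ‖f s‖ = ‖g s‖) : l2norm f = l2norm g := by
  rw [l2norm, l2norm, eLpNorm_congr_norm_ae (ae_of_all _ h)]

theorem l2norm_le_mul (hg : MemLp g 2 volume) {C : ℝ} (hC : 0 ≤ C)
    (h : ∀ᵐ s, ‖f s‖ ≤ C * ‖g s‖) : l2norm f ≤ C * l2norm g := by
  have := eLpNorm_le_mul_eLpNorm_of_ae_le_mul h 2
  have h2 := ENNReal.toReal_mono (ENNReal.mul_ne_top ENNReal.ofReal_ne_top hg.eLpNorm_ne_top) this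
  rwa [ENNReal.toReal_mul, ENNReal.toReal_ofReal hC] at h2

theorem l2norm_add_le (hf : MemLp f 2 volume) (hg : MemLp g 2 volume) :
    l2norm (fun s => f s + g s) ≤ l2norm f + l2norm g := by
  have := eLpNorm_add_le hf.1 hg.1 (p := 2) (by norm_num)
  have h2 := ENNReal.toReal_mono (ENNReal.add_ne_top.2 ⟨hf.eLpNorm_ne_top, hg.eLpNorm_ne_top⟩) this
  rwa [ENNReal.toReal_add hf.eLpNorm_ne_top hg.eLpNorm_ne_top] at h2

theorem l2norm_neg (f : ℝ → ℂ) : l2norm (fun s => -f s) = l2norm f :=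
  l2norm_congr_norm fun _ => norm_neg _

theorem l2norm_const_mul (c : ℂ) (f : ℝ → ℂ) : l2norm (fun s => c * f s) = ‖c‖ * l2norm f := by
  have := eLpNorm_const_smul c f 2 volume
  rw [l2norm, l2norm, show (fun s => c * f s) = c • f from rfl, this, ENNReal.toReal_mul]
  simp

theorem integrable_mul_of_memLp (hf : MemLp f 2 volume) (hg : MemLp g 2 volume) :
    Integrable (fun s => f s * g s) := hf.integrable_mul hg

/-- The Cauchy–Schwarz inequality. -/
theorem integral_norm_mul_le (hf : MemLp f 2 volume) (hg : MemLp g 2 volume) :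
    ∫ s, ‖f s * g s‖ ≤ l2norm f * l2norm g := by
  have h := integral_mul_norm_le_Lp_mul_Lq (μ := volume) (f := f) (g := g)
    Real.HolderConjugate.two_two (by simpa using hf) (by simpa using hg)
  have e : ∀ {k : ℝ → ℂ}, MemLp k 2 volume → (∫ a, ‖k a‖ ^ (2 : ℝ)) ^ (1 / (2 : ℝ)) = l2norm k := by
    intro k hk
    have : ∫ a, ‖k a‖ ^ (2 : ℝ) = l2norm k ^ 2 := by rw [l2norm_sq hk]; simp
    rw [this, ← Real.sqrt_eq_rpow, Real.sqrt_sq (l2norm_nonneg k)]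
  rw [e hf, e hg] at h
  simpa only [norm_mul] using h

theorem norm_integral_mul_le (hf : MemLp f 2 volume) (hg : MemLp g 2 volume) :
    ‖∫ s, f s * g s‖ ≤ l2norm f * l2norm g :=
  (norm_integral_le_integral_norm _).trans (integral_norm_mul_le hf hg)

theorem IsFourierPair.l2norm_eq (h : IsFourierPair f F) : l2norm F = l2norm f := by
  rw [l2norm, l2norm, h.eLpNorm_eq]

theorem memLp_mul_bdd (hf : MemLp f 2 volume) (hg : AEStronglyMeasurable g volume) {B : ℝ}
    (hB : ∀ s, ‖g s‖ ≤ B) : MemLp (fun s => g s * f s) 2 volume := by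
  refine (hf.const_mul (B : ℂ)).of_le (hg.mul hf.1) (ae_of_all _ fun s => ?_)
  rw [norm_mul, norm_mul, Complex.norm_real, Real.norm_eq_abs]
  exact mul_le_mul_of_nonneg_right ((hB s).trans (le_abs_self B)) (norm_nonneg _)

end l2norm

/-! ### Inversion of `κ + d/ds` -/

/-- The symbol `κ + 2πiξ` of the operator `κ + d/ds`. -/
def dsym (κ ξ : ℝ) : ℂ := κ + 2 * Real.pi * Complex.I * ξ

theorem normSq_dsym (κ ξ : ℝ) : ‖dsym κ ξ‖ ^ 2 = κ ^ 2 + (2 * Real.pi * ξ) ^ 2 := by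
  have : dsym κ ξ = (κ : ℂ) + ((2 * Real.pi * ξ : ℝ) : ℂ) * Complex.I := by
    rw [dsym]; push_cast; ring
  rw [this, ← Complex.normSq_eq_norm_sq, Complex.normSq_add_mul_I]

theorem dsym_ne_zero {κ : ℝ} (hκ : 0 < κ) (ξ : ℝ) : dsym κ ξ ≠ 0 := by
  intro h
  have := normSq_dsym κ ξ
  rw [h] at this
  have : 0 < κ ^ 2 := by positivity
  have : 0 ≤ (2 * Real.pi * ξ) ^ 2 := by positivity
  simp at *
  linarith

theorem continuous_dsym (κ : ℝ) : Continuous (dsym κ) := by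
  unfold dsym; fun_prop

theorem norm_dsym_inv_sq {κ : ℝ} (hκ : 0 < κ) (ξ : ℝ) :
    ‖(dsym κ ξ)⁻¹‖ ^ 2 = (κ ^ 2)⁻¹ * (1 + (2 * Real.pi / κ * ξ) ^ 2)⁻¹ := by
  rw [norm_inv, inv_pow, normSq_dsym, ← mul_inv]
  congr 1; field_simp

theorem memLp_dsym_inv {κ : ℝ} (hκ : 0 < κ) : MemLp (fun ξ => (dsym κ ξ)⁻¹) 2 volume := by
  rw [memLp_two_iff_integrable_sq_norm]
  · simp only [norm_dsym_inv_sq hκ]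
    exact (integrable_inv_one_add_sq.comp_mul_left' (by positivity)).const_mul _
  · exact ((continuous_dsym κ).inv₀ (dsym_ne_zero hκ)).aestronglyMeasurable

theorem l2norm_dsym_inv {κ : ℝ} (hκ : 0 < κ) : l2norm (fun ξ => (dsym κ ξ)⁻¹) = √(1 / (2 * κ)) := by
  have h := l2norm_sq (memLp_dsym_inv hκ)
  simp only [norm_dsym_inv_sq hκ] at h
  rw [integral_const_mul, Measure.integral_comp_mul_left (fun x : ℝ => (1 + x ^ 2)⁻¹),
    integral_univ_inv_one_add_sq, abs_of_pos (by positivity)] at h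
  rw [← Real.sqrt_sq (l2norm_nonneg _), h]
  congr 1
  simp only [smul_eq_mul]
  field_simp

theorem integrable_dsym_inv_mul {κ : ℝ} (hκ : 0 < κ) {G : ℝ → ℂ} (hG : MemLp G 2 volume) :
    Integrable (fun ξ => (dsym κ ξ)⁻¹ * G ξ) :=
  integrable_mul_of_memLp (memLp_dsym_inv hκ) hG

theorem memLp_dsym_inv_mul {κ : ℝ} (hκ : 0 < κ) {G : ℝ → ℂ} (hG : MemLp G 2 volume) :
    MemLp (fun ξ => (dsym κ ξ)⁻¹ * G ξ) 2 volume := by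
  refine memLp_mul_bdd hG ((continuous_dsym κ).inv₀ (dsym_ne_zero hκ)).aestronglyMeasurable
    (B := κ⁻¹) fun ξ => ?_
  rw [norm_inv]
  refine inv_anti₀ hκ ?_
  refine (sq_le_sq₀ hκ.le (norm_nonneg _)).1 ?_
  rw [normSq_dsym]; nlinarith [sq_nonneg (2 * Real.pi * ξ)]

theorem fourierInv_eq_integral (F : ℝ → ℂ) (s : ℝ) :
    𝓕⁻ F s = ∫ ξ : ℝ, Complex.exp (2 * Real.pi * Complex.I * s * ξ) * F ξ := by
  rw [Real.fourierInv_eq_fourier_neg, IsFourierPair.fourier_eq_integral]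
  congr 1; ext ξ; congr 2; push_cast; ring

theorem norm_fourierInv_le (F : ℝ → ℂ) (s : ℝ) : ‖𝓕⁻ F s‖ ≤ ∫ ξ, ‖F ξ‖ := by
  rw [Real.fourierInv_eq_fourier_neg]
  exact VectorFourier.norm_fourierIntegral_le_integral_norm _ _ _ _ _

theorem continuous_fourier {F : ℝ → ℂ} (hF : Integrable F) : Continuous (𝓕 F) :=
  VectorFourier.fourierIntegral_continuous
      Real.continuous_fourierChar (by exact continuous_inner) hF

theorem continuous_fourierInv {F : ℝ → ℂ} (hF : Integrable F) : Continuous (𝓕⁻ F) := by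
  have : 𝓕⁻ F = fun w => 𝓕 F (-w) := funext (Real.fourierInv_eq_fourier_neg F)
  rw [this]
  exact (continuous_fourier hF).comp continuous_neg

/-! ### The Sobolev space `H¹` -/

/-- The continuous elements of `H¹(ℝ)`, described by their difference quotients: `f ∈ L²` and
`‖f(· + h) - f‖₂ ≤ C |h|`. This form makes products and Lipschitz compositions immediate. -/
structure IsH1 (f : ℝ → ℂ) : Prop where
  continuous : Continuous f
  memLp : MemLp f 2 volume
  exists_diff_le : ∃ C : ℝ, 0 ≤ C ∧ ∀ h : ℝ, l2norm (fun s => f (s + h) - f s) ≤ C * |h|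

namespace IsH1
variable {f g k F G : ℝ → ℂ}

/-- Fatou's lemma for the transforms of the difference quotients. -/
theorem memLp_mul_fourier (hf : IsH1 f) (h : IsFourierPair f F) :
    MemLp (fun ξ : ℝ => 2 * Real.pi * Complex.I * ξ * F ξ) 2 volume := by
  obtain ⟨C, hC, hd⟩ := hf.exists_diff_le
  let q : ℕ → ℝ → ℂ := fun n ξ =>
    (n : ℂ) * (Complex.exp (2 * Real.pi * Complex.I * (n : ℝ)⁻¹ * ξ) * F ξ - F ξ)
  have hpair : ∀ n : ℕ, IsFourierPair (fun s => (n : ℂ) * (f (s + (n : ℝ)⁻¹) - f s)) (q n) :=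
    fun n => by simpa [q] using ((h.comp_add (n : ℝ)⁻¹).sub h).const_mul (n : ℂ)
  have hq : ∀ n, eLpNorm (q n) 2 volume ≤ ENNReal.ofReal C := by
    intro n
    rw [ENNReal.le_ofReal_iff_toReal_le (hpair n).right.eLpNorm_ne_top hC]
    change l2norm (q n) ≤ C
    rw [(hpair n).l2norm_eq, l2norm_const_mul]
    rcases Nat.eq_zero_or_pos n with rfl | hn
    · simpa using hC
    · have hn' : (0 : ℝ) < n := by exact_mod_cast hn
      have := hd (n : ℝ)⁻¹
      rw [abs_of_pos (by positivity)] at this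
      calc ‖(n : ℂ)‖ * _ ≤ n * (C * (n : ℝ)⁻¹) := by
            rw [Complex.norm_natCast]; gcongr
        _ = C := by field_simp
  have hlim : ∀ ξ : ℝ, Tendsto (fun n => q n ξ) atTop (𝓝 (2 * Real.pi * Complex.I * ξ * F ξ)) := by
    intro ξ
    have hder : HasDerivAt (fun t : ℂ => Complex.exp (t * (2 * Real.pi * Complex.I * ξ)))
        (2 * Real.pi * Complex.I * ξ) 0 := by
      simpa using ((hasDerivAt_id (0 : ℂ)).mul_const (2 * Real.pi * Complex.I * ξ)).cexp
    have h1 := hder.tendsto_slope_zero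
    have h2 : Tendsto (fun n : ℕ => ((n : ℂ))⁻¹) atTop (𝓝[≠] 0) := by
      refine tendsto_nhdsWithin_iff.2 ⟨tendsto_inv_atTop_nhds_zero_nat, ?_⟩
      filter_upwards [eventually_gt_atTop 0] with n hn
      simp; omega
    have h3 := (h1.comp h2).mul_const (F ξ)
    refine h3.congr fun n => ?_
    simp only [Function.comp, q, zero_add, zero_mul, Complex.exp_zero, inv_inv, smul_eq_mul]
    rw [mul_assoc, sub_mul, one_mul]
    congr 4; push_cast; ring
  refine ⟨AEStronglyMeasurable.mul (by fun_prop) h.right.1, ?_⟩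
  refine (Lp.eLpNorm_lim_le_liminf_eLpNorm (fun n => (hpair n).right.1) _
    (ae_of_all _ hlim)).trans_lt ?_
  refine lt_of_le_of_lt (liminf_le_of_frequently_le' (Frequently.of_forall hq)) ENNReal.ofReal_lt_top

theorem memLp_dsym_mul (hf : IsH1 f) (h : IsFourierPair f F) (κ : ℝ) :
    MemLp (fun ξ => dsym κ ξ * F ξ) 2 volume := by
  refine ((h.right.const_mul (κ : ℂ)).add (hf.memLp_mul_fourier h)).ae_eq ?_
  filter_upwards with ξ
  simp only [Pi.add_apply, dsym]; ring

theorem integrable_fourier (hf : IsH1 f) (h : IsFourierPair f F) : Integrable F := by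
  refine (integrable_dsym_inv_mul one_pos (hf.memLp_dsym_mul h 1)).congr ?_
  filter_upwards with ξ
  rw [inv_mul_cancel_left₀ (dsym_ne_zero one_pos ξ)]

theorem eq_fourierInv (hf : IsH1 f) (h : IsFourierPair f F) : f = 𝓕⁻ F := by
  have hi := hf.integrable_fourier h
  exact Continuous.ae_eq_iff_eq volume hf.continuous (continuous_fourierInv hi) |>.1
    (h.unique_left (IsFourierPair.of_integrable_right hi h.right))

theorem bounded (hf : IsH1 f) : ∃ B, 0 ≤ B ∧ ∀ s, ‖f s‖ ≤ B := by
  obtain ⟨F, h⟩ := IsFourierPair.of_memLp hf.memLp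
  refine ⟨∫ ξ, ‖F ξ‖, integral_nonneg fun _ => norm_nonneg _, fun s => ?_⟩
  rw [hf.eq_fourierInv h]
  exact norm_fourierInv_le F s

theorem tendsto_zero (hf : IsH1 f) : Tendsto f (cocompact ℝ) (𝓝 0) := by
  obtain ⟨F, h⟩ := IsFourierPair.of_memLp hf.memLp
  rw [hf.eq_fourierInv h]
  have : 𝓕⁻ F = fun w => 𝓕 F (-w) := funext (Real.fourierInv_eq_fourier_neg F)
  rw [this]
  exact (Real.zero_at_infty_fourier F).comp (Homeomorph.neg ℝ).isClosedEmbedding.tendsto_cocompact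

theorem of_fourier (hf : Continuous f) (h : IsFourierPair f F)
    (hF : MemLp (fun ξ : ℝ => 2 * Real.pi * Complex.I * ξ * F ξ) 2 volume) : IsH1 f := by
  refine ⟨hf, h.left, l2norm (fun ξ : ℝ => 2 * Real.pi * Complex.I * ξ * F ξ), l2norm_nonneg _,
    fun a => ?_⟩
  rw [← ((h.comp_add a).sub h).l2norm_eq, mul_comm _ |a|]
  refine l2norm_le_mul hF (abs_nonneg a) (ae_of_all _ fun ξ => ?_)
  have e : (2 * Real.pi * Complex.I * a * ξ : ℂ) = Complex.I * ((2 * Real.pi * a * ξ : ℝ) : ℂ) := by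
    push_cast; ring
  have := Real.norm_exp_I_mul_ofReal_sub_one_le (x := 2 * Real.pi * a * ξ)
  rw [← sub_one_mul, norm_mul, norm_mul, e, ← mul_assoc]
  refine mul_le_mul_of_nonneg_right (this.trans_eq ?_) (norm_nonneg _)
  simp; ring

/-- The inverse of `κ + d/ds` maps `L²` into `H¹`. -/
theorem of_dsym {κ : ℝ} (hκ : 0 < κ) (hG : MemLp G 2 volume) :
    IsH1 (𝓕⁻ fun ξ => (dsym κ ξ)⁻¹ * G ξ) ∧
      IsFourierPair (𝓕⁻ fun ξ => (dsym κ ξ)⁻¹ * G ξ) (fun ξ => (dsym κ ξ)⁻¹ * G ξ) := by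
  have hi := integrable_dsym_inv_mul hκ hG
  have hp := IsFourierPair.of_integrable_right hi (memLp_dsym_inv_mul hκ hG)
  refine ⟨of_fourier (continuous_fourierInv hi) hp ?_, hp⟩
  refine (hG.sub (hp.right.const_mul (κ : ℂ))).ae_eq ?_
  filter_upwards with ξ
  have : G ξ = dsym κ ξ * ((dsym κ ξ)⁻¹ * G ξ) := by
    rw [mul_inv_cancel_left₀ (dsym_ne_zero hκ ξ)]
  simp only [Pi.sub_apply]
  generalize (dsym κ ξ)⁻¹ * G ξ = q at this ⊢
  rw [this, dsym]
  ring

/-- `H¹` is stable under Lipschitz operations. -/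
theorem of_le (hf : IsH1 f) (hg : IsH1 g) (hk : Continuous k) {L : ℝ} (hL : 0 ≤ L)
    (h1 : ∀ s, ‖k s‖ ≤ L * (‖f s‖ + ‖g s‖))
    (h2 : ∀ s t, ‖k s - k t‖ ≤ L * (‖f s - f t‖ + ‖g s - g t‖)) : IsH1 k := by
  have key : ∀ {a b c : ℝ → ℂ}, MemLp a 2 volume → MemLp b 2 volume → Continuous c →
      (∀ s, ‖c s‖ ≤ L * (‖a s‖ + ‖b s‖)) → MemLp c 2 volume ∧
        l2norm c ≤ L * (l2norm a + l2norm b) := by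
    intro a b c ha hb hc h
    have ha' : MemLp (fun s => ((‖a s‖ : ℝ) : ℂ)) 2 volume := ha.norm.ofReal
    have hb' : MemLp (fun s => ((‖b s‖ : ℝ) : ℂ)) 2 volume := hb.norm.ofReal
    have hm : MemLp (fun s => ((‖a s‖ : ℝ) : ℂ) + ((‖b s‖ : ℝ) : ℂ)) 2 volume := ha'.add hb'
    have hle : ∀ s, ‖c s‖ ≤ L * ‖((‖a s‖ : ℝ) : ℂ) + ((‖b s‖ : ℝ) : ℂ)‖ := fun s => by
      rw [← Complex.ofReal_add, Complex.norm_real, Real.norm_of_nonneg (by positivity)]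
      exact h s
    refine ⟨hm.of_le_mul hc.aestronglyMeasurable (ae_of_all _ hle), ?_⟩
    refine (l2norm_le_mul hm hL (ae_of_all _ hle)).trans ?_
    refine mul_le_mul_of_nonneg_left ((l2norm_add_le ha' hb').trans_eq ?_) hL
    congr 1 <;> exact l2norm_congr_norm fun s => by simp
  obtain ⟨C, hC, hdf⟩ := hf.exists_diff_le
  obtain ⟨D, hD, hdg⟩ := hg.exists_diff_le
  refine ⟨hk, (key hf.memLp hg.memLp hk h1).1, L * (C + D), by positivity, fun h => ?_⟩
  refine ((key ((IsFourierPair.memLp_comp_add hf.memLp h).sub hf.memLp)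
    ((IsFourierPair.memLp_comp_add hg.memLp h).sub hg.memLp)
    (by fun_prop) fun s => h2 (s + h) s).2).trans ?_
  have h1 := hdf h
  have h2 := hdg h
  calc _ ≤ L * (C * |h| + D * |h|) := by gcongr <;> assumption
    _ = _ := by ring

theorem add (hf : IsH1 f) (hg : IsH1 g) : IsH1 (fun s => f s + g s) := by
  refine hf.of_le hg (hf.continuous.add hg.continuous) zero_le_one (fun s => ?_) fun s t => ?_
  · rw [one_mul]; exact norm_add_le _ _
  · rw [one_mul, add_sub_add_comm]; exact norm_add_le _ _

theorem const_mul (hf : IsH1 f) (c : ℂ) : IsH1 (fun s => c * f s) := by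
  refine hf.of_le hf (continuous_const.mul hf.continuous) (norm_nonneg c)
    (fun s => ?_) fun s t => ?_
  · rw [norm_mul]; gcongr; simp
  · rw [← mul_sub, norm_mul]; gcongr; simp

theorem neg (hf : IsH1 f) : IsH1 (fun s => -f s) := by simpa using hf.const_mul (-1)

theorem zero : IsH1 (fun _ => 0) :=
  ⟨continuous_const, MemLp.zero', 0, le_rfl, fun h => by simp [l2norm]⟩

theorem sum {ι : Type*} (s : Finset ι) {f : ι → ℝ → ℂ} (h : ∀ i ∈ s, IsH1 (f i)) :
    IsH1 (fun x => ∑ i ∈ s, f i x) := by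
  classical
  induction s using Finset.induction_on with
  | empty => simpa using zero
  | insert a s ha ih =>
    simp only [Finset.sum_insert ha]
    exact (h a (by simp)).add (ih fun i hi => h i (by simp [hi]))

protected theorem star (hf : IsH1 f) : IsH1 (fun s => conj (f s)) := by
  refine hf.of_le hf (Complex.continuous_conj.comp hf.continuous) zero_le_one
    (fun s => ?_) fun s t => ?_
  · simp
  · rw [← map_sub, RCLike.norm_conj]; simp

theorem mul (hf : IsH1 f) (hg : IsH1 g) : IsH1 (fun s => f s * g s) := by
  obtain ⟨A, hA, ha⟩ := hf.bounded
  obtain ⟨B, hB, hb⟩ := hg.bounded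
  refine hf.of_le hg (hf.continuous.mul hg.continuous) (add_nonneg hA hB)
    (fun s => ?_) fun s t => ?_
  · rw [norm_mul]
    nlinarith [ha s, hb s, norm_nonneg (f s), norm_nonneg (g s),
      mul_nonneg hB (norm_nonneg (f s)), mul_nonneg hB (norm_nonneg (g s))]
  · have : f s * g s - f t * g t = f s * (g s - g t) + (f s - f t) * g t := by ring
    rw [this]
    refine (norm_add_le _ _).trans ?_
    rw [norm_mul, norm_mul]
    nlinarith [mul_le_mul_of_nonneg_right (ha s) (norm_nonneg (g s - g t)),
      mul_le_mul_of_nonneg_left (hb t) (norm_nonneg (f s - f t)),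
      mul_nonneg hA (norm_nonneg (f s - f t)), mul_nonneg hB (norm_nonneg (g s - g t))]

theorem cexp_mul (hf : IsH1 f) (a : ℝ) :
    IsH1 (fun s : ℝ => Complex.exp (2 * Real.pi * Complex.I * a * s) * f s) := by
  obtain ⟨F, h⟩ := IsFourierPair.of_memLp hf.memLp
  have hc := hf.continuous
  refine of_fourier (by fun_prop) (h.cexp_mul a) ?_
  have h1 := IsFourierPair.memLp_comp_add (hf.memLp_mul_fourier h) (-a)
  have h2 := (IsFourierPair.memLp_comp_add h.right (-a)).const_mul (2 * Real.pi * Complex.I * a)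
  refine (h1.add h2).ae_eq ?_
  filter_upwards with ξ
  simp only [Pi.add_apply, ← sub_eq_add_neg]
  push_cast; ring

end IsH1

/-- `f b - f a = ∫ g` with `g ∈ L²` bounds the difference quotients of `f`. -/
theorem eLpNorm_diff_le {f g : ℝ → ℂ} (hg : MemLp g 2 volume)
    (h : ∀ a b : ℝ, f b - f a = ∫ t in a..b, g t) (a : ℝ) (ha : 0 ≤ a) :
    eLpNorm (fun s => f (s + a) - f s) 2 volume ≤ ENNReal.ofReal a * eLpNorm g 2 volume := by
  have e2 : ∀ k : ℝ → ℂ, eLpNorm k 2 volume = (∫⁻ s, ‖k s‖ₑ ^ (2 : ℝ)) ^ (1 / (2 : ℝ)) := fun k => by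
    rw [eLpNorm_eq_lintegral_rpow_enorm_toReal (by norm_num) (by norm_num)]; simp
  -- the Cauchy–Schwarz inequality on an interval of length `a`
  have hpt : ∀ s, ‖f (s + a) - f s‖ₑ ^ (2 : ℝ) ≤
      ENNReal.ofReal a * ∫⁻ t in Set.Ioc 0 a, ‖g (s + t)‖ₑ ^ (2 : ℝ) := by
    intro s
    have h1 : ‖f (s + a) - f s‖ₑ ≤ ∫⁻ t in Set.Ioc 0 a, ‖g (s + t)‖ₑ := by
      rw [h s (s + a)]
      have : ∫ t in s..(s + a), g t = ∫ t in (0 : ℝ)..a, g (s + t) := by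
        rw [intervalIntegral.integral_comp_add_left]; simp
      rw [this, intervalIntegral.integral_of_le ha]
      exact enorm_integral_le_lintegral_enorm _
    have hm : AEMeasurable (fun t => ‖g (s + t)‖ₑ) (volume.restrict (Set.Ioc 0 a)) :=
      ((hg.1.comp_measurePreserving (measurePreserving_add_left volume s)).enorm).restrict
    have h2 := ENNReal.lintegral_mul_le_Lp_mul_Lq (volume.restrict (Set.Ioc 0 a))
      Real.HolderConjugate.two_two (f := fun _ => 1) (g := fun t => ‖g (s + t)‖ₑ)
      aemeasurable_const hm
    simp only [Pi.mul_apply, one_mul, ENNReal.one_rpow, lintegral_const, one_mul,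
      Measure.restrict_apply_univ, Real.volume_Ioc, sub_zero] at h2
    calc ‖f (s + a) - f s‖ₑ ^ (2 : ℝ) ≤ (ENNReal.ofReal a ^ (1 / (2 : ℝ)) *
          (∫⁻ t in Set.Ioc 0 a, ‖g (s + t)‖ₑ ^ (2 : ℝ)) ^ (1 / (2 : ℝ))) ^ (2 : ℝ) := by
          gcongr; exact h1.trans h2
      _ = _ := by
          rw [ENNReal.mul_rpow_of_nonneg _ _ (by norm_num), ← ENNReal.rpow_mul, ← ENNReal.rpow_mul]
          norm_num
  have hint : ∫⁻ s, ‖f (s + a) - f s‖ₑ ^ (2 : ℝ) ≤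
      ENNReal.ofReal a ^ (2 : ℝ) * ∫⁻ s, ‖g s‖ₑ ^ (2 : ℝ) := by
    calc _ ≤ ∫⁻ s, ENNReal.ofReal a * ∫⁻ t in Set.Ioc 0 a, ‖g (s + t)‖ₑ ^ (2 : ℝ) :=
          lintegral_mono hpt
      _ = ENNReal.ofReal a * ∫⁻ s, ∫⁻ t in Set.Ioc 0 a, ‖g (s + t)‖ₑ ^ (2 : ℝ) :=
          lintegral_const_mul' _ _ ENNReal.ofReal_ne_top
      _ = ENNReal.ofReal a * ∫⁻ t in Set.Ioc 0 a, ∫⁻ s, ‖g (s + t)‖ₑ ^ (2 : ℝ) := by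
          rw [lintegral_lintegral_swap]
          have hq : AEStronglyMeasurable (fun p : ℝ × ℝ => g (p.1 + p.2))
              (volume.prod (volume.restrict (Set.Ioc 0 a))) := by
            have : AEStronglyMeasurable (fun p : ℝ × ℝ => g (p.1 + p.2))
                (volume.prod volume) :=
              hg.1.comp_quasiMeasurePreserving (quasiMeasurePreserving_add volume volume)
            refine this.mono_ac ?_
            exact Measure.AbsolutelyContinuous.rfl.prod Measure.absolutelyContinuous_restrict
          exact hq.enorm.pow_const _
      _ = ENNReal.ofReal a * ∫⁻ t in Set.Ioc 0 a, ∫⁻ s, ‖g s‖ₑ ^ (2 : ℝ) := by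
          congr 2; ext t
          exact lintegral_add_right_eq_self (fun s => ‖g s‖ₑ ^ (2 : ℝ)) t
      _ = _ := by
          rw [lintegral_const, Measure.restrict_apply_univ, Real.volume_Ioc, sub_zero,
            ENNReal.rpow_two]
          ring
  rw [e2, e2]
  calc _ ≤ (ENNReal.ofReal a ^ (2 : ℝ) * ∫⁻ s, ‖g s‖ₑ ^ (2 : ℝ)) ^ (1 / (2 : ℝ)) := by gcongr
    _ = _ := by
      rw [ENNReal.mul_rpow_of_nonneg _ _ (by norm_num), ← ENNReal.rpow_mul]; norm_num

theorem MemH1.isH1 {f : ℝ → ℂ} (hf : MemH1 f) : IsH1 f := by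
  obtain ⟨hf2, g, hg, h⟩ := hf
  have hloc : LocallyIntegrable g := hg.locallyIntegrable (by norm_num)
  have hc : Continuous f := by
    have : f = fun b => f 0 + ∫ t in (0 : ℝ)..b, g t := by
      ext b; rw [← h 0 b]; ring
    rw [this]
    exact continuous_const.add (intervalIntegral.continuous_primitive
      (fun a b => intervalIntegrable_iff.2
        ((hloc.integrableOn_isCompact isCompact_uIcc).mono_set Set.uIoc_subset_uIcc)) 0)
  have key : ∀ a, 0 ≤ a → l2norm (fun s => f (s + a) - f s) ≤ l2norm g * a := by
    intro a ha
    have h1 := ENNReal.toReal_mono (ENNReal.mul_ne_top ENNReal.ofReal_ne_top hg.eLpNorm_ne_top)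
      (eLpNorm_diff_le hg h a ha)
    rw [ENNReal.toReal_mul, ENNReal.toReal_ofReal ha, mul_comm] at h1
    exact h1
  refine ⟨hc, hf2, l2norm g, l2norm_nonneg g, fun a => ?_⟩
  rcases le_total 0 a with ha | ha
  · rw [abs_of_nonneg ha]; exact key a ha
  · rw [abs_of_nonpos ha]
    refine le_of_eq_of_le ?_ (key (-a) (by linarith))
    have e := IsFourierPair.eLpNorm_comp_add (fun s => f (s + a) - f s) (by fun_prop) (-a)
    rw [l2norm, ← e]
    apply congrArg
    apply eLpNorm_congr_norm_ae
    filter_upwards with s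
    rw [neg_add_cancel_right, norm_sub_rev]

/-! ### Hardy spaces -/

/-- The Hardy space of the lower half plane: functions in `L²(ℝ)` whose transform lives on the
negative half line. -/
def LowerHardy (f : ℝ → ℂ) : Prop :=
  ∃ F, IsFourierPair f F ∧ ∀ᵐ ξ : ℝ, 0 < ξ → F ξ = 0

/-- The Hardy space of the upper half plane: functions in `L²(ℝ)` whose transform lives on the
positive half line. -/
def UpperHardy (f : ℝ → ℂ) : Prop :=
  ∃ F, IsFourierPair f F ∧ ∀ᵐ ξ : ℝ, ξ < 0 → F ξ = 0

section Hardy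
variable {f g F G : ℝ → ℂ}

theorem LowerHardy.memLp (hf : LowerHardy f) : MemLp f 2 volume := hf.choose_spec.1.left
theorem UpperHardy.memLp (hf : UpperHardy f) : MemLp f 2 volume := hf.choose_spec.1.left

theorem LowerHardy.fourier_eq_zero (hf : LowerHardy f) (h : IsFourierPair f F) :
    ∀ᵐ ξ : ℝ, 0 < ξ → F ξ = 0 := by
  obtain ⟨F', h', h0⟩ := hf
  filter_upwards [h0, h.unique h'] with ξ h1 h2 hξ
  rw [h2, h1 hξ]

theorem UpperHardy.fourier_eq_zero (hf : UpperHardy f) (h : IsFourierPair f F) :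
    ∀ᵐ ξ : ℝ, ξ < 0 → F ξ = 0 := by
  obtain ⟨F', h', h0⟩ := hf
  filter_upwards [h0, h.unique h'] with ξ h1 h2 hξ
  rw [h2, h1 hξ]

theorem LowerHardy.add (hf : LowerHardy f) (hg : LowerHardy g) :
    LowerHardy (fun s => f s + g s) := by
  obtain ⟨F, h, h0⟩ := hf
  obtain ⟨G, h', h0'⟩ := hg
  refine ⟨_, h.add h', ?_⟩
  filter_upwards [h0, h0'] with ξ h1 h2 hξ
  rw [h1 hξ, h2 hξ, add_zero]

theorem UpperHardy.add (hf : UpperHardy f) (hg : UpperHardy g) :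
    UpperHardy (fun s => f s + g s) := by
  obtain ⟨F, h, h0⟩ := hf
  obtain ⟨G, h', h0'⟩ := hg
  refine ⟨_, h.add h', ?_⟩
  filter_upwards [h0, h0'] with ξ h1 h2 hξ
  rw [h1 hξ, h2 hξ, add_zero]

theorem LowerHardy.neg (hf : LowerHardy f) : LowerHardy (fun s => -f s) := by
  obtain ⟨F, h, h0⟩ := hf
  refine ⟨_, h.neg, ?_⟩
  filter_upwards [h0] with ξ h1 hξ
  rw [h1 hξ, neg_zero]

theorem UpperHardy.neg (hf : UpperHardy f) : UpperHardy (fun s => -f s) := by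
  obtain ⟨F, h, h0⟩ := hf
  refine ⟨_, h.neg, ?_⟩
  filter_upwards [h0] with ξ h1 hξ
  rw [h1 hξ, neg_zero]

theorem LowerHardy.sub (hf : LowerHardy f) (hg : LowerHardy g) :
    LowerHardy (fun s => f s - g s) := by
  simpa [sub_eq_add_neg] using hf.add hg.neg

theorem UpperHardy.sub (hf : UpperHardy f) (hg : UpperHardy g) :
    UpperHardy (fun s => f s - g s) := by
  simpa [sub_eq_add_neg] using hf.add hg.neg

theorem LowerHardy.integral_mul_eq_zero (hf : LowerHardy f) (hg : LowerHardy g) :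
    ∫ s, f s * g s = 0 := by
  obtain ⟨F, h, h0⟩ := hf
  obtain ⟨G, h', h0'⟩ := hg
  rw [h.integral_mul h']
  have hn := (Measure.measurePreserving_neg (volume : Measure ℝ)).quasiMeasurePreserving.ae h0
  refine integral_eq_zero_of_ae ?_
  filter_upwards [hn, h0', Measure.ae_ne volume (0 : ℝ)] with ξ h1 h2 h3
  rcases lt_or_gt_of_ne h3 with h4 | h4
  · simp [h1 (by linarith)]
  · simp [h2 h4]

theorem UpperHardy.integral_mul_eq_zero (hf : UpperHardy f) (hg : UpperHardy g) :
    ∫ s, f s * g s = 0 := by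
  obtain ⟨F, h, h0⟩ := hf
  obtain ⟨G, h', h0'⟩ := hg
  rw [h.integral_mul h']
  have hn := (Measure.measurePreserving_neg (volume : Measure ℝ)).quasiMeasurePreserving.ae h0
  refine integral_eq_zero_of_ae ?_
  filter_upwards [hn, h0', Measure.ae_ne volume (0 : ℝ)] with ξ h1 h2 h3
  rcases lt_or_gt_of_ne h3 with h4 | h4
  · simp [h2 h4]
  · simp [h1 (by linarith)]

/-- The two Hardy spaces are orthogonal. -/
theorem UpperHardy.integral_mul_conj_eq_zero (hf : UpperHardy f) (hg : LowerHardy g) :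
    ∫ s, f s * conj (g s) = 0 := by
  refine hf.integral_mul_eq_zero ?_
  obtain ⟨G, h', h0'⟩ := hg
  refine ⟨_, h'.conj', ?_⟩
  have hn := (Measure.measurePreserving_neg (volume : Measure ℝ)).quasiMeasurePreserving.ae h0'
  filter_upwards [hn] with ξ h1 hξ
  rw [h1 (by linarith), map_zero]

/-- The orthogonal splitting of `L²(ℝ)` into the two Hardy spaces. -/
theorem exists_hardy_splitting (h : IsFourierPair f F) : ∃ a b : ℝ → ℂ,
    LowerHardy a ∧ UpperHardy b ∧ (∀ s, f s = a s + b s) ∧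
    l2norm a = l2norm ((Set.Iio 0).indicator F) ∧ l2norm b = l2norm ((Set.Ici 0).indicator F) := by
  have hm : MemLp ((Set.Iio 0).indicator F) 2 volume := h.right.indicator measurableSet_Iio
  obtain ⟨a, ha⟩ := IsFourierPair.of_memLp_right hm
  have hb := h.sub ha
  have e : (fun ξ => F ξ - (Set.Iio 0).indicator F ξ) = (Set.Ici 0).indicator F := by
    rw [← Set.compl_Iio, Set.indicator_compl]; rfl
  rw [e] at hb
  refine ⟨a, fun s => f s - a s, ⟨_, ha, ?_⟩, ⟨_, hb, ?_⟩, fun s => by ring, ha.l2norm_eq.symm,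
    hb.l2norm_eq.symm⟩
  · exact ae_of_all _ fun ξ hξ => Set.indicator_of_notMem (by simpa using hξ.le) _
  · exact ae_of_all _ fun ξ hξ => Set.indicator_of_notMem (by simpa using hξ) _

end Hardy

/-! ### Toeplitz systems -/

/-- Conjugation with `κ + d/ds` turns multiplication by `E` into multiplication by `E` plus
multiplication by `E'` after inversion of `κ + d/ds`; on the transform side this is the identity
`κ + 2πiξ = (κ + 2πiη) + 2πi(ξ - η)` under the convolution integral. -/
theorem fourierPair_dsym_mul {E E' p m Eh ph : ℝ → ℂ} {κ : ℝ} (hκ : 0 < κ) (hE : IsH1 E)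
    (hm : IsH1 m) (hEh : IsFourierPair E Eh)
    (hE' : IsFourierPair E' (fun ξ : ℝ => 2 * Real.pi * Complex.I * ξ * Eh ξ))
    (hp : IsFourierPair p ph) (hmh : IsFourierPair m (fun ξ => (dsym κ ξ)⁻¹ * ph ξ)) :
    IsFourierPair (fun s => E s * m s) (𝓕 fun s => E s * m s) ∧
    IsFourierPair (fun s => E s * p s + E' s * m s)
      (fun ξ => dsym κ ξ * 𝓕 (fun s => E s * m s) ξ) := by
  obtain ⟨B, -, hB⟩ := hE.bounded
  obtain ⟨B', -, hB'⟩ := hm.bounded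
  have i1 := integrable_mul_of_memLp hE.memLp hp.left
  have l1 : MemLp (fun s => E s * p s) 2 volume :=
    memLp_mul_bdd hp.left hE.continuous.aestronglyMeasurable hB
  have i2 := integrable_mul_of_memLp hE'.left hm.memLp
  have l2 : MemLp (fun s => E' s * m s) 2 volume := by
    simpa [mul_comm] using memLp_mul_bdd hE'.left hm.continuous.aestronglyMeasurable hB'
  refine ⟨.of_integrable (integrable_mul_of_memLp hE.memLp hm.memLp) (hE.mul hm).memLp, ?_⟩
  refine ((IsFourierPair.of_integrable i1 l1).add (.of_integrable i2 l2)).congr (ae_eq_refl _)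
    (ae_of_all _ fun ξ => ?_)
  show 𝓕 (fun s => E s * p s) ξ + 𝓕 (fun s => E' s * m s) ξ = dsym κ ξ * 𝓕 (fun s => E s * m s) ξ
  have hr : ∀ k : ℝ → ℂ, MemLp k 2 volume → MemLp (fun η => k (ξ - η)) 2 volume := fun k hk =>
    hk.comp_measurePreserving (Measure.measurePreserving_sub_left volume ξ)
  rw [hEh.fourier_mul hp, hE'.fourier_mul hmh, hEh.fourier_mul hmh, ← integral_const_mul,
    ← integral_add]
  · congr 1; ext η
    have e : dsym κ ξ = dsym κ η + 2 * Real.pi * Complex.I * ((ξ - η : ℝ) : ℂ) := by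
      simp only [dsym]; push_cast; ring
    have e2 : ph η = dsym κ η * ((dsym κ η)⁻¹ * ph η) := by
      rw [mul_inv_cancel_left₀ (dsym_ne_zero hκ η)]
    generalize (dsym κ η)⁻¹ * ph η = q at e2 ⊢
    rw [e2, e]; ring
  · exact integrable_mul_of_memLp (hr _ hEh.right) hp.right
  · exact integrable_mul_of_memLp (hr _ hE'.right) hmh.right

/-- `L²(ℝ)` as a Hilbert space. -/
abbrev L2R : Type := Lp ℂ 2 (volume : Measure ℝ)

theorem IsFourierPair.coe (φ : L2R) : IsFourierPair φ (𝓕 φ : L2R) := by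
  refine ⟨Lp.memLp _, Lp.memLp _, ?_⟩
  rw [Lp.toLp_coeFn, Lp.toLp_coeFn]

theorem L2R.norm_eq (φ : L2R) : ‖φ‖ = l2norm φ := rfl

theorem exists_mulOp {w : ℝ → ℂ} (hw : AEStronglyMeasurable w volume) {B : ℝ}
    (hB : ∀ s, ‖w s‖ ≤ B) : ∃ T : L2R →L[ℂ] L2R, ∀ φ : L2R, T φ =ᵐ[volume] fun s => w s * φ s := by
  have hm : ∀ φ : L2R, MemLp (fun s => w s * φ s) 2 volume := fun φ =>
    memLp_mul_bdd (Lp.memLp φ) hw hB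
  let T : L2R →ₗ[ℂ] L2R :=
    { toFun := fun φ => (hm φ).toLp _
      map_add' := fun φ ψ => by
        rw [← MemLp.toLp_add]
        apply MemLp.toLp_congr
        filter_upwards [Lp.coeFn_add φ ψ] with s hs
        simp only [Pi.add_apply, hs]; ring
      map_smul' := fun c φ => by
        rw [RingHom.id_apply, ← MemLp.toLp_const_smul]
        apply MemLp.toLp_congr
        filter_upwards [Lp.coeFn_smul c φ] with s hs
        simp only [Pi.smul_apply, hs, smul_eq_mul]; ring }
  have hT : ∀ φ, T φ =ᵐ[volume] fun s => w s * φ s := fun φ => (hm φ).coeFn_toLp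
  refine ⟨T.mkContinuous B fun φ => ?_, hT⟩
  have hB0 : 0 ≤ B := (norm_nonneg _).trans (hB 0)
  rw [L2R.norm_eq, L2R.norm_eq, l2norm_congr (hT φ)]
  refine l2norm_le_mul (Lp.memLp φ) hB0 (ae_of_all _ fun s => ?_)
  rw [norm_mul]
  exact mul_le_mul_of_nonneg_right (hB s) (norm_nonneg _)

/-- Inversion of `κ + d/ds` followed by multiplication with an `L²` function is bounded on `L²`,
with a norm that tends to zero as `κ → ∞`. -/
theorem exists_mulInvOp {e : ℝ → ℂ} (he : MemLp e 2 volume) {κ : ℝ} (hκ : 0 < κ) :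
    ∃ R : L2R →L[ℂ] L2R, ‖R‖ ≤ √(1 / (2 * κ)) * l2norm e ∧ ∀ φ : L2R, R φ =ᵐ[volume] fun s =>
      e s * 𝓕⁻ (fun ξ => (dsym κ ξ)⁻¹ * (𝓕 φ : L2R) ξ) s := by
  have hi : ∀ φ : L2R, Integrable (fun ξ => (dsym κ ξ)⁻¹ * φ ξ) := fun φ =>
    integrable_dsym_inv_mul hκ (Lp.memLp φ)
  have hb : ∀ (φ : L2R) (s : ℝ), ‖𝓕⁻ (fun ξ => (dsym κ ξ)⁻¹ * (𝓕 φ : L2R) ξ) s‖ ≤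
      √(1 / (2 * κ)) * ‖φ‖ := fun φ s => by
    refine (norm_fourierInv_le _ s).trans ?_
    refine (integral_norm_mul_le (memLp_dsym_inv hκ) (Lp.memLp _)).trans_eq ?_
    rw [l2norm_dsym_inv hκ, ← L2R.norm_eq, Lp.norm_fourier_eq]
  have hm : ∀ φ : L2R, MemLp (fun s => e s * 𝓕⁻ (fun ξ => (dsym κ ξ)⁻¹ * (𝓕 φ : L2R) ξ) s) 2
      volume := fun φ => by
    simpa only [mul_comm] using memLp_mul_bdd he
      (continuous_fourierInv (hi (𝓕 φ))).aestronglyMeasurable (hb φ)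
  let R : L2R →ₗ[ℂ] L2R :=
    { toFun := fun φ => (hm φ).toLp _
      map_add' := fun φ ψ => by
        rw [← MemLp.toLp_add]
        apply MemLp.toLp_congr
        filter_upwards with s
        simp only [Pi.add_apply, ← mul_add]
        congr 1
        have i : ∀ φ : L2R, Integrable (fun ξ : ℝ => Complex.exp (2 * Real.pi * Complex.I * s * ξ) *
            ((dsym κ ξ)⁻¹ * φ ξ)) := fun φ =>
          (hi φ).bdd_mul (c := 1) (by fun_prop)
            (ae_of_all _ fun ξ => (IsFourierPair.norm_cexp_two_pi s ξ).le)
        rw [fourierInv_eq_integral, fourierInv_eq_integral, fourierInv_eq_integral,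
          ← integral_add (i _) (i _), FourierTransform.fourier_add]
        apply integral_congr_ae
        filter_upwards [Lp.coeFn_add (𝓕 φ) (𝓕 ψ)] with ξ hξ
        simp only [hξ, Pi.add_apply]; ring
      map_smul' := fun c φ => by
        rw [RingHom.id_apply, ← MemLp.toLp_const_smul]
        apply MemLp.toLp_congr
        filter_upwards with s
        simp only [Pi.smul_apply, smul_eq_mul, mul_left_comm c]
        congr 1
        rw [fourierInv_eq_integral, fourierInv_eq_integral, FourierTransform.fourier_smul,
          ← integral_const_mul]
        apply integral_congr_ae
        filter_upwards [Lp.coeFn_smul c (𝓕 φ)] with ξ hξ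
        simp only [hξ, Pi.smul_apply, smul_eq_mul]; ring }
  have hRφ : ∀ φ, R φ =ᵐ[volume] fun s => e s * 𝓕⁻ (fun ξ => (dsym κ ξ)⁻¹ * (𝓕 φ : L2R) ξ) s :=
    fun φ => (hm φ).coeFn_toLp
  have hR : ∀ φ, ‖R φ‖ ≤ √(1 / (2 * κ)) * l2norm e * ‖φ‖ := fun φ => by
    rw [L2R.norm_eq, l2norm_congr (hRφ φ), mul_right_comm]
    refine l2norm_le_mul he (by positivity) (ae_of_all _ fun s => ?_)
    rw [norm_mul, mul_comm]
    exact mul_le_mul_of_nonneg_right (hb φ s) (norm_nonneg _)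
  exact ⟨R.mkContinuous _ hR, LinearMap.mkContinuous_norm_le _
    (mul_nonneg (Real.sqrt_nonneg _) (l2norm_nonneg _)) _, hRφ⟩

/-- The orthogonal projection onto the Hardy space of the lower half plane. -/
theorem exists_lowerProj : ∃ P : L2R →L[ℂ] L2R,
    (∀ φ : L2R, (𝓕 (P φ) : L2R) =ᵐ[volume] (Set.Iio 0).indicator (𝓕 φ : L2R)) ∧
    (∀ φ, P (P φ) = P φ) ∧ ∀ φ ψ : L2R, inner ℂ (P φ) ψ = inner ℂ φ (P ψ) := by
  obtain ⟨T, hT⟩ := exists_mulOp (w := (Set.Iio (0 : ℝ)).indicator fun _ => (1 : ℂ)) (B := 1)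
    ((measurable_const.indicator measurableSet_Iio).aestronglyMeasurable) (fun s => by
      by_cases h : s ∈ Set.Iio (0 : ℝ) <;> simp [h])
  let 𝔉 := (Lp.fourierTransformₗᵢ ℝ ℂ)
  let P : L2R →L[ℂ] L2R := 𝔉.symm.toContinuousLinearEquiv.toContinuousLinearMap ∘L T ∘L
    𝔉.toContinuousLinearEquiv.toContinuousLinearMap
  have h1 : ∀ φ, 𝓕 (P φ) = T (𝓕 φ) := fun φ => 𝔉.apply_symm_apply _
  have h2 : ∀ φ : L2R, T φ =ᵐ[volume] (Set.Iio 0).indicator φ := fun φ => by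
    filter_upwards [hT φ] with s hs
    rw [hs]
    by_cases h : s ∈ Set.Iio (0 : ℝ) <;> simp [h]
  have h3 : ∀ φ, T (T φ) = T φ := fun φ => by
    apply Lp.ext
    filter_upwards [h2 (T φ), h2 φ] with s h4 h5
    rw [h4]
    by_cases h : s ∈ Set.Iio (0 : ℝ)
    · rw [Set.indicator_of_mem h]
    · rw [Set.indicator_of_notMem h, h5, Set.indicator_of_notMem h]
  have hinj : Function.Injective (fun φ : L2R => 𝓕 φ) := 𝔉.injective
  refine ⟨P, fun φ => ?_, fun φ => ?_, fun φ ψ => ?_⟩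
  · rw [h1]; exact h2 _
  · apply hinj
    simp only [h1, h3]
  · rw [← Lp.inner_fourier_eq, ← Lp.inner_fourier_eq φ, h1, h1, MeasureTheory.L2.inner_def,
      MeasureTheory.L2.inner_def]
    apply integral_congr_ae
    filter_upwards [h2 (𝓕 φ), h2 (𝓕 ψ)] with s h4 h5
    rw [h4, h5]
    by_cases h : s ∈ Set.Iio (0 : ℝ) <;> simp [h]

/-- Coercivity passes from a matrix symbol to the quadratic form on `L²`. -/
theorem coercive_integral {ι : Type*} [Fintype ι] {W : ι → ι → ℝ → ℂ} {c : ℝ}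
    {p q : ι → ℝ → ℂ} (hp : ∀ k, MemLp (p k) 2 volume) (hq : ∀ k, MemLp (q k) 2 volume)
    (hpq : ∀ k, ∀ᵐ s, q k s = ∑ l, p l s * W l k s)
    (hc : ∀ (s : ℝ) (w : ι → ℂ),
      c * ∑ k, ‖w k‖ ^ 2 ≤ (∑ k, (∑ l, w l * W l k s) * conj (w k)).re) :
    c * ∑ k, l2norm (p k) ^ 2 ≤ (∑ k, ∫ s, q k s * conj (p k s)).re := by
  have i1 : ∀ k, Integrable (fun s => ‖p k s‖ ^ 2) := fun k => (hp k).integrable_norm_pow (by norm_num)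
  have hcj : ∀ k, MemLp (fun s => conj (p k s)) 2 volume := fun k =>
    (hp k).of_le (Complex.continuous_conj.comp_aestronglyMeasurable (hp k).1)
      (ae_of_all _ fun s => by simp)
  have i2 : ∀ k, Integrable (fun s => q k s * conj (p k s)) := fun k =>
    integrable_mul_of_memLp (hq k) (hcj k)
  rw [← integral_finsetSum _ fun k _ => i2 k]
  have e : (∫ s, ∑ k, q k s * conj (p k s)).re = ∫ s, (∑ k, q k s * conj (p k s)).re :=
    (integral_re (𝕜 := ℂ) (integrable_finsetSum _ fun k _ => i2 k)).symm
  have e2 : ∀ k, l2norm (p k) ^ 2 = ∫ s, ‖p k s‖ ^ 2 := fun k => l2norm_sq (hp k)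
  simp only [e, e2]
  rw [← integral_finsetSum _ fun k _ => i1 k, ← integral_const_mul]
  refine integral_mono_ae ((integrable_finsetSum _ fun k _ => i1 k).const_mul _)
    (integrable_finsetSum _ fun k _ => i2 k).re ?_
  have hall : ∀ᵐ s, ∀ k, q k s = ∑ l, p l s * W l k s := ae_all_iff.2 hpq
  filter_upwards [hall] with s hs
  simp only [hs]
  exact hc s fun k => p k s

/-- A system of operators on `L²` with coercive quadratic form stays solvable after compression by
an orthogonal projection. -/
theorem exists_compression_solution {ι : Type*} [Fintype ι] {P : L2R →L[ℂ] L2R}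
    (hPP : ∀ φ, P (P φ) = P φ) (hPs : ∀ φ ψ : L2R, inner ℂ (P φ) ψ = inner ℂ φ (P ψ))
    (N : ι → ι → L2R →L[ℂ] L2R) {c : ℝ} (hc0 : 0 < c)
    (hN : ∀ p : ι → L2R, c * ∑ k, ‖p k‖ ^ 2 ≤ (∑ k, inner ℂ (∑ l, N l k (p l)) (p k)).re)
    (G : ι → L2R) (hG : ∀ k, P (G k) = G k) :
    ∃ p : ι → L2R, (∀ k, P (p k) = p k) ∧ ∀ k, P (∑ l, N l k (p l)) = G k := by
  let K := PiLp 2 fun _ : ι => L2R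
  -- The compression is completed by the identity on the orthogonal complement of the range.
  let A : K →L[ℂ] K := (PiLp.continuousLinearEquiv 2 ℂ fun _ : ι => L2R).symm.toContinuousLinearMap ∘L
    ContinuousLinearMap.pi fun k =>
      (∑ l, P ∘L N l k ∘L P ∘L PiLp.proj 2 (fun _ : ι => L2R) l) +
        (1 - P) ∘L PiLp.proj 2 (fun _ : ι => L2R) k
  have hA : ∀ (x : K) k, A x k = P (∑ l, N l k (P (x l))) + (x k - P (x k)) := fun x k => by
    simp only [A, ContinuousLinearMap.comp_apply, ContinuousLinearEquiv.coe_coe,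
      PiLp.continuousLinearEquiv_symm_apply, ContinuousLinearMap.pi_apply,
      add_apply, sum_apply, sub_apply, one_apply_eq_self, map_sum]
    rfl
  have horth : ∀ φ ψ : L2R, inner ℂ (φ - P φ) (P ψ) = 0 := fun φ ψ => by
    rw [inner_sub_left, hPs, hPP, sub_self]
  have hin : ∀ (x : K) k, inner ℂ (A x k) (x k) =
      inner ℂ (∑ l, N l k (P (x l))) (P (x k)) + ((‖x k - P (x k)‖ ^ 2 : ℝ) : ℂ) := fun x k => by
    rw [hA, inner_add_left, hPs]
    congr 1
    have : x k = (x k - P (x k)) + P (x k) := by abel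
    conv_lhs => rw [this]
    rw [inner_add_right]
    rw [show x k - P (x k) + P (x k) - P (x k - P (x k) + P (x k)) = x k - P (x k) by
      rw [← this]]
    rw [horth, add_zero, inner_self_eq_norm_sq_to_K]
    simp
  have hpyth : ∀ φ : L2R, ‖φ‖ ^ 2 = ‖P φ‖ ^ 2 + ‖φ - P φ‖ ^ 2 := fun φ => by
    have h := norm_add_sq_eq_norm_sq_add_norm_sq_of_inner_eq_zero (𝕜 := ℂ) (φ - P φ) (P φ) (horth φ φ)
    rw [sub_add_cancel] at h
    rw [sq, h]; ring
  have hm0 : 0 < min c 1 := lt_min hc0 one_pos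
  have hunit : IsUnit A := by
    refine ContinuousLinearMap.isUnit_of_forall_le_norm_inner_map A (c := ⟨min c 1, hm0.le⟩) hm0
      fun x => ?_
    refine le_trans ?_ (Complex.re_le_norm _)
    rw [PiLp.inner_apply]
    have e : (∑ k, inner ℂ (A x k) (x k)).re =
        (∑ k, inner ℂ (∑ l, N l k (P (x l))) (P (x k))).re + ∑ k, ‖x k - P (x k)‖ ^ 2 := by
      simp only [hin, Finset.sum_add_distrib, Complex.add_re]
      rw [← Complex.ofReal_sum, Complex.ofReal_re]
    rw [e]
    have h1 := hN fun k => P (x k)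
    have h2 : ‖x‖ ^ 2 = ∑ k, ‖P (x k)‖ ^ 2 + ∑ k, ‖x k - P (x k)‖ ^ 2 := by
      rw [PiLp.norm_sq_eq_of_L2, ← Finset.sum_add_distrib]
      exact Finset.sum_congr rfl fun k _ => hpyth _
    have h3 : 0 ≤ ∑ k, ‖P (x k)‖ ^ 2 := Finset.sum_nonneg fun k _ => by positivity
    have h4 : 0 ≤ ∑ k, ‖x k - P (x k)‖ ^ 2 := Finset.sum_nonneg fun k _ => by positivity
    show ‖x‖ ^ 2 * min c 1 ≤ _
    rw [h2]
    nlinarith [min_le_left c 1, min_le_right c 1, mul_le_mul_of_nonneg_left (min_le_left c 1) h3,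
      mul_le_mul_of_nonneg_left (min_le_right c 1) h4]
  obtain ⟨U, hU⟩ := hunit
  let x : K := (↑U⁻¹ : K →L[ℂ] K) (WithLp.toLp 2 G)
  have hx : A x = WithLp.toLp 2 G := by
    rw [← hU]
    show ((↑U : K →L[ℂ] K) * (↑U⁻¹ : K →L[ℂ] K)) _ = _
    rw [Units.mul_inv]; rfl
  have hx' : ∀ k, P (∑ l, N l k (P (x l))) + (x k - P (x k)) = G k := fun k => by
    rw [← hA, hx]
  refine ⟨fun k => P (x k), fun k => hPP _, fun k => ?_⟩
  have := congrArg P (hx' k)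
  rwa [map_add, map_sub, hPP, hPP, sub_self, add_zero, hG] at this

/-- Solvability of Toeplitz systems in `H¹`: if the matrix symbol `1 + E` has `H¹` entries and
positive definite real part, bounded below, then for every `g ∈ H¹` there is `m ∈ H¹` in the lower
Hardy space such that `m (1 + E) - g` is in the upper Hardy space. -/
theorem exists_toeplitz_solution {ι : Type*} [Fintype ι] [DecidableEq ι] {W E : ι → ι → ℝ → ℂ}
    {g : ι → ℝ → ℂ} (hE : ∀ l k, IsH1 (E l k))
    (hW : ∀ l k s, W l k s = (if l = k then 1 else 0) + E l k s) {c : ℝ} (hc0 : 0 < c)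
    (hc : ∀ (s : ℝ) (w : ι → ℂ),
      c * ∑ k, ‖w k‖ ^ 2 ≤ (∑ k, (∑ l, w l * W l k s) * conj (w k)).re)
    (hg : ∀ k, IsH1 (g k)) :
    ∃ m : ι → ℝ → ℂ, (∀ k, IsH1 (m k)) ∧ (∀ k, LowerHardy (m k)) ∧
      ∀ k, UpperHardy (fun s => ∑ l, m l s * W l k s - g k s) := by
  obtain ⟨P, hP, hPP, hPs⟩ := exists_lowerProj
  choose Eh hEh using fun l k => IsFourierPair.of_memLp (hE l k).memLp
  choose E' hE' using fun l k => IsFourierPair.of_memLp_right ((hE l k).memLp_mul_fourier (hEh l k))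
  choose gh hgh using fun k => IsFourierPair.of_memLp (hg k).memLp
  -- `κ` is so large that the commutator terms are dominated by the coercivity constant.
  obtain ⟨κ, hκ, hκs⟩ : ∃ κ : ℝ, 0 < κ ∧
      ∑ l, ∑ k, √(1 / (2 * κ)) * l2norm (E' l k) ≤ c / 2 := by
    have ht : Tendsto (fun κ : ℝ => ∑ l, ∑ k, √(1 / (2 * κ)) * l2norm (E' l k)) atTop (𝓝 0) := by
      have h0 : Tendsto (fun κ : ℝ => √(1 / (2 * κ))) atTop (𝓝 0) := by
        have : Tendsto (fun κ : ℝ => 1 / (2 * κ)) atTop (𝓝 0) := by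
          refine tendsto_const_nhds.div_atTop (tendsto_id.const_mul_atTop (by norm_num))
        have h := (Real.continuous_sqrt.tendsto 0).comp this
        rwa [Real.sqrt_zero] at h
      have := tendsto_finsetSum (Finset.univ : Finset ι) fun l _ =>
        tendsto_finsetSum (Finset.univ : Finset ι) fun k _ => h0.mul_const (l2norm (E' l k))
      simpa using this
    obtain ⟨κ, h1, h2⟩ := ((ht.eventually (gt_mem_nhds (half_pos hc0))).and
      (eventually_gt_atTop 0)).exists
    exact ⟨κ, h2, h1.le⟩
  have hWb : ∀ l k, ∃ B, ∀ s, ‖W l k s‖ ≤ B := fun l k => by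
    obtain ⟨B, -, hB⟩ := (hE l k).bounded
    refine ⟨1 + B, fun s => ?_⟩
    rw [hW]
    refine (norm_add_le _ _).trans (add_le_add ?_ (hB s))
    split_ifs <;> simp
  have hWc : ∀ l k, Continuous (W l k) := fun l k => by
    rw [funext (hW l k)]
    exact continuous_const.add (hE l k).continuous
  choose B hB using hWb
  choose M hM using fun l k => exists_mulOp (hWc l k).aestronglyMeasurable (hB l k)
  choose R hRn hR using fun l k => exists_mulInvOp (hE' l k).left hκ
  have hcoer : ∀ p : ι → L2R, c / 2 * ∑ k, ‖p k‖ ^ 2 ≤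
      (∑ k, inner ℂ (∑ l, (M l k + R l k) (p l)) (p k)).re := by
    intro p
    have h1 : c * ∑ k, ‖p k‖ ^ 2 ≤ (∑ k, inner ℂ (∑ l, M l k (p l)) (p k)).re := by
      have h := coercive_integral (p := fun k => p k) (q := fun k => (∑ l, M l k (p l) : L2R))
        (W := W) (fun k => Lp.memLp (p k)) (fun k => Lp.memLp _) (fun k => ?_) hc
      · refine h.trans_eq ?_
        rw [Complex.re_sum, Complex.re_sum]
        refine Finset.sum_congr rfl fun k _ => ?_
        rw [← Complex.conj_re, ← integral_conj, MeasureTheory.L2.inner_def]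
        congr 2; ext s
        simp [mul_comm]
      · have ha : ∀ᵐ s, ∀ l, M l k (p l) s = W l k s * p l s := ae_all_iff.2 fun l => hM l k (p l)
        filter_upwards [ha, Lp.coeFn_finsetSum Finset.univ fun l => M l k (p l)] with s h1 h2
        rw [h2, Finset.sum_apply]
        exact Finset.sum_congr rfl fun l _ => by rw [h1, mul_comm]
    have hS : ∀ k, ‖p k‖ ^ 2 ≤ ∑ i, ‖p i‖ ^ 2 := fun k =>
      Finset.single_le_sum (f := fun i => ‖p i‖ ^ 2) (fun i _ => by positivity) (Finset.mem_univ k)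
    have h2 : ‖∑ k, inner ℂ (∑ l, R l k (p l)) (p k)‖ ≤ c / 2 * ∑ k, ‖p k‖ ^ 2 := by
      have hterm : ∀ k l, ‖inner ℂ (R l k (p l)) (p k)‖ ≤
          (√(1 / (2 * κ)) * l2norm (E' l k)) * ∑ i, ‖p i‖ ^ 2 := fun k l => by
        have h3 : ‖p l‖ * ‖p k‖ ≤ ∑ i, ‖p i‖ ^ 2 := by
          nlinarith [hS k, hS l, sq_nonneg (‖p l‖ - ‖p k‖)]
        calc _ ≤ ‖R l k (p l)‖ * ‖p k‖ := norm_inner_le_norm _ _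
          _ ≤ ‖R l k‖ * ‖p l‖ * ‖p k‖ := by gcongr; exact (R l k).le_opNorm _
          _ = ‖R l k‖ * (‖p l‖ * ‖p k‖) := mul_assoc _ _ _
          _ ≤ _ := mul_le_mul (hRn l k) h3 (by positivity)
            (mul_nonneg (Real.sqrt_nonneg _) (l2norm_nonneg _))
      calc _ ≤ ∑ k, ∑ l, ‖inner ℂ (R l k (p l)) (p k)‖ := by
            refine (norm_sum_le _ _).trans (Finset.sum_le_sum fun k _ => ?_)
            rw [sum_inner]
            exact norm_sum_le _ _
        _ ≤ ∑ k, ∑ l, (√(1 / (2 * κ)) * l2norm (E' l k)) * ∑ i, ‖p i‖ ^ 2 :=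
            Finset.sum_le_sum fun k _ => Finset.sum_le_sum fun l _ => hterm k l
        _ = (∑ l, ∑ k, √(1 / (2 * κ)) * l2norm (E' l k)) * ∑ i, ‖p i‖ ^ 2 := by
            rw [Finset.sum_comm, Finset.sum_mul]
            simp only [Finset.sum_mul]
        _ ≤ _ := by gcongr
    have e : ∑ k, inner ℂ (∑ l, (M l k + R l k) (p l)) (p k) =
        ∑ k, inner ℂ (∑ l, M l k (p l)) (p k) + ∑ k, inner ℂ (∑ l, R l k (p l)) (p k) := by
      rw [← Finset.sum_add_distrib]
      refine Finset.sum_congr rfl fun k _ => ?_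
      rw [← inner_add_left, ← Finset.sum_add_distrib]
      rfl
    rw [e, Complex.add_re]
    have h3 := (abs_le.1 ((Complex.abs_re_le_norm _).trans h2)).1
    linarith
  -- The right hand side is the lower Hardy part of `(κ + d/ds) g`.
  have hGex : ∀ k, ∃ G : L2R, P G = G ∧
      ∀ᵐ ξ : ℝ, ξ < 0 → (𝓕 G : L2R) ξ = dsym κ ξ * gh k ξ := fun k => by
    have hm := (hg k).memLp_dsym_mul (hgh k) κ
    refine ⟨P (𝓕⁻ (hm.toLp _)), hPP _, ?_⟩
    filter_upwards [hP (𝓕⁻ (hm.toLp _)), hm.coeFn_toLp] with ξ h1 h2 hξ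
    rw [h1, Set.indicator_of_mem (by simpa using hξ), FourierTransform.fourier_fourierInv_eq, h2]
  choose G hPG hGh using hGex
  obtain ⟨p, hPp, hsol⟩ := exists_compression_solution hPP hPs (fun l k => M l k + R l k)
    (half_pos hc0) hcoer G hPG
  let m : ι → ℝ → ℂ := fun k => 𝓕⁻ fun ξ => (dsym κ ξ)⁻¹ * (𝓕 (p k) : L2R) ξ
  have hm1 : ∀ k, IsH1 (m k) := fun k => (IsH1.of_dsym hκ (Lp.memLp (𝓕 (p k)))).1
  have hmh : ∀ k, IsFourierPair (m k) fun ξ => (dsym κ ξ)⁻¹ * (𝓕 (p k) : L2R) ξ := fun k =>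
    (IsH1.of_dsym hκ (Lp.memLp (𝓕 (p k)))).2
  refine ⟨m, hm1, fun k => ⟨_, hmh k, ?_⟩, fun k => ?_⟩
  · have h := hP (p k)
    rw [hPp] at h
    filter_upwards [h] with ξ h1 hξ
    rw [h1, Set.indicator_of_notMem (by simpa using hξ.le), mul_zero]
  · have key : ∀ l, _ := fun l => fourierPair_dsym_mul hκ (hE l k) (hm1 l) (hEh l k) (hE' l k)
      (IsFourierPair.coe (p l)) (hmh l)
    -- the transform of the solved equation, on the side of `(κ + d/ds) (m W)`
    have hN := IsFourierPair.sum Finset.univ fun l _ =>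
      ((IsFourierPair.coe (p l)).const_mul (if l = k then 1 else 0)).add (key l).2
    have hN2 := IsFourierPair.coe (∑ l, (M l k + R l k) (p l) : L2R)
    have hNeq : (fun x => ∑ l, ((if l = k then 1 else 0) * p l x +
        (E l k x * p l x + E' l k x * m l x))) =ᵐ[volume]
        (∑ l, (M l k + R l k) (p l) : L2R) := by
      have h1 : ∀ᵐ s, ∀ l, M l k (p l) s = W l k s * p l s := ae_all_iff.2 fun l => hM l k (p l)
      have h2 : ∀ᵐ s, ∀ l, R l k (p l) s = E' l k s * m l s := ae_all_iff.2 fun l => hR l k (p l)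
      have h3 : ∀ᵐ s, ∀ l, (M l k (p l) + R l k (p l) : L2R) s =
        M l k (p l) s + R l k (p l) s := ae_all_iff.2 fun l => Lp.coeFn_add _ _
      filter_upwards [h1, h2, h3,
        Lp.coeFn_finsetSum Finset.univ fun l => (M l k + R l k) (p l)] with s h1 h2 h3 h4
      rw [h4, Finset.sum_apply]
      refine Finset.sum_congr rfl fun l _ => ?_
      rw [add_apply, h3, h1, h2, hW]; ring
    have hQ := (IsFourierPair.sum Finset.univ fun l _ =>
      ((hmh l).const_mul (if l = k then 1 else 0)).add (key l).1).sub (hgh k)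
    refine ⟨_, hQ.congr (ae_of_all _ fun s => ?_) (ae_eq_refl _), ?_⟩
    · beta_reduce
      congr 1
      refine Finset.sum_congr rfl fun l _ => ?_
      rw [hW]; ring
    · have h1 := (hN.congr hNeq (ae_eq_refl _)).unique hN2
      have h2 := hP (∑ l, (M l k + R l k) (p l))
      have h3 : P (∑ l, (M l k + R l k) (p l)) = G k := hsol k
      rw [h3] at h2
      filter_upwards [h1, h2, hGh k] with ξ h1 h2 h4 hξ
      rw [Set.indicator_of_mem (by simpa using hξ), ← h1, h4 hξ] at h2
      refine mul_left_cancel₀ (dsym_ne_zero hκ ξ) ?_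
      rw [mul_zero, mul_sub, h2, Finset.mul_sum, ← Finset.sum_sub_distrib]
      refine Finset.sum_eq_zero fun l _ => ?_
      rw [mul_add, mul_left_comm, mul_inv_cancel_left₀ (dsym_ne_zero hκ ξ)]
      ring

/-- The a priori bound for Toeplitz systems: `m W` is paired with `m`, and the upper Hardy part `b`
of the right hand side drops out by orthogonality. -/
theorem toeplitz_bound {ι : Type*} [Fintype ι] {W : ι → ι → ℝ → ℂ} {c : ℝ} (hc0 : 0 < c)
    (hc : ∀ (s : ℝ) (w : ι → ℂ),
      c * ∑ k, ‖w k‖ ^ 2 ≤ (∑ k, (∑ l, w l * W l k s) * conj (w k)).re)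
    {m b e : ι → ℝ → ℂ} (hm : ∀ k, LowerHardy (m k)) (hb : ∀ k, UpperHardy (b k))
    (he : ∀ k, MemLp (e k) 2 volume) (h : ∀ k s, ∑ l, m l s * W l k s = b k s + e k s) (i : ι) :
    l2norm (m i) ≤ c⁻¹ * ∑ k, l2norm (e k) := by
  have h1 := coercive_integral (p := m) (q := fun k s => b k s + e k s) (fun k => (hm k).memLp)
    (fun k => (hb k).memLp.add (he k)) (fun k => ae_of_all _ fun s => (h k s).symm) hc
  have hcj : ∀ k, MemLp (fun s => conj (m k s)) 2 volume := fun k =>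
    (hm k).memLp.of_le (Complex.continuous_conj.comp_aestronglyMeasurable (hm k).memLp.1)
      (ae_of_all _ fun s => by simp)
  have hsplit : ∀ k, ∫ s, (b k s + e k s) * conj (m k s) = ∫ s, e k s * conj (m k s) := fun k => by
    simp only [add_mul]
    rw [integral_add (integrable_mul_of_memLp (hb k).memLp (hcj k))
      (integrable_mul_of_memLp (he k) (hcj k)), (hb k).integral_mul_conj_eq_zero (hm k), zero_add]
  simp only [hsplit] at h1
  set S := √(∑ k, l2norm (m k) ^ 2) with hS
  have hSn : 0 ≤ ∑ k, l2norm (m k) ^ 2 := Finset.sum_nonneg fun k _ => by positivity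
  have hS2 : S ^ 2 = ∑ k, l2norm (m k) ^ 2 := Real.sq_sqrt hSn
  have hle : ∀ k, l2norm (m k) ≤ S := fun k => by
    refine Real.le_sqrt_of_sq_le ?_
    exact Finset.single_le_sum (f := fun i => l2norm (m i) ^ 2) (fun i _ => by positivity)
      (Finset.mem_univ k)
  have h2 : c * S ^ 2 ≤ (∑ k, l2norm (e k)) * S := by
    rw [hS2]
    refine h1.trans ((Complex.re_le_norm _).trans ((norm_sum_le _ _).trans ?_))
    rw [Finset.sum_mul]
    refine Finset.sum_le_sum fun k _ => (norm_integral_mul_le (he k) (hcj k)).trans ?_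
    have : l2norm (fun s => conj (m k s)) = l2norm (m k) := l2norm_congr_norm fun s => by simp
    rw [this]
    exact mul_le_mul_of_nonneg_left (hle k) (l2norm_nonneg _)
  refine (hle i).trans ?_
  have he0 : 0 ≤ ∑ k, l2norm (e k) := Finset.sum_nonneg fun k _ => l2norm_nonneg _
  rcases eq_or_lt_of_le (Real.sqrt_nonneg (∑ k, l2norm (m k) ^ 2)) with h0 | h0
  · rw [hS, ← h0]; positivity
  · rw [inv_mul_eq_div, le_div_iff₀ hc0]
    have : S * (S * c) ≤ S * ∑ k, l2norm (e k) := by nlinarith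
    exact le_of_mul_le_mul_left this h0

/-! ### Holomorphic extension from the real line -/

/-- The holomorphic extension to the lower half plane of the function whose transform is `F` on the
negative half line. -/
def lowerExt (F : ℝ → ℂ) (z : ℂ) : ℂ :=
  ∫ ξ in Set.Iio (0 : ℝ), Complex.exp (2 * Real.pi * Complex.I * z * ξ) * F ξ

/-- The holomorphic extension to the upper half plane of the function whose transform is `F` on the
positive half line. -/
def upperExt (F : ℝ → ℂ) (z : ℂ) : ℂ := lowerExt (fun ξ => F (-ξ)) (-z)

section lowerExt
variable {F : ℝ → ℂ}

theorem norm_cexp_lower (z : ℂ) (ξ : ℝ) :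
    ‖Complex.exp (2 * Real.pi * Complex.I * z * ξ)‖ = Real.exp (-(2 * Real.pi * z.im * ξ)) := by
  rw [Complex.norm_exp]; congr 1; simp

theorem norm_cexp_lower_le {z : ℂ} (hz : z.im ≤ 0) {ξ : ℝ} (hξ : ξ ≤ 0) :
    ‖Complex.exp (2 * Real.pi * Complex.I * z * ξ)‖ ≤ 1 := by
  rw [norm_cexp_lower, Real.exp_le_one_iff, neg_nonpos, mul_assoc]
  have : 0 ≤ z.im * ξ := mul_nonneg_of_nonpos_of_nonpos hz hξ
  positivity

theorem integrableOn_lowerExt (hF : Integrable F) {z : ℂ} (hz : z.im ≤ 0) :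
    IntegrableOn (fun ξ : ℝ => Complex.exp (2 * Real.pi * Complex.I * z * ξ) * F ξ) (Set.Iio 0) := by
  refine Integrable.bdd_mul (c := 1) hF.integrableOn (by fun_prop) ?_
  filter_upwards [ae_restrict_mem measurableSet_Iio] with ξ hξ
  exact norm_cexp_lower_le hz (le_of_lt hξ)

theorem norm_lowerExt_le (hF : Integrable F) {z : ℂ} (hz : z.im ≤ 0) :
    ‖lowerExt F z‖ ≤ ∫ ξ, ‖F ξ‖ := by
  calc ‖lowerExt F z‖ ≤ ∫ ξ in Set.Iio (0 : ℝ), ‖F ξ‖ := by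
        refine norm_integral_le_of_norm_le hF.norm.integrableOn ?_
        filter_upwards [ae_restrict_mem measurableSet_Iio] with ξ hξ
        rw [norm_mul]
        exact mul_le_of_le_one_left (norm_nonneg _) (norm_cexp_lower_le hz (le_of_lt hξ))
    _ ≤ _ := setIntegral_le_integral hF.norm (ae_of_all _ fun _ => norm_nonneg _)

theorem continuousOn_lowerExt (hF : Integrable F) :
    ContinuousOn (lowerExt F) {z : ℂ | z.im ≤ 0} := by
  refine continuousOn_of_dominated (bound := fun ξ => ‖F ξ‖) (fun z _ => ?_) (fun z hz => ?_)
    hF.norm.integrableOn (ae_of_all _ fun ξ => ?_)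
  · exact AEStronglyMeasurable.mul (by fun_prop) hF.1.restrict
  · filter_upwards [ae_restrict_mem measurableSet_Iio] with ξ hξ
    rw [norm_mul]
    exact mul_le_of_le_one_left (norm_nonneg _) (norm_cexp_lower_le hz (le_of_lt hξ))
  · fun_prop

theorem differentiableOn_lowerExt (hF : Integrable F) :
    DifferentiableOn ℂ (lowerExt F) {z : ℂ | z.im < 0} := by
  intro z hz
  have hz : z.im < 0 := hz
  have hopen : {w : ℂ | w.im < z.im / 2} ∈ 𝓝 z :=
    (isOpen_lt Complex.continuous_im continuous_const).mem_nhds (by simp; linarith)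
  have h := hasDerivAt_integral_of_dominated_loc_of_deriv_le (𝕜 := ℂ)
    (μ := volume.restrict (Set.Iio (0 : ℝ)))
    (F := fun z ξ => Complex.exp (2 * Real.pi * Complex.I * z * ξ) * F ξ)
    (F' := fun z ξ => (2 * Real.pi * Complex.I * ξ) *
      Complex.exp (2 * Real.pi * Complex.I * z * ξ) * F ξ)
    (bound := fun ξ => (2 * Real.pi) * (Real.pi * -z.im)⁻¹ * ‖F ξ‖) (x₀ := z) hopen
    (Eventually.of_forall fun w => AEStronglyMeasurable.mul (by fun_prop) hF.1.restrict)
    (integrableOn_lowerExt hF hz.le)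
    (AEStronglyMeasurable.mul (by fun_prop) hF.1.restrict) ?_
    ((hF.norm.const_mul _).integrableOn) ?_
  · exact h.2.differentiableAt.differentiableWithinAt
  · filter_upwards [ae_restrict_mem measurableSet_Iio] with ξ hξ w hw
    have hξ : ξ < 0 := hξ
    have hw : w.im < z.im / 2 := hw
    rw [norm_mul]
    gcongr
    rw [norm_mul, norm_cexp_lower]
    have e : ‖(2 * Real.pi * Complex.I * ξ : ℂ)‖ = 2 * Real.pi * -ξ := by
      simp [abs_of_neg hξ, abs_of_pos Real.pi_pos]
    rw [e, mul_assoc (2 * Real.pi)]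
    gcongr
    set t := Real.pi * -z.im * -ξ with ht
    have hpz : 0 < Real.pi * -z.im := by have := Real.pi_pos; apply mul_pos this; linarith
    have h1 : Real.exp (-(2 * Real.pi * w.im * ξ)) ≤ Real.exp (-t) := by
      rw [Real.exp_le_exp, neg_le_neg_iff, ht]
      have : 0 < Real.pi * -ξ := mul_pos Real.pi_pos (by linarith)
      nlinarith
    have h2 : t * Real.exp (-t) ≤ 1 := by
      rw [Real.exp_neg, ← div_eq_mul_inv, div_le_one (Real.exp_pos _)]
      linarith [Real.add_one_le_exp t]
    calc -ξ * Real.exp (-(2 * Real.pi * w.im * ξ)) ≤ -ξ * Real.exp (-t) := by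
          gcongr; linarith
      _ = (Real.pi * -z.im)⁻¹ * (t * Real.exp (-t)) := by
          have : -ξ = (Real.pi * -z.im)⁻¹ * t := by rw [ht, inv_mul_cancel_left₀ hpz.ne']
          rw [this, mul_assoc]
      _ ≤ (Real.pi * -z.im)⁻¹ * 1 := by gcongr
      _ = _ := mul_one _
  · refine ae_of_all _ fun ξ w _ => ?_
    have h1 : HasDerivAt (fun w : ℂ => 2 * Real.pi * Complex.I * w * ξ)
        (2 * Real.pi * Complex.I * ξ) w := by
      have := ((hasDerivAt_id w).const_mul (2 * Real.pi * Complex.I)).mul_const (ξ : ℂ)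
      simpa using this
    have h2 := h1.cexp.mul_const (F ξ)
    convert! h2 using 1
    ring

theorem lowerExt_ofReal (h0 : ∀ᵐ ξ : ℝ, 0 < ξ → F ξ = 0) (s : ℝ) :
    lowerExt F s = 𝓕⁻ F s := by
  rw [fourierInv_eq_integral, lowerExt, ← integral_indicator measurableSet_Iio]
  apply integral_congr_ae
  filter_upwards [h0, Measure.ae_ne volume (0 : ℝ)] with ξ h1 h2
  rcases lt_or_gt_of_ne h2 with h3 | h3
  · rw [Set.indicator_of_mem (by simpa using h3)]
  · rw [Set.indicator_of_notMem (by simpa using h3.le), h1 h3, mul_zero]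

/-- The Riemann–Lebesgue lemma in the closed lower half plane. -/
theorem tendsto_lowerExt (hF : Integrable F) :
    Tendsto (lowerExt F) (cocompact ℂ ⊓ 𝓟 {z : ℂ | z.im ≤ 0}) (𝓝 0) := by
  rw [Metric.tendsto_nhds]
  intro ε hε
  -- approximation by a Schwartz function, for which integration by parts gives decay
  obtain ⟨φ, hφ⟩ : ∃ φ : 𝓢(ℝ, ℂ), ∫ ξ, ‖F ξ - φ ξ‖ < ε / 2 := by
    have hd := SchwartzMap.denseRange_toLpCLM (E := ℝ) (F := ℂ) (p := 1) (μ := volume)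
      (by norm_num)
    have hF1 : MemLp F 1 volume := memLp_one_iff_integrable.2 hF
    obtain ⟨φ, hφ⟩ := hd.exists_dist_lt (hF1.toLp F) (half_pos hε)
    refine ⟨φ, ?_⟩
    have e : dist (hF1.toLp F) (SchwartzMap.toLpCLM ℝ ℂ 1 volume φ) =
        dist (hF1.toLp F) ((φ.memLp 1 volume).toLp φ) := rfl
    rw [e, dist_eq_norm, ← MemLp.toLp_sub, Lp.norm_toLp, eLpNorm_one_eq_lintegral_enorm,
      ← integral_norm_eq_lintegral_enorm (hF1.sub (φ.memLp 1 volume)).1] at hφ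
    exact hφ
  have hφi : Integrable φ := φ.integrable
  have hφ'i : Integrable (deriv φ) := (SchwartzMap.derivCLM ℝ ℂ φ).integrable
  set C := ‖φ 0‖ + ∫ ξ, ‖deriv φ ξ‖ with hC
  have hparts : ∀ z : ℂ, z.im ≤ 0 → 2 * Real.pi * ‖z‖ * ‖lowerExt φ z‖ ≤ C := by
    intro z hz
    have i1 := (integrableOn_lowerExt hφi hz).congr_set_ae Iio_ae_eq_Iic.symm
    have i2 := (integrableOn_lowerExt hφ'i hz).congr_set_ae Iio_ae_eq_Iic.symm
    have hderiv : ∀ ξ ∈ Set.Iic (0 : ℝ),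
        HasDerivAt (fun ξ : ℝ => Complex.exp (2 * Real.pi * Complex.I * z * ξ) * φ ξ)
        (2 * Real.pi * Complex.I * z * (Complex.exp (2 * Real.pi * Complex.I * z * ξ) * φ ξ) +
          Complex.exp (2 * Real.pi * Complex.I * z * ξ) * deriv φ ξ) ξ := by
      intro ξ _
      have h1 : HasDerivAt (fun ξ : ℝ => 2 * Real.pi * Complex.I * z * (ξ : ℂ))
          (2 * Real.pi * Complex.I * z) ξ := by
        simpa using (Complex.ofRealCLM.hasDerivAt (x := ξ)).const_mul (2 * Real.pi * Complex.I * z)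
      have h2 := h1.cexp.mul (φ.differentiable ξ).hasDerivAt
      convert! h2 using 1
      ring
    have hlim : Tendsto (fun ξ : ℝ => Complex.exp (2 * Real.pi * Complex.I * z * ξ) * φ ξ) atBot
        (𝓝 0) := by
      have hφ0 : Tendsto φ atBot (𝓝 0) := by
        have := φ.toZeroAtInfty.zero_at_infty'
        exact this.mono_left atBot_le_cocompact
      refine squeeze_zero_norm' ?_ (by simpa using hφ0.norm)
      filter_upwards [eventually_le_atBot 0] with ξ hξ
      rw [norm_mul]
      exact mul_le_of_le_one_left (norm_nonneg _) (norm_cexp_lower_le hz hξ)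
    have hint := integral_Iic_of_hasDerivAt_of_tendsto' hderiv
      ((i1.const_mul _).add i2) hlim
    rw [integral_add (i1.const_mul _) i2, integral_const_mul, integral_Iic_eq_integral_Iio,
      integral_Iic_eq_integral_Iio] at hint
    have e : 2 * Real.pi * Complex.I * z * lowerExt φ z = φ 0 - lowerExt (deriv φ) z := by
      rw [eq_sub_iff_add_eq]
      simpa [lowerExt] using hint
    have e2 : ‖2 * Real.pi * Complex.I * z * lowerExt φ z‖ = 2 * Real.pi * ‖z‖ * ‖lowerExt φ z‖ := by
      simp [abs_of_pos Real.pi_pos]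
    rw [← e2, e]
    exact (norm_sub_le _ _).trans (add_le_add_right (norm_lowerExt_le hφ'i hz) _)
  have hbig : ∀ᶠ z : ℂ in cocompact ℂ, 2 * C / ε < 2 * Real.pi * ‖z‖ := by
    have : Tendsto (fun z : ℂ => 2 * Real.pi * ‖z‖) (cocompact ℂ) atTop :=
      (tendsto_norm_cocompact_atTop (E := ℂ)).const_mul_atTop (by positivity)
    exact this.eventually_gt_atTop _
  filter_upwards [mem_inf_of_left hbig, mem_inf_of_right (mem_principal_self _)] with z h1 h2
  have h2 : z.im ≤ 0 := h2
  have h1 : 2 * C / ε < 2 * Real.pi * ‖z‖ := h1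
  rw [dist_zero_right]
  have hC0 : 0 ≤ C := add_nonneg (norm_nonneg _) (integral_nonneg fun _ => norm_nonneg _)
  have hsub : lowerExt F z = lowerExt (fun ξ => F ξ - φ ξ) z + lowerExt φ z := by
    rw [lowerExt, lowerExt, lowerExt, ← integral_add]
    · congr 1; ext ξ; ring
    · exact integrableOn_lowerExt (hF.sub hφi) h2
    · exact integrableOn_lowerExt hφi h2
  have h3 : ‖lowerExt φ z‖ < ε / 2 := by
    have hpos : 0 < 2 * Real.pi * ‖z‖ := lt_of_le_of_lt (by positivity) h1
    rw [div_lt_iff₀ hε] at h1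
    by_contra hcon
    push Not at hcon
    have := hparts z h2
    nlinarith [mul_le_mul_of_nonneg_left hcon hpos.le]
  rw [hsub]
  calc _ ≤ _ := norm_add_le _ _
    _ < ε / 2 + ε / 2 := add_lt_add_of_le_of_lt
      ((norm_lowerExt_le (hF.sub hφi) h2).trans hφ.le) h3
    _ = ε := by ring

/-- Point evaluations in the lower half plane are bounded on `L²`. -/
theorem exists_lowerExt_bound {z : ℂ} (hz : z.im < 0) : ∃ C : ℝ, 0 ≤ C ∧
    ∀ F, MemLp F 2 volume → ‖lowerExt F z‖ ≤ C * l2norm F := by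
  let k : ℝ → ℂ := (Set.Iio (0 : ℝ)).indicator fun ξ =>
    Complex.exp (2 * Real.pi * Complex.I * z * ξ)
  have hkm : AEStronglyMeasurable k volume :=
    (Continuous.aestronglyMeasurable (by fun_prop)).indicator measurableSet_Iio
  have hk : MemLp k 2 volume := by
    rw [memLp_two_iff_integrable_sq_norm hkm]
    have e : (fun ξ => ‖k ξ‖ ^ 2) = (Set.Iio (0 : ℝ)).indicator fun ξ =>
        Real.exp ((-(4 * Real.pi * z.im)) * ξ) := by
      ext ξ
      by_cases h : ξ ∈ Set.Iio (0 : ℝ)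
      · simp only [k, Set.indicator_of_mem h, norm_cexp_lower]
        rw [← Real.exp_nat_mul]; congr 1; push_cast; ring
      · simp [k, Set.indicator_of_notMem h]
    rw [e, integrable_indicator_iff measurableSet_Iio]
    have := integrableOn_exp_mul_Iic (a := -(4 * Real.pi * z.im))
      (by nlinarith [Real.pi_pos]) 0
    exact this.mono_set Set.Iio_subset_Iic_self
  refine ⟨l2norm k, l2norm_nonneg k, fun F hF => ?_⟩
  have e : lowerExt F z = ∫ ξ, k ξ * F ξ := by
    rw [lowerExt, ← integral_indicator measurableSet_Iio]
    congr 1; ext ξ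
    by_cases h : ξ ∈ Set.Iio (0 : ℝ)
    · simp only [k, Set.indicator_of_mem h]
    · simp [k, Set.indicator_of_notMem h]
  rw [e]
  exact norm_integral_mul_le hk hF

end lowerExt

/-! ### An Abelian theorem for the Laplace transform -/

/-- Integration by parts in the Laplace transform, by Fubini's theorem. -/
theorem laplace_eq_mul_integral_primitive {k : ℝ → ℂ} (hk : Integrable k) {w : ℂ} (hw : 0 < w.re) :
    ∫ t in Set.Ioi (0 : ℝ), Complex.exp (-(w * t)) * k t =
      w * ∫ s in Set.Ioi (0 : ℝ), Complex.exp (-(w * s)) * ∫ t in Set.Ioc 0 s, k t := by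
  have hw0 : w ≠ 0 := fun h => by simp [h] at hw
  have hexp : IntegrableOn (fun s : ℝ => Complex.exp (-(w * s))) (Set.Ioi 0) := by
    have := integrableOn_exp_mul_complex_Ioi (a := -w) (by simpa using hw) 0
    simpa using this
  let q : ℝ → ℝ → ℂ := fun s t => Complex.exp (-(w * s)) * (Set.Iic s).indicator k t
  have hq : Integrable (Function.uncurry q)
      ((volume.restrict (Set.Ioi (0 : ℝ))).prod (volume.restrict (Set.Ioi (0 : ℝ)))) := by
    have h1 := Integrable.mul_prod (μ := volume.restrict (Set.Ioi (0 : ℝ)))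
      (ν := volume.restrict (Set.Ioi (0 : ℝ))) hexp hk.integrableOn
    have hset : MeasurableSet {p : ℝ × ℝ | p.2 ≤ p.1} := measurableSet_le measurable_snd measurable_fst
    refine (h1.indicator hset).congr (ae_of_all _ fun p => ?_)
    by_cases h : p.2 ≤ p.1
    · simp [q, Function.uncurry, Set.indicator, h]
    · simp [q, Function.uncurry, Set.indicator, h]
  have hswap := integral_integral_swap hq
  have hl : ∀ s ∈ Set.Ioi (0 : ℝ), ∫ t in Set.Ioi (0 : ℝ), q s t =
      Complex.exp (-(w * s)) * ∫ t in Set.Ioc 0 s, k t := fun s hs => by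
    rw [integral_const_mul, setIntegral_indicator measurableSet_Iic, Set.Ioi_inter_Iic]
  have hr : ∀ t ∈ Set.Ioi (0 : ℝ), ∫ s in Set.Ioi (0 : ℝ), q s t =
      w⁻¹ * (Complex.exp (-(w * t)) * k t) := fun t ht => by
    have ht : 0 < t := ht
    have e : (fun s => q s t) = (Set.Ici t).indicator fun s => Complex.exp (-w * s) * k t := by
      ext s
      by_cases h : t ≤ s <;> simp [q, Set.indicator, h]
    rw [e, setIntegral_indicator measurableSet_Ici, Set.inter_eq_right.2 (fun x hx => ?_),
      integral_Ici_eq_integral_Ioi, integral_mul_const,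
      integral_exp_mul_complex_Ioi (by simpa using hw)]
    · field_simp
    · exact ht.trans_le hx
  rw [setIntegral_congr_fun measurableSet_Ioi hl, setIntegral_congr_fun measurableSet_Ioi hr,
    integral_const_mul] at hswap
  rw [hswap, mul_inv_cancel_left₀ hw0]

theorem integral_cexp_neg_mul_mul_id {w : ℂ} (hw : 0 < w.re) :
    ∫ s in Set.Ioi (0 : ℝ), Complex.exp (-(w * s)) * s = 1 / w ^ 2 := by
  have hw0 : w ≠ 0 := fun h => by simp [h] at hw
  have hnorm : ∀ s : ℝ, ‖Complex.exp (-(w * s))‖ = Real.exp (-w.re * s) := fun s => by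
    rw [Complex.norm_exp]; congr 1; simp
  have hderiv : ∀ s ∈ Set.Ici (0 : ℝ), HasDerivAt
      (fun s : ℝ => -(Complex.exp (-(w * s)) * (s / w + 1 / w ^ 2)))
      (Complex.exp (-(w * s)) * s) s := by
    intro s _
    have h0 : HasDerivAt (fun s : ℝ => (s : ℂ)) 1 s := Complex.ofRealCLM.hasDerivAt
    have h1 := ((h0.const_mul w).neg.cexp.mul ((h0.div_const w).add_const (1 / w ^ 2))).neg
    convert! h1 using 1
    simp only [Pi.neg_apply]
    field_simp
    ring
  have hint : IntegrableOn (fun s : ℝ => Complex.exp (-(w * s)) * s) (Set.Ioi 0) := by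
    have h := integrableOn_rpow_mul_exp_neg_mul_rpow (s := 1) (p := 1) (b := w.re) (by norm_num)
      one_pos hw
    refine h.mono' (Continuous.aestronglyMeasurable (by fun_prop)) ?_
    filter_upwards [ae_restrict_mem measurableSet_Ioi] with s hs
    rw [norm_mul, hnorm, Complex.norm_real, Real.norm_of_nonneg (le_of_lt hs), Real.rpow_one,
      mul_comm]
  have hlim : Tendsto (fun s : ℝ => -(Complex.exp (-(w * s)) * (s / w + 1 / w ^ 2))) atTop
      (𝓝 0) := by
    have h1 := (tendsto_rpow_mul_exp_neg_mul_atTop_nhds_zero 1 w.re hw).mul_const (‖w‖⁻¹)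
    have h2 := (tendsto_rpow_mul_exp_neg_mul_atTop_nhds_zero 0 w.re hw).mul_const (‖w ^ 2‖⁻¹)
    have h3 := h1.add h2
    rw [zero_mul, zero_mul, zero_add] at h3
    refine squeeze_zero_norm' ?_ h3
    filter_upwards [eventually_ge_atTop 0] with s hs
    rw [norm_neg, norm_mul, hnorm, Real.rpow_one, Real.rpow_zero, one_mul]
    have : ‖(s : ℂ) / w + 1 / w ^ 2‖ ≤ s * ‖w‖⁻¹ + ‖w ^ 2‖⁻¹ := by
      refine (norm_add_le _ _).trans_eq ?_
      rw [norm_div, norm_div, Complex.norm_real, Real.norm_of_nonneg hs, norm_one, one_div,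
        div_eq_mul_inv]
    calc _ ≤ Real.exp (-w.re * s) * (s * ‖w‖⁻¹ + ‖w ^ 2‖⁻¹) := by gcongr
      _ = _ := by ring
  rw [integral_Ioi_of_hasDerivAt_of_tendsto' hderiv hint hlim]
  simp

/-- If `D t = o(t)` at the origin and `D t = O(t)`, then its Laplace transform is `o(a⁻²)`. -/
theorem tendsto_sq_mul_laplace {D : ℝ → ℝ} (hD : Continuous D)
    (h0 : Tendsto (fun t => t⁻¹ * D t) (𝓝[>] 0) (𝓝 0)) {C : ℝ}
    (hC : ∀ t, 0 < t → |D t| ≤ C * t) :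
    Tendsto (fun a : ℝ => a ^ 2 * ∫ t in Set.Ioi (0 : ℝ), D t * Real.exp (-(a * t))) atTop (𝓝 0) := by
  have hscale : ∀ a : ℝ, 0 < a → a ^ 2 * ∫ t in Set.Ioi (0 : ℝ), D t * Real.exp (-(a * t)) =
      ∫ s in Set.Ioi (0 : ℝ), a * D (a⁻¹ * s) * Real.exp (-s) := fun a ha => by
    have := integral_comp_mul_left_Ioi (fun t => D t * Real.exp (-(a * t))) 0 (inv_pos.2 ha)
    rw [mul_zero, inv_inv, smul_eq_mul] at this
    rw [sq, mul_assoc, ← this, ← integral_const_mul]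
    congr 1; ext s
    rw [mul_inv_cancel_left₀ ha.ne', mul_assoc]
  have hlim : Tendsto (fun a : ℝ => ∫ s in Set.Ioi (0 : ℝ), a * D (a⁻¹ * s) * Real.exp (-s)) atTop
      (𝓝 (∫ s in Set.Ioi (0 : ℝ), (0 : ℝ))) := by
    refine tendsto_integral_filter_of_dominated_convergence
      (fun s => C * (s * Real.exp (-s))) (Eventually.of_forall fun a => ?_) ?_ ?_ ?_
    · exact Continuous.aestronglyMeasurable (by fun_prop)
    · filter_upwards [eventually_gt_atTop 0] with a ha
      filter_upwards [ae_restrict_mem measurableSet_Ioi] with s hs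
      have hs : 0 < s := hs
      rw [norm_mul, Real.norm_of_nonneg (Real.exp_pos _).le, norm_mul, Real.norm_of_nonneg ha.le,
        Real.norm_eq_abs, ← mul_assoc]
      refine mul_le_mul_of_nonneg_right ?_ (Real.exp_pos _).le
      have := hC (a⁻¹ * s) (by positivity)
      calc a * |D (a⁻¹ * s)| ≤ a * (C * (a⁻¹ * s)) := by gcongr
        _ = C * s := by field_simp
    · have := Real.GammaIntegral_convergent (s := 2) (by norm_num)
      refine Integrable.const_mul (this.congr_fun (fun s hs => ?_) measurableSet_Ioi) C
      norm_num [mul_comm]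
    · filter_upwards [ae_restrict_mem measurableSet_Ioi] with s hs
      have hs : 0 < s := hs
      have h1 : Tendsto (fun a : ℝ => a⁻¹ * s) atTop (𝓝[>] 0) := by
        refine tendsto_nhdsWithin_iff.2 ⟨?_, ?_⟩
        · simpa using tendsto_inv_atTop_zero.mul_const s
        · filter_upwards [eventually_gt_atTop 0] with a ha
          exact mul_pos (inv_pos.2 ha) hs
      have h2 := ((h0.comp h1).const_mul s).mul_const (Real.exp (-s))
      rw [mul_zero, zero_mul] at h2
      refine h2.congr' ?_
      filter_upwards [eventually_gt_atTop 0] with a ha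
      simp only [Function.comp]
      field_simp
  rw [integral_zero] at hlim
  refine hlim.congr' ?_
  filter_upwards [eventually_gt_atTop 0] with a ha
  exact (hscale a ha).symm

/-- An Abelian theorem: the mean value of `K` at `0⁻` is read off from the behaviour of its
holomorphic extension at infinity, in every sector of the lower half plane. -/
theorem tendsto_mul_lowerExt {K : ℝ → ℂ} (hK : Integrable K) {κ : ℂ}
    (h0 : Tendsto (fun t : ℝ => (t : ℂ)⁻¹ * ∫ ξ in (-t)..0, K ξ) (𝓝[>] 0) (𝓝 κ)) {c : ℝ}
    (hc : 0 < c) :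
    Tendsto (fun z => z * lowerExt K z) (lowerSectorAtInfinity c)
      (𝓝 (κ / (2 * Real.pi * Complex.I))) := by
  let k : ℝ → ℂ := fun t => K (-t)
  have hk : Integrable k := hK.comp_neg
  let H : ℝ → ℂ := fun s => ∫ t in (0 : ℝ)..s, k t
  have hHc : Continuous H := intervalIntegral.continuous_primitive
    (fun a b => hk.intervalIntegrable) 0
  have hH : ∀ t, H t = ∫ ξ in (-t)..0, K ξ := fun t => by
    simp only [H, k]; rw [intervalIntegral.integral_comp_neg]; simp
  have hHb : ∀ t, 0 < t → ‖H t‖ ≤ ∫ ξ, ‖k ξ‖ := fun t ht => by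
    simp only [H]
    rw [intervalIntegral.integral_of_le ht.le]
    exact (norm_integral_le_integral_norm _).trans
      (setIntegral_le_integral hk.norm (ae_of_all _ fun _ => norm_nonneg _))
  let D : ℝ → ℝ := fun t => ‖H t - κ * t‖
  have hDc : Continuous D := by fun_prop
  have hD0 : Tendsto (fun t => t⁻¹ * D t) (𝓝[>] 0) (𝓝 0) := by
    have h1 := (h0.sub_const κ).norm
    rw [sub_self, norm_zero] at h1
    refine h1.congr' ?_
    filter_upwards [self_mem_nhdsWithin] with t ht
    have ht : 0 < t := ht
    have ht' : (t : ℂ) ≠ 0 := by exact_mod_cast ht.ne'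
    have : (t : ℂ)⁻¹ * (∫ ξ in (-t)..0, K ξ) - κ = (t : ℂ)⁻¹ * (H t - κ * t) := by
      rw [hH]; field_simp
    rw [this, norm_mul, norm_inv, Complex.norm_real, Real.norm_of_nonneg ht.le]
  obtain ⟨C, hC⟩ : ∃ C, ∀ t, 0 < t → |D t| ≤ C * t := by
    have hev : ∀ᶠ t in 𝓝[>] (0 : ℝ), t⁻¹ * D t < 1 := hD0.eventually (gt_mem_nhds one_pos)
    obtain ⟨δ, hδ, hδ1⟩ := mem_nhdsGT_iff_exists_Ioo_subset.1 hev
    have hδ : 0 < δ := hδ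
    have hI : 0 ≤ ∫ ξ, ‖k ξ‖ := integral_nonneg fun _ => norm_nonneg _
    refine ⟨1 + (∫ ξ, ‖k ξ‖) / δ + ‖κ‖, fun t ht => ?_⟩
    rw [abs_of_nonneg (norm_nonneg _)]
    rcases lt_or_ge t δ with h | h
    · have h2 : t⁻¹ * D t < 1 := hδ1 ⟨ht, h⟩
      rw [inv_mul_lt_iff₀ ht, mul_one] at h2
      have : 0 ≤ ((∫ ξ, ‖k ξ‖) / δ + ‖κ‖) * t := by positivity
      nlinarith
    · have h2 : D t ≤ (∫ ξ, ‖k ξ‖) + ‖κ‖ * t := by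
        refine (norm_sub_le _ _).trans (add_le_add (hHb t ht) ?_)
        rw [norm_mul, Complex.norm_real, Real.norm_of_nonneg ht.le]
      have h3 : (∫ ξ, ‖k ξ‖) ≤ (∫ ξ, ‖k ξ‖) / δ * t := by
        rw [div_mul_eq_mul_div, le_div_iff₀ hδ]
        exact mul_le_mul_of_nonneg_left h hI
      change D t ≤ _
      nlinarith
  have hlap := tendsto_sq_mul_laplace hDc hD0 hC
  have hrep : ∀ z : ℂ, z.im < 0 → z * lowerExt K z - κ / (2 * Real.pi * Complex.I) =
      (2 * Real.pi * Complex.I)⁻¹ * ((2 * Real.pi * Complex.I * z) ^ 2 *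
        ∫ s in Set.Ioi (0 : ℝ), Complex.exp (-(2 * Real.pi * Complex.I * z * s)) * (H s - κ * s)) := by
    intro z hz
    set w := 2 * Real.pi * Complex.I * z with hw
    have hwre : 0 < w.re := by
      have : w.re = -(2 * Real.pi * z.im) := by simp [hw]
      rw [this]; nlinarith [Real.pi_pos]
    have hw0 : w ≠ 0 := fun h => by simp [h] at hwre
    have h1 : lowerExt K z = ∫ t in Set.Ioi (0 : ℝ), Complex.exp (-(w * t)) * k t := by
      rw [lowerExt, ← integral_Iic_eq_integral_Iio, ← neg_zero, ← integral_comp_neg_Ioi]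
      simp [hw, k]
    have hlapl := laplace_eq_mul_integral_primitive hk hwre
    have hset : ∫ s in Set.Ioi (0 : ℝ), Complex.exp (-(w * s)) * ∫ t in Set.Ioc 0 s, k t =
        ∫ s in Set.Ioi (0 : ℝ), Complex.exp (-(w * s)) * H s :=
      setIntegral_congr_fun measurableSet_Ioi fun s hs => by
        simp only [H]; rw [intervalIntegral.integral_of_le (le_of_lt hs)]
    have hone := integral_cexp_neg_mul_mul_id hwre
    have i1 : IntegrableOn (fun s : ℝ => Complex.exp (-(w * s)) * H s) (Set.Ioi 0) := by
      have hexp : IntegrableOn (fun s : ℝ => Complex.exp (-(w * s))) (Set.Ioi 0) := by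
        have := integrableOn_exp_mul_complex_Ioi (a := -w) (by simpa using hwre) 0
        simpa using this
      refine Integrable.mul_bdd (c := ∫ ξ, ‖k ξ‖) hexp hHc.aestronglyMeasurable ?_
      filter_upwards [ae_restrict_mem measurableSet_Ioi] with s hs using hHb s hs
    have i2 : IntegrableOn (fun s : ℝ => Complex.exp (-(w * s)) * (κ * s)) (Set.Ioi 0) := by
      have hne : ∫ s in Set.Ioi (0 : ℝ), Complex.exp (-(w * s)) * s ≠ 0 := by
        rw [hone]; exact div_ne_zero one_ne_zero (pow_ne_zero 2 hw0)
      have := (Integrable.of_integral_ne_zero hne).const_mul κ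
      refine this.congr (ae_of_all _ fun s => ?_)
      ring
    have h2pi : (2 * Real.pi * Complex.I : ℂ) ≠ 0 := by simp [Real.pi_ne_zero]
    have hz' : z = (2 * Real.pi * Complex.I)⁻¹ * w := by rw [hw, inv_mul_cancel_left₀ h2pi]
    have hκ : ∫ s in Set.Ioi (0 : ℝ), Complex.exp (-(w * s)) * (κ * s) = κ * (1 / w ^ 2) := by
      rw [← hone, ← integral_const_mul]
      congr 1; ext s; ring
    simp only [mul_sub]
    rw [integral_sub i1 i2, hκ, h1, hlapl, hset]
    conv_lhs => rw [hz']
    field_simp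
  rw [tendsto_iff_norm_sub_tendsto_zero]
  have him : Tendsto (fun z : ℂ => 2 * Real.pi * |z.im|) (lowerSectorAtInfinity c) atTop := by
    have h1 : Tendsto (fun z : ℂ => 2 * Real.pi / (c + 1) * ‖z‖) (lowerSectorAtInfinity c) atTop :=
      ((tendsto_norm_cocompact_atTop (E := ℂ)).mono_left inf_le_left).const_mul_atTop
        (by positivity)
    refine tendsto_atTop_mono' _ ?_ h1
    filter_upwards [mem_inf_of_right (mem_principal_self _)] with z hz
    have hz2 : |z.re| ≤ c * |z.im| := hz.2
    have := Complex.norm_le_abs_re_add_abs_im z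
    rw [div_mul_eq_mul_div, div_le_iff₀ (by positivity)]
    nlinarith [Real.pi_pos]
  have hfin := (hlap.comp him).const_mul ((2 * Real.pi)⁻¹ * (c + 1) ^ 2)
  rw [mul_zero] at hfin
  refine squeeze_zero' (Eventually.of_forall fun _ => norm_nonneg _) ?_ hfin
  filter_upwards [mem_inf_of_right (mem_principal_self _)] with z hz
  have hz1 : z.im < 0 := hz.1
  have hz2 : |z.re| ≤ c * |z.im| := hz.2
  rw [hrep z hz1, norm_mul, norm_mul, norm_inv, norm_pow]
  have e1 : ‖(2 * Real.pi * Complex.I : ℂ)‖ = 2 * Real.pi := by simp [abs_of_pos Real.pi_pos]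
  have e2 : ‖(2 * Real.pi * Complex.I * z : ℂ)‖ ≤ (c + 1) * (2 * Real.pi * |z.im|) := by
    rw [norm_mul, e1]
    have := Complex.norm_le_abs_re_add_abs_im z
    nlinarith [Real.pi_pos]
  have e3 : ‖∫ s in Set.Ioi (0 : ℝ), Complex.exp (-(2 * Real.pi * Complex.I * z * s)) *
      (H s - κ * s)‖ ≤ ∫ s in Set.Ioi (0 : ℝ), D s * Real.exp (-(2 * Real.pi * |z.im| * s)) := by
    refine (norm_integral_le_integral_norm _).trans_eq ?_
    congr 1; ext s
    rw [norm_mul, mul_comm]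
    congr 1
    rw [Complex.norm_exp, abs_of_neg hz1]; congr 1; simp
  simp only [Function.comp]
  rw [e1]
  calc _ ≤ (2 * Real.pi)⁻¹ * (((c + 1) * (2 * Real.pi * |z.im|)) ^ 2 *
        ∫ s in Set.Ioi (0 : ℝ), D s * Real.exp (-(2 * Real.pi * |z.im| * s))) := by gcongr
    _ = _ := by
      generalize (∫ s in Set.Ioi (0 : ℝ), D s * Real.exp (-(2 * Real.pi * |z.im| * s))) = J
      ring

/-! ### Uniqueness of the solution -/

/-- A continuous function on `ℂ` that is holomorphic off the real line is entire. -/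
theorem differentiable_of_continuous_of_im_ne_zero {f : ℂ → ℂ} (hc : Continuous f)
    (hd : DifferentiableOn ℂ f {z | z.im ≠ 0}) : Differentiable ℂ f := by
  have hrect : ∀ z w : ℂ, (0 : ℝ) ∉ Set.Ioo (min z.im w.im) (max z.im w.im) →
      (((∫ x : ℝ in z.re..w.re, f (x + z.im * Complex.I)) -
        ∫ x : ℝ in z.re..w.re, f (x + w.im * Complex.I)) +
        Complex.I • ∫ y : ℝ in z.im..w.im, f (w.re + y * Complex.I)) -
        Complex.I • ∫ y : ℝ in z.im..w.im, f (z.re + y * Complex.I) = 0 := fun z w h => by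
    refine Complex.integral_boundary_rect_eq_zero_of_continuousOn_of_differentiableOn f z w
      hc.continuousOn (hd.mono fun x hx => ?_)
    rintro (h0 : x.im = 0)
    have := hx.2
    rw [Set.mem_preimage, h0] at this
    exact h this
  have hcons : Complex.IsConservativeOn f Set.univ := by
    intro z w _
    have hii : ∀ (g : ℝ → ℂ), Continuous g → ∀ a b : ℝ, IntervalIntegrable (fun t => f (g t)) volume a b :=
      fun g hg a b => (hc.comp hg).intervalIntegrable a b
    -- the rectangle is cut along the real axis
    have h1 := hrect z (w.re : ℂ) (by simpa using fun h : z.im < 0 => h.le)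
    have h2 := hrect (z.re : ℂ) w (by simpa using fun h : w.im < 0 => h.le)
    simp only [Complex.ofReal_re, Complex.ofReal_im] at h1 h2
    have s1 := intervalIntegral.integral_add_adjacent_intervals
      (hii (fun y : ℝ => (w.re : ℂ) + y * Complex.I) (by fun_prop) z.im 0)
      (hii (fun y : ℝ => (w.re : ℂ) + y * Complex.I) (by fun_prop) 0 w.im)
    have s2 := intervalIntegral.integral_add_adjacent_intervals
      (hii (fun y : ℝ => (z.re : ℂ) + y * Complex.I) (by fun_prop) z.im 0)
      (hii (fun y : ℝ => (z.re : ℂ) + y * Complex.I) (by fun_prop) 0 w.im)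
    rw [← add_eq_zero_iff_eq_neg, Complex.wedgeIntegral_add_wedgeIntegral_eq]
    rw [← s1, ← s2]
    simp only [smul_add]
    linear_combination h1 + h2
  have hex := hcons.isExactOn_univ hc
  rw [← differentiableOn_univ]
  exact hex.differentiableOn isOpen_univ

theorem det_jumpVx (ε : ℝ) (ρ₁ ρ₂ : ℝ → ℂ) (x l : ℝ) : (jumpVx ε ρ₁ ρ₂ x l).det = 1 := by
  have hV : (jumpV ε ρ₁ ρ₂ l).det = 1 := by
    rw [jumpV, Matrix.det_fin_three]
    have h1 := Complex.mul_conj' (ρ₁ l)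
    have h2 := Complex.mul_conj' (ρ₂ l)
    simp
    linear_combination (-(ε : ℂ)) * h1 - (ε : ℂ) * h2
  rw [jumpVx, Matrix.det_mul, Matrix.det_mul, hV, mul_one, expSigma, expSigma, Matrix.det_diagonal,
    Matrix.det_diagonal, ← Finset.prod_mul_distrib]
  refine Finset.prod_eq_one fun i _ => ?_
  fin_cases i <;> simp [← Complex.exp_add]

/-- Any two solutions `M`, `N` satisfy `N adj(M) = 1`: the product has no jump, so it is entire,
and Liouville's theorem applies. -/
theorem IsRHPSolution.mul_adjugate {ε : ℝ} {ρ₁ ρ₂ : ℝ → ℂ} {x : ℝ}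
    {M N : ℂ → Matrix (Fin 3) (Fin 3) ℂ} (hM : IsRHPSolution ε ρ₁ ρ₂ x M)
    (hN : IsRHPSolution ε ρ₁ ρ₂ x N) {z : ℂ} (hz : z.im ≠ 0) :
    N z * (M z).adjugate = 1 := by
  obtain ⟨Mp, Mm, hMpc, hMmc, hMp, hMm, hMj⟩ := hM.jump
  obtain ⟨Np, Nm, hNpc, hNmc, hNp, hNm, hNj⟩ := hN.jump
  have hcomb : ∀ {F : Filter ℂ} {A B : Matrix (Fin 3) (Fin 3) ℂ}, Tendsto N F (𝓝 A) →
      Tendsto M F (𝓝 B) → Tendsto (fun z => N z * (M z).adjugate) F (𝓝 (A * B.adjugate)) :=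
    fun hA hB => hA.mul (((Continuous.matrix_adjugate continuous_id).tendsto _).comp hB)
  have hnojump : ∀ l, Np l * (Mp l).adjugate = Nm l * (Mm l).adjugate := fun l => by
    rw [hNj, hMj, Matrix.adjugate_mul_distrib, Matrix.mul_assoc, ← Matrix.mul_assoc (jumpVx _ _ _ _ _),
      Matrix.mul_adjugate, det_jumpVx, one_smul, Matrix.one_mul]
  have hopen : IsOpen {z : ℂ | z.im ≠ 0} := isOpen_ne_fun Complex.continuous_im continuous_const
  have entry : ∀ i j, (N z * (M z).adjugate) i j = (1 : Matrix (Fin 3) (Fin 3) ℂ) i j := by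
    intro i j
    let f : ℂ → ℂ := fun z => if z.im = 0 then (Nm z.re * (Mm z.re).adjugate) i j
      else (N z * (M z).adjugate) i j
    have hfoff : ∀ w : ℂ, w.im ≠ 0 → f w = (N w * (M w).adjugate) i j := fun w hw => by
      simp [f, hw]
    have hent : ∀ {F : Filter ℂ} {A : Matrix (Fin 3) (Fin 3) ℂ} {g : ℂ → Matrix (Fin 3) (Fin 3) ℂ},
        Tendsto g F (𝓝 A) → Tendsto (fun w => g w i j) F (𝓝 (A i j)) := fun h =>
      ((continuous_id.matrix_elem i j).tendsto _).comp h
    have hd : DifferentiableOn ℂ f {w | w.im ≠ 0} := by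
      have hD : DifferentiableOn ℂ (fun w => (N w * (M w).adjugate) i j) {w | w.im ≠ 0} := by
        have hadj : ∀ a b, DifferentiableOn ℂ (fun w => (M w).adjugate a b) {w | w.im ≠ 0} := by
          intro a b
          simp only [Matrix.adjugate_apply, Matrix.det_fin_three, Matrix.updateRow_apply]
          have hM' := hM.analytic
          have hite : ∀ p q r, DifferentiableOn ℂ
              (fun w => if p = b then (Pi.single a (1 : ℂ) : Fin 3 → ℂ) q else M w p r)
              {w | w.im ≠ 0} := fun p q r => by
            split_ifs
            · exact differentiableOn_const _
            · exact hM' p r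
          exact ((((((hite 0 0 0).mul (hite 1 1 1)).mul (hite 2 2 2)).sub
            (((hite 0 0 0).mul (hite 1 2 2)).mul (hite 2 1 1))).sub
            (((hite 0 1 1).mul (hite 1 0 0)).mul (hite 2 2 2))).add
            (((hite 0 1 1).mul (hite 1 2 2)).mul (hite 2 0 0))).add
            (((hite 0 2 2).mul (hite 1 0 0)).mul (hite 2 1 1)) |>.sub
            (((hite 0 2 2).mul (hite 1 1 1)).mul (hite 2 0 0))
        simp only [Matrix.mul_apply]
        exact DifferentiableOn.fun_sum fun k _ => (hN.analytic i k).mul (hadj k j)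
      exact hD.congr fun w hw => hfoff w hw
    have hc : Continuous f := by
      rw [continuous_iff_continuousAt]
      intro w
      by_cases hw : w.im = 0
      · have hwr : w = (w.re : ℂ) := Complex.ext rfl (by simpa using hw)
        have hfw : f w = (Nm w.re * (Mm w.re).adjugate) i j := by simp [f, hw]
        have hcov : 𝓝 w = 𝓝[{z : ℂ | 0 < z.im}] w ⊔ 𝓝[{z : ℂ | z.im < 0}] w ⊔
            𝓝[{z : ℂ | z.im = 0}] w := by
          rw [← nhdsWithin_union, ← nhdsWithin_union, ← nhdsWithin_univ]
          congr 1
          ext z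
          simp only [Set.mem_univ, Set.mem_union, Set.mem_ofPred_eq, true_iff]
          rcases lt_trichotomy z.im 0 with h | h | h <;> simp [h]
        rw [ContinuousAt, hcov, hfw]
        refine Tendsto.sup (Tendsto.sup ?_ ?_) ?_
        · rw [← hnojump]
          have h := hent (hcomb (hNp w.re) (hMp w.re))
          rw [← hwr] at h
          refine h.congr' ?_
          filter_upwards [self_mem_nhdsWithin] with z hz
          exact (hfoff z (ne_of_gt hz)).symm
        · have h := hent (hcomb (hNm w.re) (hMm w.re))
          rw [← hwr] at h
          refine h.congr' ?_
          filter_upwards [self_mem_nhdsWithin] with z hz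
          exact (hfoff z (ne_of_lt hz)).symm
        · have h : Continuous fun z : ℂ => (Nm z.re * (Mm z.re).adjugate) i j :=
            ((hNmc.comp Complex.continuous_re).matrix_mul
              (hMmc.comp Complex.continuous_re).matrix_adjugate).matrix_elem i j
          refine ((h.tendsto w).mono_left nhdsWithin_le_nhds).congr' ?_
          filter_upwards [self_mem_nhdsWithin] with z hz
          have hz : z.im = 0 := hz
          simp [f, hz]
      · exact (hd.differentiableAt (hopen.mem_nhds hw)).continuousAt
    have hent1 := differentiable_of_continuous_of_im_ne_zero hc hd
    have hlim : Tendsto f (cocompact ℂ) (𝓝 ((1 : Matrix (Fin 3) (Fin 3) ℂ) i j)) := by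
      have h := hent (hcomb hN.normalization hM.normalization)
      simp only [Matrix.adjugate_one, Matrix.one_mul] at h
      rw [Metric.tendsto_nhds] at h ⊢
      intro δ hδ
      have h1 := h (δ / 2) (half_pos hδ)
      rw [eventually_inf_principal, ← Metric.cobounded_eq_cocompact,
        (Metric.hasBasis_cobounded_compl_closedBall (0 : ℂ)).eventually_iff] at h1
      obtain ⟨R, -, hR⟩ := h1
      rw [← Metric.cobounded_eq_cocompact,
        (Metric.hasBasis_cobounded_compl_closedBall (0 : ℂ)).eventually_iff]
      refine ⟨R, trivial, fun w hw => ?_⟩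
      have hdense : Dense {z : ℂ | z.im ≠ 0} := by
        have : {z : ℂ | z.im ≠ 0} = {z : ℂ | z.im = 0}ᶜ := rfl
        rw [this, ← interior_eq_empty_iff_dense_compl]
        have : {z : ℂ | z.im = 0} = Complex.im ⁻¹' {0} := rfl
        rw [this, Complex.interior_preimage_im, interior_singleton, Set.preimage_empty]
      have hwo : (Metric.closedBall (0 : ℂ) R)ᶜ ∈ 𝓝 w := Metric.isClosed_closedBall.isOpen_compl.mem_nhds hw
      have hwcl : w ∈ closure ((Metric.closedBall (0 : ℂ) R)ᶜ ∩ {z : ℂ | z.im ≠ 0}) :=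
        (hdense.open_subset_closure_inter Metric.isClosed_closedBall.isOpen_compl) hw
      have hsub : (Metric.closedBall (0 : ℂ) R)ᶜ ∩ {z : ℂ | z.im ≠ 0} ⊆
          {w | dist (f w) ((1 : Matrix (Fin 3) (Fin 3) ℂ) i j) ≤ δ / 2} := fun w hw => by
        have := hR hw.1 hw.2
        simp only [Set.mem_ofPred_eq, hfoff w hw.2]
        exact this.le
      have hclosed : IsClosed {w | dist (f w) ((1 : Matrix (Fin 3) (Fin 3) ℂ) i j) ≤ δ / 2} :=
        isClosed_le (hc.dist continuous_const) continuous_const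
      have h3 : dist (f w) ((1 : Matrix (Fin 3) (Fin 3) ℂ) i j) ≤ δ / 2 :=
        (closure_minimal hsub hclosed) hwcl
      linarith
    rw [← hfoff z hz]
    exact hent1.apply_eq_of_tendsto_cocompact z hlim
  ext i j
  exact entry i j

theorem IsRHPSolution.unique {ε : ℝ} {ρ₁ ρ₂ : ℝ → ℂ} {x : ℝ}
    {M N : ℂ → Matrix (Fin 3) (Fin 3) ℂ} (hM : IsRHPSolution ε ρ₁ ρ₂ x M)
    (hN : IsRHPSolution ε ρ₁ ρ₂ x N) {z : ℂ} (hz : z.im ≠ 0) : N z = M z := by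
  have h1 := hM.mul_adjugate hN hz
  have h2 := mul_eq_one_comm.1 (hM.mul_adjugate hM hz)
  calc N z = N z * ((M z).adjugate * M z) := by rw [h2, mul_one]
    _ = M z := by rw [← mul_assoc, h1, one_mul]

/-! ### The symbol of the Riemann-Hilbert problem -/

theorem IsH1.inv_one_add_sub_one {g : ℝ → ℂ} (hg : IsH1 g) {δ : ℝ} (hδ : 0 < δ)
    (h : ∀ s, δ ≤ ‖1 + g s‖) : IsH1 (fun s => (1 + g s)⁻¹ - 1) := by
  have hne : ∀ s, 1 + g s ≠ 0 := fun s h0 => by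
    have := h s; rw [h0, norm_zero] at this; linarith
  have hc := hg.continuous
  refine hg.of_le hg (L := δ⁻¹ + δ⁻¹ * δ⁻¹) ?_ (by positivity) (fun s => ?_) fun s t => ?_
  · exact ((continuous_const.add hc).inv₀ hne).sub continuous_const
  · have e : (1 + g s)⁻¹ - 1 = -(g s * (1 + g s)⁻¹) := by
      have := hne s; field_simp; ring
    rw [e, norm_neg, norm_mul, norm_inv]
    have h1 : ‖1 + g s‖⁻¹ ≤ δ⁻¹ := inv_anti₀ hδ (h s)
    calc ‖g s‖ * ‖1 + g s‖⁻¹ ≤ ‖g s‖ * δ⁻¹ := by gcongr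
      _ ≤ _ := by nlinarith [norm_nonneg (g s), inv_pos.2 hδ,
        mul_nonneg (norm_nonneg (g s)) (inv_pos.2 hδ).le,
        mul_nonneg (norm_nonneg (g s)) (mul_self_nonneg δ⁻¹)]
  · have e : (1 + g s)⁻¹ - 1 - ((1 + g t)⁻¹ - 1) =
        -((g s - g t) * ((1 + g s)⁻¹ * (1 + g t)⁻¹)) := by
      have := hne s; have := hne t; field_simp; ring
    rw [e, norm_neg, norm_mul, norm_mul, norm_inv, norm_inv]
    have h1 : ‖1 + g s‖⁻¹ ≤ δ⁻¹ := inv_anti₀ hδ (h s)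
    have h2 : ‖1 + g t‖⁻¹ ≤ δ⁻¹ := inv_anti₀ hδ (h t)
    calc _ ≤ ‖g s - g t‖ * (δ⁻¹ * δ⁻¹) := by gcongr
      _ ≤ _ := by nlinarith [norm_nonneg (g s - g t), inv_pos.2 hδ,
        mul_nonneg (norm_nonneg (g s - g t)) (inv_pos.2 hδ).le,
        mul_nonneg (norm_nonneg (g s - g t)) (mul_self_nonneg δ⁻¹)]

/-- The character `s ↦ e^{2πias}`. -/
def wave (a s : ℝ) : ℂ := Complex.exp (2 * Real.pi * Complex.I * a * s)

theorem norm_wave (a s : ℝ) : ‖wave a s‖ = 1 := IsFourierPair.norm_cexp_two_pi a s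

theorem wave_neg_mul (a s : ℝ) : wave (-a) s * wave a s = 1 := by
  rw [wave, wave, ← Complex.exp_add]; simp

theorem conj_wave (a s : ℝ) : conj (wave a s) = wave (-a) s := by
  have h2 : conj (2 : ℂ) = 2 := Complex.conj_ofReal 2
  rw [wave, wave, ← Complex.exp_conj]; congr 1
  simp [Complex.conj_ofReal, h2]

theorem continuous_wave (a : ℝ) : Continuous (wave a) := by unfold wave; fun_prop

/-- The corner entry `1 + ε |ρ|²` of the jump matrix. -/
def dens (ε : ℝ) (ρ : Fin 2 → ℝ → ℂ) (s : ℝ) : ℝ := 1 + ε * ∑ k, ‖ρ k s‖ ^ 2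

/-- The entries of the jump matrix `e^{iλx ad σ} V(λ)`. The parameter is `a = x / π`, so that the
exponential `e^{2iλx}` is the character `wave a`. -/
def symV (ε : ℝ) (ρ : Fin 2 → ℝ → ℂ) (a : ℝ) (l k : Fin 3) (s : ℝ) : ℂ :=
  Fin.cases (Fin.cases (dens ε ρ s : ℂ) (fun k' => ε * conj (ρ k' s) * wave (-a) s) k)
    (fun l' => Fin.cases (ρ l' s * wave a s) (fun k' => if l' = k' then 1 else 0) k) l

section symbol
variable {ε : ℝ} {ρ : Fin 2 → ℝ → ℂ} {a : ℝ}

@[simp] theorem symV_zero_zero (s : ℝ) : symV ε ρ a 0 0 s = dens ε ρ s := rfl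
@[simp] theorem symV_zero_succ (k : Fin 2) (s : ℝ) :
    symV ε ρ a 0 k.succ s = ε * conj (ρ k s) * wave (-a) s := rfl
@[simp] theorem symV_succ_zero (l : Fin 2) (s : ℝ) :
    symV ε ρ a l.succ 0 s = ρ l s * wave a s := rfl
@[simp] theorem symV_succ_succ (l k : Fin 2) (s : ℝ) :
    symV ε ρ a l.succ k.succ s = if l = k then 1 else 0 := rfl

theorem jumpVx_apply (ε : ℝ) (ρ₁ ρ₂ : ℝ → ℂ) (x s : ℝ) (l k : Fin 3) :
    jumpVx ε ρ₁ ρ₂ x s l k = symV ε ![ρ₁, ρ₂] (x / Real.pi) l k s := by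
  have hpi : (Real.pi : ℂ) ≠ 0 := by exact_mod_cast Real.pi_ne_zero
  have h1 : wave (x / Real.pi) s = Complex.exp (Complex.I * (s * x : ℝ)) *
      Complex.exp (Complex.I * (s * x : ℝ)) := by
    rw [wave, ← Complex.exp_add]; congr 1; push_cast; field_simp; ring
  have h2 : wave (-(x / Real.pi)) s = Complex.exp (-(Complex.I * (s * x : ℝ))) *
      Complex.exp (-(Complex.I * (s * x : ℝ))) := by
    rw [wave, ← Complex.exp_add]; congr 1; push_cast; field_simp; ring
  have h3 : Complex.exp (-(Complex.I * (s * x : ℝ))) * Complex.exp (Complex.I * (s * x : ℝ)) = 1 := by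
    rw [← Complex.exp_add]; simp
  have hneg : ((-(s * x) : ℝ) : ℂ) = -((s * x : ℝ) : ℂ) := by push_cast; ring
  rw [jumpVx, expSigma, expSigma, Matrix.mul_diagonal, Matrix.diagonal_mul, hneg]
  generalize hE : Complex.exp (Complex.I * (s * x : ℝ)) = E at *
  generalize hF : Complex.exp (-(Complex.I * (s * x : ℝ))) = F at *
  have hE' : Complex.exp (-(Complex.I * -((s * x : ℝ) : ℂ))) = E := by rw [← hE]; congr 1; ring
  have hF' : Complex.exp (Complex.I * -((s * x : ℝ) : ℂ)) = F := by rw [← hF]; congr 1; ring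
  rw [hE', hF']
  have hd : ((dens ε ![ρ₁, ρ₂] s : ℝ) : ℂ) = 1 + ε * ‖ρ₁ s‖ ^ 2 + ε * ‖ρ₂ s‖ ^ 2 := by
    simp [dens, Fin.sum_univ_two]; ring
  fin_cases l <;> fin_cases k
  · change F * (1 + ε * ‖ρ₁ s‖ ^ 2 + ε * ‖ρ₂ s‖ ^ 2) * E = ((dens ε ![ρ₁, ρ₂] s : ℝ) : ℂ)
    rw [hd]; linear_combination (1 + ε * ‖ρ₁ s‖ ^ 2 + ε * ‖ρ₂ s‖ ^ 2 : ℂ) * h3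
  · change F * (ε * conj (ρ₁ s)) * F = ε * conj (ρ₁ s) * wave _ _
    rw [h2]; ring
  · change F * (ε * conj (ρ₂ s)) * F = ε * conj (ρ₂ s) * wave _ _
    rw [h2]; ring
  · change E * ρ₁ s * E = ρ₁ s * wave _ _
    rw [h1]; ring
  · change E * 1 * F = 1
    linear_combination h3
  · change E * 0 * F = 0
    ring
  · change E * ρ₂ s * E = ρ₂ s * wave _ _
    rw [h1]; ring
  · change E * 0 * F = 0
    ring
  · change E * 1 * F = 1
    linear_combination h3

theorem ofReal_dens (s : ℝ) : (dens ε ρ s : ℂ) = 1 + ε * ∑ k, ρ k s * conj (ρ k s) := by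
  simp only [dens, Complex.mul_conj']
  push_cast; rfl

variable (hρ : ∀ k, IsH1 (ρ k))
include hρ

theorem isH1_dens_sub_one : IsH1 (fun s => (ε : ℂ) * ∑ k, ρ k s * conj (ρ k s)) :=
  (IsH1.sum Finset.univ fun k _ => (hρ k).mul (hρ k).star).const_mul _

theorem isH1_symV (l k : Fin 3) : IsH1 (fun s => symV ε ρ a l k s - if l = k then 1 else 0) := by
  induction l using Fin.cases with
  | zero =>
    induction k using Fin.cases with
    | zero =>
      simp only [symV_zero_zero, ofReal_dens, if_true, add_sub_cancel_left]
      exact isH1_dens_sub_one hρ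
    | succ k =>
      have := ((hρ k).star.cexp_mul (-a)).const_mul (ε : ℂ)
      have e : (fun s => symV ε ρ a 0 k.succ s - if (0 : Fin 3) = k.succ then 1 else 0) =
          fun s : ℝ => (ε : ℂ) * (Complex.exp (2 * Real.pi * Complex.I * (-a : ℝ) * s) * conj (ρ k s)) := by
        ext s
        rw [if_neg (Fin.succ_ne_zero k).symm, symV_zero_succ, wave, sub_zero]; ring
      rw [e]; exact this
  | succ l =>
    induction k using Fin.cases with
    | zero =>
      have e : (fun s => symV ε ρ a l.succ 0 s - if l.succ = (0 : Fin 3) then 1 else 0) =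
          fun s : ℝ => Complex.exp (2 * Real.pi * Complex.I * a * s) * ρ l s := by
        ext s
        rw [if_neg (Fin.succ_ne_zero l), symV_succ_zero, wave, sub_zero, mul_comm]
      rw [e]; exact (hρ l).cexp_mul a
    | succ k =>
      simp only [symV_succ_succ, Fin.succ_inj, sub_self]
      exact IsH1.zero

theorem exists_rho_bound : ∃ B : ℝ, 0 ≤ B ∧ ∀ k s, ‖ρ k s‖ ≤ B := by
  choose B hB0 hB using fun k => (hρ k).bounded
  refine ⟨∑ k, B k, Finset.sum_nonneg fun k _ => hB0 k, fun k s => (hB k s).trans ?_⟩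
  exact Finset.single_le_sum (f := B) (fun i _ => hB0 i) (Finset.mem_univ k)

variable (hε : ε = 1 ∨ ε = -1) (hpos : ε = -1 → ∀ s, ∑ k, ‖ρ k s‖ ^ 2 < 1)
include hε hpos

/-- The smallness condition holds with a uniform margin, because `ρ` vanishes at infinity. -/
theorem exists_dens_lower : ∃ δ : ℝ, 0 < δ ∧ δ ≤ 1 ∧ ∀ s, δ ≤ dens ε ρ s := by
  rcases hε with rfl | rfl
  · refine ⟨1, one_pos, le_rfl, fun s => ?_⟩
    have : 0 ≤ ∑ k, ‖ρ k s‖ ^ 2 := Finset.sum_nonneg fun k _ => by positivity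
    rw [dens]; linarith
  · have hlim : Tendsto (fun s => ∑ k, ‖ρ k s‖ ^ 2) (cocompact ℝ) (𝓝 0) := by
      have := tendsto_finsetSum (Finset.univ : Finset (Fin 2)) fun k _ =>
        ((hρ k).tendsto_zero.norm.pow 2)
      simpa using this
    have hcont : Continuous (fun s => ∑ k, ‖ρ k s‖ ^ 2) :=
      continuous_finsetSum _ fun k _ => ((hρ k).continuous.norm.pow 2)
    have hev : ∀ᶠ s in cocompact ℝ, ∑ k, ‖ρ k s‖ ^ 2 < 1 / 2 :=
      hlim.eventually (gt_mem_nhds (by norm_num))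
    obtain ⟨K, hK, hKs⟩ := mem_cocompact.1 hev
    rcases K.eq_empty_or_nonempty with rfl | hne
    · refine ⟨1 / 2, by norm_num, by norm_num, fun s => ?_⟩
      have : ∑ k, ‖ρ k s‖ ^ 2 < 1 / 2 := hKs (by simp)
      rw [dens]; linarith
    · obtain ⟨s₀, -, hs₀⟩ := hK.exists_isMaxOn hne hcont.continuousOn
      have h0 := hpos rfl s₀
      have h00 : 0 ≤ ∑ k, ‖ρ k s₀‖ ^ 2 := Finset.sum_nonneg fun k _ => by positivity
      refine ⟨min (1 / 2) (1 - ∑ k, ‖ρ k s₀‖ ^ 2), lt_min (by norm_num) (by linarith),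
        (min_le_left _ _).trans (by norm_num), fun s => ?_⟩
      rw [dens]
      by_cases hs : s ∈ K
      · have := hs₀ hs
        have : ∑ k, ‖ρ k s‖ ^ 2 ≤ ∑ k, ‖ρ k s₀‖ ^ 2 := this
        have := min_le_right (1 / 2) (1 - ∑ k, ‖ρ k s₀‖ ^ 2)
        linarith
      · have : ∑ k, ‖ρ k s‖ ^ 2 < 1 / 2 := hKs hs
        have := min_le_left (1 / 2) (1 - ∑ k, ‖ρ k s₀‖ ^ 2)
        linarith

/-- The real part of the jump matrix is positive definite, uniformly in all parameters. -/
theorem exists_symV_coercive : ∃ c : ℝ, 0 < c ∧ ∀ (a s : ℝ) (w : Fin 3 → ℂ),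
    c * ∑ k, ‖w k‖ ^ 2 ≤ (∑ k, (∑ l, w l * symV ε ρ a l k s) * conj (w k)).re := by
  obtain ⟨δ, hδ0, hδ1, hδ⟩ := exists_dens_lower hρ hε hpos
  obtain ⟨B, hB0, hB⟩ := exists_rho_bound hρ
  have hform : ∀ (a s : ℝ) (w : Fin 3 → ℂ),
      (∑ k, (∑ l, w l * symV ε ρ a l k s) * conj (w k)).re =
        ‖w 0‖ ^ 2 * dens ε ρ s + ∑ k : Fin 2, ((1 + ε) * (w k.succ * (ρ k s * wave a s) * conj (w 0)).re
          + ‖w k.succ‖ ^ 2) := by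
    intro a s w
    have key : ∑ k, (∑ l, w l * symV ε ρ a l k s) * conj (w k) =
        ((‖w 0‖ ^ 2 * dens ε ρ s : ℝ) : ℂ) + ∑ k : Fin 2, (w k.succ * (ρ k s * wave a s) * conj (w 0) +
          ε * conj (w k.succ * (ρ k s * wave a s) * conj (w 0)) + ((‖w k.succ‖ ^ 2 : ℝ) : ℂ)) := by
      simp only [Fin.sum_univ_succ (n := 2), symV_zero_zero, symV_zero_succ, symV_succ_zero,
        symV_succ_succ]
      push_cast
      simp only [← Complex.mul_conj', map_mul, Complex.conj_conj, conj_wave]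
      simp only [mul_ite, mul_one, mul_zero, Finset.sum_ite_eq', Finset.mem_univ, if_true,
        add_mul, Finset.sum_mul, Finset.sum_add_distrib]
      have : ∀ i : Fin 2, w 0 * (ε * conj (ρ i s) * wave (-a) s) * conj (w i.succ) =
        ε * (conj (w i.succ) * (conj (ρ i s) * wave (-a) s) * w 0) := fun i => by ring
      simp only [this]
      ring
    rw [key, Complex.add_re, Complex.ofReal_re, Complex.re_sum]
    congr 1
    refine Finset.sum_congr rfl fun k _ => ?_
    rw [Complex.add_re, Complex.add_re, Complex.re_ofReal_mul, Complex.conj_re, Complex.ofReal_re]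
    ring
  have hc : 0 < min δ (1 / (2 + 4 * B ^ 2)) := lt_min hδ0 (by positivity)
  refine ⟨min δ (1 / (2 + 4 * B ^ 2)), hc, fun a s w => ?_⟩
  rw [hform, Fin.sum_univ_succ]
  have hw0 : 0 ≤ ‖w 0‖ ^ 2 := by positivity
  have hws : 0 ≤ ∑ k : Fin 2, ‖w k.succ‖ ^ 2 := Finset.sum_nonneg fun k _ => by positivity
  rcases hε with rfl | rfl
  · have hterm : ∀ k : Fin 2, ‖ρ k s‖ ^ 2 * ‖w 0‖ ^ 2 - 2 * (‖ρ k s‖ * ‖w 0‖ * ‖w k.succ‖) ≤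
        ‖ρ k s‖ ^ 2 * ‖w 0‖ ^ 2 + 2 * (w k.succ * (ρ k s * wave a s) * conj (w 0)).re := fun k => by
      have h1 := (abs_le.1 (Complex.abs_re_le_norm (w k.succ * (ρ k s * wave a s) * conj (w 0)))).1
      have e : ‖w k.succ * (ρ k s * wave a s) * conj (w 0)‖ = ‖ρ k s‖ * ‖w 0‖ * ‖w k.succ‖ := by
        rw [norm_mul, norm_mul, norm_mul, norm_wave, RCLike.norm_conj]; ring
      rw [e] at h1
      linarith
    have hsq : ∀ k : Fin 2, ‖w k.succ‖ ^ 2 ≤ 2 * (‖w k.succ‖ - ‖ρ k s‖ * ‖w 0‖) ^ 2 +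
        2 * (B ^ 2 * ‖w 0‖ ^ 2) := fun k => by
      have h2 : ‖ρ k s‖ ^ 2 * ‖w 0‖ ^ 2 ≤ B ^ 2 * ‖w 0‖ ^ 2 := by
        have := hB k s
        gcongr
      nlinarith [sq_nonneg (‖w k.succ‖ - 2 * (‖ρ k s‖ * ‖w 0‖))]
    have hmain : (∑ k : Fin 2, ‖w k.succ‖ ^ 2) ≤
        2 * ∑ k : Fin 2, (‖w k.succ‖ - ‖ρ k s‖ * ‖w 0‖) ^ 2 + 4 * B ^ 2 * ‖w 0‖ ^ 2 := by
      refine (Finset.sum_le_sum fun k _ => hsq k).trans_eq ?_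
      rw [Finset.sum_add_distrib, Finset.mul_sum]
      simp; ring
    have hS : 0 ≤ ∑ k : Fin 2, (‖w k.succ‖ - ‖ρ k s‖ * ‖w 0‖) ^ 2 :=
      Finset.sum_nonneg fun k _ => by positivity
    have hlow : ‖w 0‖ ^ 2 + ∑ k : Fin 2, (‖w k.succ‖ - ‖ρ k s‖ * ‖w 0‖) ^ 2 ≤
        ‖w 0‖ ^ 2 * dens 1 ρ s + ∑ k : Fin 2, ((1 + 1) *
          (w k.succ * (ρ k s * wave a s) * conj (w 0)).re + ‖w k.succ‖ ^ 2) := by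
      rw [dens, mul_add, mul_one, one_mul, add_assoc, Finset.mul_sum, ← Finset.sum_add_distrib]
      gcongr with k _
      have := hterm k
      nlinarith
    refine le_trans ?_ hlow
    have hle : ‖w 0‖ ^ 2 + ∑ k : Fin 2, ‖w k.succ‖ ^ 2 ≤ (2 + 4 * B ^ 2) *
        (‖w 0‖ ^ 2 + ∑ k : Fin 2, (‖w k.succ‖ - ‖ρ k s‖ * ‖w 0‖) ^ 2) := by
      have : 0 ≤ B ^ 2 * ∑ k : Fin 2, (‖w k.succ‖ - ‖ρ k s‖ * ‖w 0‖) ^ 2 := by positivity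
      nlinarith
    calc _ ≤ 1 / (2 + 4 * B ^ 2) * (‖w 0‖ ^ 2 + ∑ k : Fin 2, ‖w k.succ‖ ^ 2) := by
          gcongr; exact min_le_right _ _
      _ ≤ _ := by
          rw [one_div, inv_mul_le_iff₀ (by positivity)]
          exact hle
  · have h1 := hδ s
    have h2 := min_le_left δ (1 / (2 + 4 * B ^ 2))
    simp only [add_neg_cancel, zero_mul, zero_add]
    nlinarith [mul_le_mul_of_nonneg_left (h2.trans h1) hw0,
      mul_le_mul_of_nonneg_right (h2.trans hδ1) hws]

end symbol

/-! ### Existence of solutions -/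

/-- Row `j` of a solution of the Riemann-Hilbert problem, in terms of its boundary values: the row
is `e_j + m` from below and `e_j + n` from above. -/
structure IsRowSolution (ε : ℝ) (ρ : Fin 2 → ℝ → ℂ) (a : ℝ) (j : Fin 3) (m n : Fin 3 → ℝ → ℂ) :
    Prop where
  lower_h1 : ∀ k, IsH1 (m k)
  upper_h1 : ∀ k, IsH1 (n k)
  lower : ∀ k, LowerHardy (m k)
  upper : ∀ k, UpperHardy (n k)
  jump : ∀ k s, n k s + (if j = k then 1 else 0) =
    ∑ l, (m l s + if j = l then 1 else 0) * symV ε ρ a l k s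

/-- The rows exist: `m` solves the Toeplitz system with right hand side `e_j - e_j V`, and `n` is
the upper Hardy function left over. -/
theorem exists_rowSolution {ε : ℝ} {ρ : Fin 2 → ℝ → ℂ} (hρ : ∀ k, IsH1 (ρ k))
    (hε : ε = 1 ∨ ε = -1) (hpos : ε = -1 → ∀ s, ∑ k, ‖ρ k s‖ ^ 2 < 1) (a : ℝ) (j : Fin 3) :
    ∃ m n, IsRowSolution ε ρ a j m n := by
  obtain ⟨c, hc0, hc⟩ := exists_symV_coercive hρ hε hpos
  obtain ⟨m, hm1, hml, hmu⟩ := exists_toeplitz_solution (ι := Fin 3) (W := symV ε ρ a)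
    (E := fun l k s => symV ε ρ a l k s - if l = k then 1 else 0)
    (g := fun k s => -(symV ε ρ a j k s - if j = k then 1 else 0))
    (fun l k => isH1_symV hρ l k) (fun l k s => by ring) hc0 (hc a)
    (fun k => (isH1_symV hρ j k).neg)
  have hn : ∀ k s, ∑ l, m l s * symV ε ρ a l k s - -(symV ε ρ a j k s - if j = k then 1 else 0) =
      ∑ l, m l s * (symV ε ρ a l k s - if l = k then 1 else 0) + m k s +
        (symV ε ρ a j k s - if j = k then 1 else 0) := fun k s => by
    simp only [mul_sub, Finset.sum_sub_distrib, mul_ite, mul_one, mul_zero, Finset.sum_ite_eq',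
      Finset.mem_univ, if_true]
    ring
  refine ⟨m, fun k s => ∑ l, m l s * symV ε ρ a l k s -
    -(symV ε ρ a j k s - if j = k then 1 else 0), hm1, fun k => ?_, hml, hmu, fun k s => ?_⟩
  · simp only [hn]
    exact ((IsH1.sum Finset.univ fun l _ => (hm1 l).mul (isH1_symV hρ l k)).add (hm1 k)).add
      (isH1_symV hρ j k)
  · simp only [add_mul, Finset.sum_add_distrib, ite_mul, one_mul, zero_mul, Finset.sum_ite_eq,
      Finset.mem_univ, if_true]
    ring

theorem tendsto_lowerExt_boundary {m F : ℝ → ℂ} (hm : IsH1 m) (hl : LowerHardy m)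
    (h : IsFourierPair m F) (s : ℝ) :
    Tendsto (lowerExt F) (𝓝[{z : ℂ | z.im ≤ 0}] (s : ℂ)) (𝓝 (m s)) := by
  have h1 := (continuousOn_lowerExt (hm.integrable_fourier h)) (s : ℂ) (by simp)
  rw [ContinuousWithinAt, lowerExt_ofReal (hl.fourier_eq_zero h), ← hm.eq_fourierInv h] at h1
  exact h1

theorem tendsto_neg_nhdsWithin (s : ℝ) :
    Tendsto (fun z : ℂ => -z) (𝓝[{z : ℂ | 0 < z.im}] (s : ℂ)) (𝓝[{z : ℂ | z.im ≤ 0}] (-s : ℂ)) := by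
  refine tendsto_nhdsWithin_iff.2 ⟨(continuous_neg.tendsto _).mono_left nhdsWithin_le_nhds, ?_⟩
  filter_upwards [self_mem_nhdsWithin] with z hz
  have hz : 0 < z.im := hz
  simp [hz.le]

theorem tendsto_upperExt_boundary {n F : ℝ → ℂ} (hn : IsH1 n) (hu : UpperHardy n)
    (h : IsFourierPair n F) (s : ℝ) :
    Tendsto (upperExt F) (𝓝[{z : ℂ | 0 < z.im}] (s : ℂ)) (𝓝 (n s)) := by
  have hi := hn.integrable_fourier h
  have h1 := (continuousOn_lowerExt hi.comp_neg) ((-s : ℝ) : ℂ) (by simp)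
  have h0 := (Measure.measurePreserving_neg (volume : Measure ℝ)).quasiMeasurePreserving.ae
    (hu.fourier_eq_zero h)
  rw [ContinuousWithinAt, lowerExt_ofReal (by filter_upwards [h0] with ξ hξ h; exact hξ (by linarith))] at h1
  have e : 𝓕⁻ (fun ξ => F (-ξ)) (-s) = n s := by
    rw [hn.eq_fourierInv h, fourierInv_eq_integral, fourierInv_eq_integral, ← integral_neg_eq_self]
    congr 1; ext ξ; simp
  rw [e, Complex.ofReal_neg] at h1
  exact h1.comp (tendsto_neg_nhdsWithin s)

/-- The matrix function `1 + (extension of the boundary values)`, where `F` and `G` hold the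
transforms of the lower and of the upper boundary values. On the real line itself it takes the value
from below, which plays no role. -/
def rhpMatrix (F G : Fin 3 → Fin 3 → ℝ → ℂ) (z : ℂ) : Matrix (Fin 3) (Fin 3) ℂ :=
  Matrix.of fun j k => (if j = k then 1 else 0) +
    if 0 < z.im then upperExt (G j k) z else lowerExt (F j k) z

theorem isRHPSolution_rhpMatrix {ε : ℝ} {ρ₁ ρ₂ : ℝ → ℂ} {x : ℝ} {m n F G : Fin 3 → Fin 3 → ℝ → ℂ}
    (h : ∀ j, IsRowSolution ε ![ρ₁, ρ₂] (x / Real.pi) j (m j) (n j))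
    (hF : ∀ j k, IsFourierPair (m j k) (F j k)) (hG : ∀ j k, IsFourierPair (n j k) (G j k)) :
    IsRHPSolution ε ρ₁ ρ₂ x (rhpMatrix F G) := by
  have hFi : ∀ j k, Integrable (F j k) := fun j k => ((h j).lower_h1 k).integrable_fourier (hF j k)
  have hGi : ∀ j k, Integrable (G j k) := fun j k => ((h j).upper_h1 k).integrable_fourier (hG j k)
  have hup : ∀ j k (z : ℂ), 0 < z.im → rhpMatrix F G z j k = (if j = k then 1 else 0) +
      upperExt (G j k) z := fun j k z hz => by simp [rhpMatrix, hz]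
  have hlo : ∀ j k (z : ℂ), z.im ≤ 0 → rhpMatrix F G z j k = (if j = k then 1 else 0) +
      lowerExt (F j k) z := fun j k z hz => by simp [rhpMatrix, hz.not_gt]
  refine ⟨fun j k => ?_, ?_, fun s => Matrix.of fun j k => n j k s + if j = k then 1 else 0,
    fun s => Matrix.of fun j k => m j k s + if j = k then 1 else 0, ?_, ?_, ?_, ?_, ?_⟩
  · intro z hz
    have hz : z.im ≠ 0 := hz
    refine DifferentiableAt.differentiableWithinAt ?_
    rcases lt_or_gt_of_ne hz with h1 | h1
    · have hnhds : {z : ℂ | z.im < 0} ∈ 𝓝 z :=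
        (isOpen_lt Complex.continuous_im continuous_const).mem_nhds h1
      have hd := ((differentiableOn_lowerExt (hFi j k)).differentiableAt hnhds).const_add
        (if j = k then 1 else 0)
      refine hd.congr_of_eventuallyEq ?_
      filter_upwards [hnhds] with w hw using hlo j k w (le_of_lt hw)
    · have hnhds : {z : ℂ | 0 < z.im} ∈ 𝓝 z :=
        (isOpen_lt continuous_const Complex.continuous_im).mem_nhds h1
      have hnhds' : {z : ℂ | z.im < 0} ∈ 𝓝 (-z) :=
        (isOpen_lt Complex.continuous_im continuous_const).mem_nhds (by simpa using h1)
      have hd := (((differentiableOn_lowerExt (hGi j k).comp_neg).differentiableAt hnhds').comp z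
        differentiableAt_id.neg).const_add (if j = k then 1 else 0)
      refine hd.congr_of_eventuallyEq ?_
      filter_upwards [hnhds] with w hw using hup j k w hw
  · refine tendsto_pi_nhds.2 fun j => tendsto_pi_nhds.2 fun k => ?_
    rw [Matrix.one_apply]
    have hcov : cocompact ℂ ⊓ 𝓟 {z : ℂ | z.im ≠ 0} ≤ (cocompact ℂ ⊓ 𝓟 {z : ℂ | 0 < z.im}) ⊔
        (cocompact ℂ ⊓ 𝓟 {z : ℂ | z.im ≤ 0}) := by
      rw [← inf_sup_left, sup_principal]
      refine inf_le_inf_left _ (principal_mono.2 fun z hz => ?_)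
      rcases lt_or_ge 0 z.im with h | h
      · exact Or.inl h
      · exact Or.inr h
    refine Tendsto.mono_left (Tendsto.sup ?_ ?_) hcov
    · have hneg : Tendsto (fun z : ℂ => -z) (cocompact ℂ ⊓ 𝓟 {z : ℂ | 0 < z.im})
          (cocompact ℂ ⊓ 𝓟 {z : ℂ | z.im ≤ 0}) := by
        refine tendsto_inf.2 ⟨((Homeomorph.neg ℂ).isClosedEmbedding.tendsto_cocompact).mono_left
          inf_le_left, tendsto_principal.2 ?_⟩
        filter_upwards [mem_inf_of_right (mem_principal_self _)] with z hz
        have hz : 0 < z.im := hz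
        simp [hz.le]
      have ht := ((tendsto_lowerExt (hGi j k).comp_neg).comp hneg).const_add
        (if j = k then (1 : ℂ) else 0)
      rw [add_zero] at ht
      refine ht.congr' ?_
      filter_upwards [mem_inf_of_right (mem_principal_self _)] with z hz
      exact (hup j k z hz).symm
    · have ht := (tendsto_lowerExt (hFi j k)).const_add (if j = k then (1 : ℂ) else 0)
      rw [add_zero] at ht
      refine ht.congr' ?_
      filter_upwards [mem_inf_of_right (mem_principal_self _)] with z hz
      exact (hlo j k z hz).symm
  · exact continuous_matrix fun j k => ((h j).upper_h1 k).continuous.add continuous_const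
  · exact continuous_matrix fun j k => ((h j).lower_h1 k).continuous.add continuous_const
  · refine fun s => tendsto_pi_nhds.2 fun j => tendsto_pi_nhds.2 fun k => ?_
    have ht := (tendsto_upperExt_boundary ((h j).upper_h1 k) ((h j).upper k) (hG j k) s).const_add
      (if j = k then (1 : ℂ) else 0)
    rw [add_comm] at ht
    refine ht.congr' ?_
    filter_upwards [self_mem_nhdsWithin] with z hz
    exact (hup j k z hz).symm
  · refine fun s => tendsto_pi_nhds.2 fun j => tendsto_pi_nhds.2 fun k => ?_
    have hsub : {z : ℂ | z.im < 0} ⊆ {z : ℂ | z.im ≤ 0} := fun z hz =>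
      (le_of_lt (show z.im < 0 from hz) : z.im ≤ 0)
    have ht := ((tendsto_lowerExt_boundary ((h j).lower_h1 k) ((h j).lower k) (hF j k) s).mono_left
      (nhdsWithin_mono _ hsub)).const_add (if j = k then (1 : ℂ) else 0)
    rw [add_comm] at ht
    refine ht.congr' ?_
    filter_upwards [self_mem_nhdsWithin] with z hz
    exact (hlo j k z (le_of_lt hz)).symm
  · intro s
    ext j k
    rw [Matrix.mul_apply]
    change n j k s + (if j = k then 1 else 0) =
      ∑ l, (m j l s + if j = l then 1 else 0) * jumpVx ε ρ₁ ρ₂ x s l k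
    rw [(h j).jump k s]
    refine Finset.sum_congr rfl fun l _ => ?_
    rw [jumpVx_apply]

/-! ### Decay of the Hardy parts of a modulated Sobolev function -/

theorem one_add_abs_le_norm_dsym (η : ℝ) : 1 + |η| ≤ 2 * ‖dsym 1 η‖ := by
  have h := normSq_dsym 1 η
  have h3 : (2 * Real.pi * η) ^ 2 = (2 * Real.pi) ^ 2 * |η| ^ 2 := by rw [mul_pow, sq_abs]
  have h4 : (1 : ℝ) ≤ (2 * Real.pi) ^ 2 := by nlinarith [Real.pi_gt_three]
  have h5 : |η| ^ 2 ≤ (2 * Real.pi) ^ 2 * |η| ^ 2 := le_mul_of_one_le_left (by positivity) h4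
  refine le_of_sq_le_sq ?_ (by positivity)
  rw [mul_pow, h, h3]
  nlinarith [sq_nonneg (|η| - 1)]

/-- Modulating an `H¹` function by `e^{2πias}` moves its Fourier transform by `a`, so the Hardy part
that is pushed away by the translation has `L²` norm `O(1/(1+|a|))`. -/
theorem IsH1.exists_wave_splitting {f : ℝ → ℂ} (hf : IsH1 f) : ∃ C : ℝ, 0 ≤ C ∧ ∀ a : ℝ,
    ∃ A B : ℝ → ℂ, LowerHardy A ∧ UpperHardy B ∧ (∀ s, wave a s * f s = A s + B s) ∧
      (0 ≤ a → l2norm A ≤ C / (1 + |a|)) ∧ (a ≤ 0 → l2norm B ≤ C / (1 + |a|)) := by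
  obtain ⟨F, hF⟩ := IsFourierPair.of_memLp hf.memLp
  have hG := hf.memLp_dsym_mul hF 1
  set G : ℝ → ℂ := fun ξ => dsym 1 ξ * F ξ with hGdef
  refine ⟨2 * l2norm G, mul_nonneg zero_le_two (l2norm_nonneg _), fun a => ?_⟩
  obtain ⟨A, B, hA, hB, hs, hnA, hnB⟩ := exists_hardy_splitting (hF.cexp_mul a)
  have hGa : MemLp (fun ξ => G (ξ - a)) 2 volume := by
    simpa [sub_eq_add_neg] using IsFourierPair.memLp_comp_add hG (-a)
  have hGn : l2norm (fun ξ => G (ξ - a)) = l2norm G := by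
    have := IsFourierPair.eLpNorm_comp_add G hG.1 (-a)
    simp only [← sub_eq_add_neg] at this
    simp only [l2norm, this]
  have hpos : 0 < 1 + |a| := by positivity
  have key : ∀ S : Set ℝ, (∀ ξ ∈ S, |a| ≤ |ξ - a|) →
      l2norm (S.indicator fun ξ => F (ξ - a)) ≤ 2 * l2norm G / (1 + |a|) := fun S hS => by
    rw [← hGn, mul_div_right_comm]
    refine l2norm_le_mul hGa (by positivity) (Eventually.of_forall fun ξ => ?_)
    by_cases hξ : ξ ∈ S
    · rw [Set.indicator_of_mem hξ, hGdef, norm_mul, div_mul_eq_mul_div, le_div_iff₀ hpos]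
      have h1 := one_add_abs_le_norm_dsym (ξ - a)
      have h2 := hS ξ hξ
      nlinarith [mul_le_mul_of_nonneg_left ((add_le_add_right h2 1).trans h1)
        (norm_nonneg (F (ξ - a)))]
    · rw [Set.indicator_of_notMem hξ, norm_zero]
      positivity
  refine ⟨A, B, hA, hB, hs, fun ha => ?_, fun ha => ?_⟩
  · rw [hnA]
    refine key _ fun ξ hξ => ?_
    have hξ : ξ < 0 := hξ
    rw [abs_of_nonneg ha, abs_of_nonpos (by linarith)]
    linarith
  · rw [hnB]
    refine key _ fun ξ hξ => ?_
    have hξ : 0 ≤ ξ := hξ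
    rw [abs_of_nonpos ha, abs_of_nonneg (by linarith)]
    linarith

/-! ### The first column of a row solution -/

section rows

variable {ε : ℝ} {ρ : Fin 2 → ℝ → ℂ} {a : ℝ} {j : Fin 2} {m n : Fin 3 → ℝ → ℂ}

theorem sum_mul_symV_zero (w : Fin 3 → ℂ) (s : ℝ) : ∑ l, w l * symV ε ρ a l 0 s =
    w 0 * dens ε ρ s + wave a s * ∑ k : Fin 2, w k.succ * ρ k s := by
  rw [Fin.sum_univ_succ, Finset.mul_sum]
  simp only [symV_zero_zero, symV_succ_zero]
  congr 1
  exact Finset.sum_congr rfl fun k _ => by ring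

theorem sum_mul_symV_succ (w : Fin 3 → ℂ) (k : Fin 2) (s : ℝ) : ∑ l, w l * symV ε ρ a l k.succ s =
    w k.succ + ε * conj (ρ k s) * wave (-a) s * w 0 := by
  rw [Fin.sum_univ_succ]
  simp only [symV_zero_succ, symV_succ_succ, mul_ite, mul_one, mul_zero, Finset.sum_ite_eq',
    Finset.mem_univ, if_true]
  ring

theorem IsRowSolution.jump_zero (h : IsRowSolution ε ρ a j.succ m n) (s : ℝ) :
    n 0 s = m 0 s * dens ε ρ s + wave a s * (ρ j s + ∑ k : Fin 2, m k.succ s * ρ k s) := by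
  have := h.jump 0 s
  rw [sum_mul_symV_zero fun l => m l s + if j.succ = l then 1 else 0] at this
  simpa only [Fin.succ_inj, Fin.succ_ne_zero, if_false, add_zero,
    add_mul, ite_mul, zero_mul, one_mul, Finset.sum_add_distrib, Finset.sum_ite_eq,
    Finset.mem_univ, if_true, add_comm (ρ j s)] using this

theorem IsRowSolution.jump_succ (h : IsRowSolution ε ρ a j.succ m n) (k : Fin 2) (s : ℝ) :
    n k.succ s = m k.succ s + ε * conj (ρ k s) * wave (-a) s * m 0 s := by
  have := h.jump k.succ s
  rw [sum_mul_symV_succ fun l => m l s + if j.succ = l then 1 else 0] at this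
  simp only [Fin.succ_inj, Fin.succ_ne_zero, if_false, add_zero] at this
  linear_combination this

/-- The lower values `m_0` cancel in the jump of the first entry, because the last two columns of
the jump condition express `m_k` through `n_k` and `m_0`. -/
theorem IsRowSolution.sub_eq (h : IsRowSolution ε ρ a j.succ m n) (s : ℝ) :
    n 0 s - m 0 s = wave a s * (ρ j s + ∑ k : Fin 2, ρ k s * n k.succ s) := by
  have hw := wave_neg_mul a s
  simp only [h.jump_zero, h.jump_succ, ofReal_dens, mul_add, Finset.mul_sum,
    Finset.sum_add_distrib]
  have e : ∀ k : Fin 2, wave a s * (ρ k s * (ε * conj (ρ k s) * wave (-a) s * m 0 s)) =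
      m 0 s * (ε * (ρ k s * conj (ρ k s))) := fun k => by
    linear_combination (ρ k s * (ε * conj (ρ k s) * m 0 s)) * hw
  have e' : ∀ k : Fin 2, wave a s * (ρ k s * m k.succ s) = wave a s * (m k.succ s * ρ k s) :=
    fun k => by ring
  simp only [e, e']
  ring

theorem l2norm_zero : l2norm (fun _ => 0) = 0 := by simp [l2norm]

theorem memLp_wave_mul {f : ℝ → ℂ} (a : ℝ) (hf : MemLp f 2 volume) :
    MemLp (fun s => wave a s * f s) 2 volume := IsFourierPair.memLp_cexp_mul a hf

/-- For `a ≥ 0` the row is close to `e_j`: up to an integrable remainder with integral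
`O((1+|a|)⁻²)`, the jump of its first entry is the modulated datum `ρ_j`. -/
theorem exists_remainder_nonneg (hρ : ∀ k, IsH1 (ρ k)) (hε : ε = 1 ∨ ε = -1)
    (hpos : ε = -1 → ∀ s, ∑ k, ‖ρ k s‖ ^ 2 < 1) (j : Fin 2) :
    ∃ C : ℝ, 0 ≤ C ∧ ∀ a, 0 ≤ a → ∀ m n, IsRowSolution ε ρ a j.succ m n →
      ∃ g, Integrable g ∧ MemLp g 2 volume ∧ (∀ s, n 0 s - m 0 s = wave a s * ρ j s + g s) ∧
        ‖∫ s, g s‖ ≤ C / (1 + |a|) ^ 2 := by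
  obtain ⟨c, hc0, hc⟩ := exists_symV_coercive hρ hε hpos
  obtain ⟨R, hR0, hR⟩ := exists_rho_bound hρ
  choose D hD0 hD using fun k => (hρ k).exists_wave_splitting
  have hε1 : ‖(ε : ℂ)‖ = 1 := by rcases hε with rfl | rfl <;> simp
  refine ⟨∑ k, D k * ((1 + R) * (c⁻¹ * D j)), Finset.sum_nonneg fun k _ => by
    have := hD0 k; have := hD0 j; positivity, fun a ha m n h => ?_⟩
  choose A B hA hB hAB hA' hB' using fun k => hD k a
  have hpa : 0 < 1 + |a| := by positivity
  -- the upper part `B j` of the datum is absorbed in `n_0`; the residual is its lower part `A j`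
  have hm : ∀ i, l2norm (m i) ≤ c⁻¹ * D j / (1 + |a|) := fun i => by
    have := toeplitz_bound hc0 (hc a) (m := m)
      (b := Fin.cases (fun s => n 0 s - B j s) fun k => n k.succ)
      (e := Fin.cases (fun s => -A j s) fun _ _ => 0) h.lower
      (fun k => by
        induction k using Fin.cases with
        | zero => exact (h.upper 0).sub (hB j)
        | succ k => exact h.upper k.succ)
      (fun k => by
        induction k using Fin.cases with
        | zero => exact (hA j).memLp.neg
        | succ k => exact MemLp.zero)
      (fun k s => by
        induction k using Fin.cases with
        | zero =>
          have h1 := h.jump_zero s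
          have h2 := hAB j s
          rw [sum_mul_symV_zero fun l => m l s]
          simp only [Fin.cases_zero]
          linear_combination -h1 - h2
        | succ k =>
          rw [sum_mul_symV_succ fun l => m l s]
          simp only [Fin.cases_succ, add_zero]
          exact (h.jump_succ k s).symm) i
    rw [Fin.sum_univ_succ] at this
    simp only [Fin.cases_zero, Fin.cases_succ, l2norm_zero, Finset.sum_const_zero, add_zero,
      l2norm_neg] at this
    refine this.trans ?_
    rw [mul_div_assoc]
    exact mul_le_mul_of_nonneg_left (hA' j ha) (by positivity)
  have hn : ∀ k : Fin 2, l2norm (n k.succ) ≤ (1 + R) * (c⁻¹ * D j) / (1 + |a|) := fun k => by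
    have hb : ∀ s, ‖(ε : ℂ) * conj (ρ k s) * wave (-a) s‖ ≤ R := fun s => by
      rw [norm_mul, norm_mul, hε1, RCLike.norm_conj, norm_wave, one_mul, mul_one]
      exact hR k s
    have hcont : Continuous fun s => (ε : ℂ) * conj (ρ k s) * wave (-a) s :=
      (continuous_const.mul (Complex.continuous_conj.comp (hρ k).continuous)).mul
        (continuous_wave _)
    have h1 : n k.succ = fun s => m k.succ s + ε * conj (ρ k s) * wave (-a) s * m 0 s :=
      funext fun s => h.jump_succ k s
    rw [h1]
    refine (l2norm_add_le (h.lower k.succ).memLp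
      (memLp_mul_bdd (h.lower 0).memLp hcont.aestronglyMeasurable hb)).trans ?_
    have h2 := l2norm_le_mul (f := fun s => ε * conj (ρ k s) * wave (-a) s * m 0 s)
      (h.lower 0).memLp hR0 (Eventually.of_forall fun s => by
        rw [norm_mul]; exact mul_le_mul_of_nonneg_right (hb s) (norm_nonneg _))
    have h3 := hm 0
    have h4 := hm k.succ
    have h5 := mul_le_mul_of_nonneg_left h3 hR0
    rw [mul_div_assoc, add_mul, one_mul]
    exact add_le_add h4 (h2.trans h5)
  have hi : ∀ k : Fin 2, Integrable fun s => wave a s * ρ k s * n k.succ s := fun k =>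
    integrable_mul_of_memLp (memLp_wave_mul a (hρ k).memLp) (h.upper k.succ).memLp
  have hg : (fun s => wave a s * ∑ k : Fin 2, ρ k s * n k.succ s) =
      fun s => ∑ k : Fin 2, wave a s * ρ k s * n k.succ s := by
    funext s; rw [Finset.mul_sum]; exact Finset.sum_congr rfl fun k _ => by ring
  refine ⟨fun s => wave a s * ∑ k : Fin 2, ρ k s * n k.succ s, ?_, ?_, fun s => ?_, ?_⟩
  · rw [hg]
    exact integrable_finsetSum _ fun k _ => hi k
  · exact memLp_wave_mul a (IsH1.sum Finset.univ fun (k : Fin 2) _ =>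
      (hρ k).mul (h.upper_h1 k.succ)).memLp
  · rw [h.sub_eq s, mul_add]
  · rw [hg, integral_finsetSum _ fun k _ => hi k, Finset.sum_div]
    refine (norm_sum_le _ _).trans (Finset.sum_le_sum fun k _ => ?_)
    -- only the lower part of `e^{2πias} ρ_k` pairs with the upper Hardy function `n_k`
    have e : ∫ s, wave a s * ρ k s * n k.succ s = ∫ s, A k s * n k.succ s := by
      simp only [hAB, add_mul]
      rw [integral_add (integrable_mul_of_memLp (hA k).memLp (h.upper _).memLp)
        (integrable_mul_of_memLp (hB k).memLp (h.upper _).memLp),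
        (hB k).integral_mul_eq_zero (h.upper _), add_zero]
    rw [e]
    refine (norm_integral_mul_le (hA k).memLp (h.upper _).memLp).trans ?_
    calc _ ≤ D k / (1 + |a|) * ((1 + R) * (c⁻¹ * D j) / (1 + |a|)) :=
          mul_le_mul (hA' k ha) (hn k) (l2norm_nonneg _) (by have := hD0 k; positivity)
      _ = _ := by rw [div_mul_div_comm, sq]

end rows

/-! ### The limiting problem at `-∞` -/

section schur

variable {ε : ℝ} {ρ : Fin 2 → ℝ → ℂ}

theorem exists_dens_bounds (hρ : ∀ k, IsH1 (ρ k)) (hε : ε = 1 ∨ ε = -1)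
    (hpos : ε = -1 → ∀ s, ∑ k, ‖ρ k s‖ ^ 2 < 1) :
    ∃ δ K : ℝ, 0 < δ ∧ 1 ≤ K ∧ ∀ s, δ ≤ dens ε ρ s ∧ dens ε ρ s ≤ K := by
  obtain ⟨δ, hδ0, -, hδ⟩ := exists_dens_lower hρ hε hpos
  obtain ⟨R, hR0, hR⟩ := exists_rho_bound hρ
  refine ⟨δ, 1 + 2 * R ^ 2, hδ0, by nlinarith [sq_nonneg R], fun s => ⟨hδ s, ?_⟩⟩
  have h0 : 0 ≤ ∑ k, ‖ρ k s‖ ^ 2 := Finset.sum_nonneg fun k _ => by positivity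
  have h1 : ∑ k, ‖ρ k s‖ ^ 2 ≤ 2 * R ^ 2 := by
    calc _ ≤ ∑ _k : Fin 2, R ^ 2 := Finset.sum_le_sum fun k _ => by
          have := hR k s
          gcongr
      _ = _ := by simp
  rw [dens]
  rcases hε with rfl | rfl <;> nlinarith [sq_nonneg R]

theorem isH1_dens_inv_sub_one (hρ : ∀ k, IsH1 (ρ k)) {δ : ℝ} (hδ0 : 0 < δ)
    (hδ : ∀ s, δ ≤ dens ε ρ s) : IsH1 (fun s => (dens ε ρ s : ℂ)⁻¹ - 1) := by
  have := (isH1_dens_sub_one (ε := ε) hρ).inv_one_add_sub_one hδ0 fun s => by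
    rw [← ofReal_dens, Complex.norm_real]
    exact (hδ s).trans (le_abs_self _)
  simpa only [← ofReal_dens] using this

theorem isH1_mul_dens_inv (hρ : ∀ k, IsH1 (ρ k)) {δ : ℝ} (hδ0 : 0 < δ)
    (hδ : ∀ s, δ ≤ dens ε ρ s) (k : Fin 2) : IsH1 (fun s => ρ k s * (dens ε ρ s : ℂ)⁻¹) := by
  have := (hρ k).add ((hρ k).mul (isH1_dens_inv_sub_one hρ hδ0 hδ))
  simpa only [mul_sub, mul_one, add_sub_cancel] using this

/-- The Schur complement `1 - ε ρ ρ* / d` has spectrum `{1, 1 / d}`, hence is bounded below. -/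
theorem schur_coercive (hε : ε = 1 ∨ ε = -1) {K : ℝ} (hK : 1 ≤ K) {s : ℝ} (h0 : 0 < dens ε ρ s)
    (h1 : dens ε ρ s ≤ K) (w : Fin 2 → ℂ) : K⁻¹ * ∑ k, ‖w k‖ ^ 2 ≤
      (∑ k, (∑ l, w l * ((if l = k then 1 else 0) -
        ε * (ρ l s * (dens ε ρ s : ℂ)⁻¹) * conj (ρ k s))) * conj (w k)).re := by
  set y : ℂ := ∑ l, w l * ρ l s with hy
  have key : ∑ k, (∑ l, w l * ((if l = k then 1 else 0) -
        ε * (ρ l s * (dens ε ρ s : ℂ)⁻¹) * conj (ρ k s))) * conj (w k) =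
      ((∑ k, ‖w k‖ ^ 2 - ε * (dens ε ρ s)⁻¹ * ‖y‖ ^ 2 : ℝ) : ℂ) := by
    push_cast
    simp only [← Complex.mul_conj', hy, map_sum, map_mul]
    simp only [Fin.sum_univ_two]
    simp
    ring
  rw [key, Complex.ofReal_re]
  have hS : 0 ≤ ∑ k, ‖w k‖ ^ 2 := Finset.sum_nonneg fun k _ => by positivity
  have hy2 : ‖y‖ ^ 2 ≤ (∑ k, ‖w k‖ ^ 2) * ∑ k, ‖ρ k s‖ ^ 2 := by
    refine le_trans ?_ (Finset.sum_mul_sq_le_sq_mul_sq Finset.univ _ _)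
    refine pow_le_pow_left₀ (norm_nonneg _) ((norm_sum_le _ _).trans_eq ?_) 2
    simp only [norm_mul]
  have hKi : K⁻¹ ≤ (dens ε ρ s)⁻¹ := inv_anti₀ h0 h1
  have hdi : 0 < (dens ε ρ s)⁻¹ := inv_pos.2 h0
  rcases hε with rfl | rfl
  · have e : (dens 1 ρ s)⁻¹ * ((∑ k, ‖w k‖ ^ 2) * ∑ k, ‖ρ k s‖ ^ 2) =
        ∑ k, ‖w k‖ ^ 2 - (dens 1 ρ s)⁻¹ * ∑ k, ‖w k‖ ^ 2 := by
      have : ∑ k, ‖ρ k s‖ ^ 2 = dens 1 ρ s - 1 := by rw [dens]; ring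
      rw [this]
      field_simp
    nlinarith [mul_le_mul_of_nonneg_left hy2 hdi.le, mul_le_mul_of_nonneg_right hKi hS]
  · have h2 : K⁻¹ ≤ 1 := inv_le_one_of_one_le₀ hK
    nlinarith [mul_nonneg hdi.le (sq_nonneg ‖y‖), mul_le_mul_of_nonneg_right h2 hS]

/-- Scalar factor: `1 + β` extends to the lower half plane and `(1 + β) / d` to the upper one. -/
theorem exists_scalar_factor (hρ : ∀ k, IsH1 (ρ k)) (hε : ε = 1 ∨ ε = -1)
    (hpos : ε = -1 → ∀ s, ∑ k, ‖ρ k s‖ ^ 2 < 1) : ∃ β : ℝ → ℂ, IsH1 β ∧ LowerHardy β ∧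
      UpperHardy (fun s => β s * (dens ε ρ s : ℂ)⁻¹ - (1 - (dens ε ρ s : ℂ)⁻¹)) := by
  obtain ⟨δ, K, hδ0, hK, hd⟩ := exists_dens_bounds hρ hε hpos
  have h1 := isH1_dens_inv_sub_one hρ hδ0 fun s => (hd s).1
  obtain ⟨m, hm1, hml, hmu⟩ := exists_toeplitz_solution (ι := Fin 1)
    (W := fun _ _ s => (dens ε ρ s : ℂ)⁻¹) (E := fun _ _ s => (dens ε ρ s : ℂ)⁻¹ - 1)
    (g := fun _ s => -((dens ε ρ s : ℂ)⁻¹ - 1)) (fun _ _ => h1)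
    (fun l k s => by simp [Subsingleton.elim l k])
    (c := K⁻¹) (by positivity) (fun s w => by
      simp only [Finset.univ_unique, Fin.default_eq_zero, Finset.sum_singleton]
      have e : w 0 * (dens ε ρ s : ℂ)⁻¹ * conj (w 0) =
          (((dens ε ρ s)⁻¹ * ‖w 0‖ ^ 2 : ℝ) : ℂ) := by
        push_cast
        rw [← Complex.mul_conj']
        ring
      rw [e, Complex.ofReal_re]
      have := inv_anti₀ (hδ0.trans_le (hd s).1) (hd s).2
      gcongr) (fun _ => h1.neg)
  refine ⟨m 0, hm1 0, hml 0, ?_⟩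
  simpa using hmu 0

/-- Solution of the limiting problem for `a → -∞`, whose symbol is the Schur complement of the
corner entry of the jump matrix. -/
theorem exists_schur_row (hρ : ∀ k, IsH1 (ρ k)) (hε : ε = 1 ∨ ε = -1)
    (hpos : ε = -1 → ∀ s, ∑ k, ‖ρ k s‖ ^ 2 < 1) (j : Fin 2) : ∃ m : Fin 2 → ℝ → ℂ,
      (∀ k, IsH1 (m k)) ∧ (∀ k, LowerHardy (m k)) ∧
      ∀ k, UpperHardy (fun s => m k s - ε * conj (ρ k s) *
        ∑ l, (m l s + if j = l then 1 else 0) * (ρ l s * (dens ε ρ s : ℂ)⁻¹)) := by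
  obtain ⟨δ, K, hδ0, hK, hd⟩ := exists_dens_bounds hρ hε hpos
  have hr := isH1_mul_dens_inv hρ hδ0 fun s => (hd s).1
  obtain ⟨m, hm1, hml, hmu⟩ := exists_toeplitz_solution (ι := Fin 2)
    (W := fun l k s => (if l = k then 1 else 0) -
        ε * (ρ l s * (dens ε ρ s : ℂ)⁻¹) * conj (ρ k s))
    (E := fun l k s => -(ε * ((ρ l s * (dens ε ρ s : ℂ)⁻¹) * conj (ρ k s))))
    (g := fun k s => ε * ((ρ j s * (dens ε ρ s : ℂ)⁻¹) * conj (ρ k s)))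
    (fun l k => (((hr l).mul (hρ k).star).const_mul _).neg) (fun l k s => by ring)
    (c := K⁻¹) (by positivity)
    (fun s w => schur_coercive hε hK (hδ0.trans_le (hd s).1) (hd s).2 w)
    (fun k => ((hr j).mul (hρ k).star).const_mul _)
  refine ⟨m, hm1, hml, fun k => ?_⟩
  convert hmu k using 2 with s
  simp only [mul_sub, add_mul, ite_mul, one_mul, zero_mul, mul_ite, mul_one, mul_zero,
    Finset.sum_add_distrib, Finset.sum_sub_distrib, Finset.sum_ite_eq, Finset.sum_ite_eq',
    Finset.mem_univ, if_true, mul_add, Finset.mul_sum]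
  have e : ∀ l, (ε : ℂ) * conj (ρ k s) * (m l s * (ρ l s * (dens ε ρ s : ℂ)⁻¹)) =
      m l s * (ε * (ρ l s * (dens ε ρ s : ℂ)⁻¹) * conj (ρ k s)) := fun l => by ring
  simp only [e]
  ring

end schur

/-! ### The first column for negative parameters -/

section nonpos

variable {ε : ℝ} {ρ : Fin 2 → ℝ → ℂ}

/-- For `a ≤ 0` the row is close to an explicit approximate solution, built from the limiting
problem for the Schur complement. The datum `ρ_j` is replaced by the `H¹` function
`(1 + β) ∑ₖ (e_j + m)ₖ ρₖ / d`, and the remainder is again `O((1+|a|)⁻²)`. -/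
theorem exists_remainder_nonpos (hρ : ∀ k, IsH1 (ρ k)) (hε : ε = 1 ∨ ε = -1)
    (hpos : ε = -1 → ∀ s, ∑ k, ‖ρ k s‖ ^ 2 < 1) (j : Fin 2) :
    ∃ f, IsH1 f ∧ ∃ C : ℝ, 0 ≤ C ∧ ∀ a, a ≤ 0 → ∀ m n, IsRowSolution ε ρ a j.succ m n →
      ∃ g, Integrable g ∧ MemLp g 2 volume ∧ (∀ s, n 0 s - m 0 s = wave a s * f s + g s) ∧
        ‖∫ s, g s‖ ≤ C / (1 + |a|) ^ 2 := by
  obtain ⟨c, hc0, hc⟩ := exists_symV_coercive hρ hε hpos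
  obtain ⟨R, hR0, hR⟩ := exists_rho_bound hρ
  obtain ⟨δ, K, hδ0, hK, hd⟩ := exists_dens_bounds hρ hε hpos
  have hr := isH1_mul_dens_inv hρ hδ0 fun s => (hd s).1
  obtain ⟨β, hβ1, hβl, hβu⟩ := exists_scalar_factor hρ hε hpos
  obtain ⟨b, hb1, hbl, hbu⟩ := exists_schur_row hρ hε hpos j
  have hε1 : ‖(ε : ℂ)‖ = 1 := by rcases hε with rfl | rfl <;> simp
  have hd0 : ∀ s, (dens ε ρ s : ℂ) ≠ 0 := fun s => by
    exact_mod_cast (hδ0.trans_le (hd s).1).ne'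
  have hcd : Continuous fun s => (dens ε ρ s : ℂ) := by
    simp only [ofReal_dens]
    exact continuous_const.add (isH1_dens_sub_one hρ).continuous
  set S : ℝ → ℂ := fun s => ∑ l, (b l s + if j = l then 1 else 0) *
    (ρ l s * (dens ε ρ s : ℂ)⁻¹) with hS
  have hS1 : IsH1 S := by
    refine IsH1.sum Finset.univ fun l _ => ?_
    simp only [add_mul]
    exact ((hb1 l).mul (hr l)).add ((hr l).const_mul _)
  have hSd : ∀ s, S s * dens ε ρ s = ρ j s + ∑ l, b l s * ρ l s := fun s => by
    have e : ∀ l, (b l s + if j = l then 1 else 0) * (ρ l s * (dens ε ρ s : ℂ)⁻¹) *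
        dens ε ρ s = (if j = l then ρ l s else 0) + b l s * ρ l s := fun l => by
      have := hd0 s
      split_ifs <;> field_simp <;> ring
    rw [hS, Finset.sum_mul]
    simp only [e, Finset.sum_add_distrib, Finset.sum_ite_eq, Finset.mem_univ, if_true]
  have ht : ∀ k, IsH1 fun s => ρ k s * (dens ε ρ s : ℂ)⁻¹ * (1 + β s) := fun k => by
    simpa only [mul_add, mul_one] using (hr k).add ((hr k).mul hβ1)
  have hf1 : IsH1 fun s => S s * (1 + β s) := by
    simpa only [mul_add, mul_one] using hS1.add (hS1.mul hβ1)
  obtain ⟨E, hE0, hE⟩ := hS1.exists_wave_splitting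
  choose D hD0 hD using fun k => (ht k).exists_wave_splitting
  refine ⟨fun s => S s * (1 + β s), hf1, ∑ k, D k * (c⁻¹ * ((K + 2 * R) * E)),
    Finset.sum_nonneg fun k _ => by have := hD0 k; positivity, fun a ha m n h => ?_⟩
  obtain ⟨A, p, hA, hp, hAp, -, hp'⟩ := hE a
  have hp' := hp' ha
  choose A' B' hA' hB' hAB' _ hB'' using fun k => hD k a
  have hpa : 0 < 1 + |a| := by positivity
  have hbd : ∀ s, ‖(dens ε ρ s : ℂ)‖ ≤ K := fun s => by
    rw [Complex.norm_real, Real.norm_of_nonneg (hδ0.le.trans (hd s).1)]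
    exact (hd s).2
  have hbr : ∀ k s, ‖(ε : ℂ) * conj (ρ k s) * wave (-a) s‖ ≤ R := fun k s => by
    rw [norm_mul, norm_mul, hε1, RCLike.norm_conj, norm_wave, one_mul, mul_one]
    exact hR k s
  have hcr : ∀ k, Continuous fun s => (ε : ℂ) * conj (ρ k s) * wave (-a) s := fun k =>
    (continuous_const.mul (Complex.continuous_conj.comp (hρ k).continuous)).mul
      (continuous_wave _)
  -- the approximate solution is `(-A, b)`; its difference to the row solves a Toeplitz system with
  -- a residual that is bounded by the small upper part `p` of the modulated `S`
  have hμ : ∀ k : Fin 2, l2norm (fun s => m k.succ s - b k s) ≤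
      c⁻¹ * ((K + 2 * R) * E) / (1 + |a|) := fun k => by
    have := toeplitz_bound hc0 (hc a)
      (m := Fin.cases (fun s => m 0 s + A s) fun k s => m k.succ s - b k s)
      (b := Fin.cases (n 0) fun k s => n k.succ s - (b k s - ε * conj (ρ k s) * S s))
      (e := Fin.cases (fun s => -(dens ε ρ s * p s))
        fun k s => -(ε * conj (ρ k s) * wave (-a) s * p s))
      (fun k => by
        induction k using Fin.cases with
        | zero => exact (h.lower 0).add hA
        | succ k => exact (h.lower k.succ).sub (hbl k))
      (fun k => by
        induction k using Fin.cases with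
        | zero => exact h.upper 0
        | succ k => exact (h.upper k.succ).sub (hbu k))
      (fun k => by
        induction k using Fin.cases with
        | zero => exact (memLp_mul_bdd hp.memLp hcd.aestronglyMeasurable hbd).neg
        | succ k => exact (memLp_mul_bdd hp.memLp (hcr k).aestronglyMeasurable (hbr k)).neg)
      (fun k s => by
        have h2 := hAp s
        induction k using Fin.cases with
        | zero =>
          have h1 := h.jump_zero s
          have h3 := hSd s
          rw [sum_mul_symV_zero fun l => Fin.cases (motive := fun _ => ℝ → ℂ)
            (fun s => m 0 s + A s) (fun k s => m k.succ s - b k s) l s]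
          simp only [Fin.cases_zero, Fin.cases_succ, sub_mul, Finset.sum_sub_distrib]
          linear_combination -h1 - dens ε ρ s * h2 + wave a s * h3
        | succ k =>
          rw [sum_mul_symV_succ fun l => Fin.cases (motive := fun _ => ℝ → ℂ)
            (fun s => m 0 s + A s) (fun k s => m k.succ s - b k s) l s]
          simp only [Fin.cases_zero, Fin.cases_succ]
          have h1 := h.jump_succ k s
          have h4 := wave_neg_mul a s
          linear_combination -h1 - ε * conj (ρ k s) * wave (-a) s * h2 +
            ε * conj (ρ k s) * S s * h4) k.succ
    rw [Fin.sum_univ_succ] at this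
    simp only [Fin.cases_zero, Fin.cases_succ, l2norm_neg] at this
    have h1 : l2norm (fun s => dens ε ρ s * p s) ≤ K * l2norm p :=
      l2norm_le_mul hp.memLp (by linarith) (Eventually.of_forall fun s => by
        rw [norm_mul]; exact mul_le_mul_of_nonneg_right (hbd s) (norm_nonneg _))
    have h2 : ∀ k : Fin 2, l2norm (fun s => ε * conj (ρ k s) * wave (-a) s * p s) ≤
        R * l2norm p := fun k =>
      l2norm_le_mul hp.memLp hR0 (Eventually.of_forall fun s => by
        rw [norm_mul]; exact mul_le_mul_of_nonneg_right (hbr k s) (norm_nonneg _))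
    refine this.trans ?_
    rw [mul_div_assoc]
    refine mul_le_mul_of_nonneg_left ?_ (by positivity)
    calc _ ≤ K * l2norm p + ∑ _k : Fin 2, R * l2norm p :=
          add_le_add h1 (Finset.sum_le_sum fun k _ => h2 k)
      _ = (K + 2 * R) * l2norm p := by simp; ring
      _ ≤ (K + 2 * R) * (E / (1 + |a|)) :=
          mul_le_mul_of_nonneg_left hp' (by linarith)
      _ = _ := by ring
  set Q : ℝ → ℂ := fun s => β s * (dens ε ρ s : ℂ)⁻¹ - (1 - (dens ε ρ s : ℂ)⁻¹) with hQ
  set μ : Fin 2 → ℝ → ℂ := fun k s => m k.succ s - b k s with hμdef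
  have hμl : ∀ k, LowerHardy (μ k) := fun k => (h.lower k.succ).sub (hbl k)
  -- The factor `1 + β` is chosen such that all terms of the remainder but the first integrate to
  -- zero: `n_0 Q` is a product of upper, `β m_0` one of lower Hardy functions.
  have hg : ∀ s, n 0 s - m 0 s = wave a s * (S s * (1 + β s)) +
      (∑ k, wave a s * (ρ k s * (dens ε ρ s : ℂ)⁻¹ * (1 + β s)) * μ k s - n 0 s * Q s +
        β s * m 0 s) := fun s => by
    have h1 := h.jump_zero s
    have h3 := hSd s
    have hdi : (dens ε ρ s : ℂ) * (dens ε ρ s : ℂ)⁻¹ = 1 := mul_inv_cancel₀ (hd0 s)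
    have e : ∑ k, wave a s * (ρ k s * (dens ε ρ s : ℂ)⁻¹ * (1 + β s)) * μ k s =
        wave a s * (dens ε ρ s : ℂ)⁻¹ * (1 + β s) *
          (∑ k : Fin 2, m k.succ s * ρ k s - ∑ k, b k s * ρ k s) := by
      rw [← Finset.sum_sub_distrib, Finset.mul_sum]
      exact Finset.sum_congr rfl fun k _ => by simp only [hμdef]; ring
    rw [e, hQ]
    linear_combination (dens ε ρ s : ℂ)⁻¹ * (1 + β s) * h1 -
      wave a s * (dens ε ρ s : ℂ)⁻¹ * (1 + β s) * h3 +
      (1 + β s) * (wave a s * S s + m 0 s) * hdi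
  have hi1 : ∀ k, Integrable fun s =>
      wave a s * (ρ k s * (dens ε ρ s : ℂ)⁻¹ * (1 + β s)) * μ k s := fun k =>
    integrable_mul_of_memLp (memLp_wave_mul a (ht k).memLp) (hμl k).memLp
  have hi1s := integrable_finsetSum Finset.univ fun k _ => hi1 k
  have hi2 : Integrable fun s => n 0 s * Q s :=
    integrable_mul_of_memLp (h.upper 0).memLp hβu.memLp
  have hi12 : Integrable fun s =>
      ∑ k, wave a s * (ρ k s * (dens ε ρ s : ℂ)⁻¹ * (1 + β s)) * μ k s - n 0 s * Q s :=
    hi1s.sub hi2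
  have hi3 : Integrable fun s => β s * m 0 s :=
    integrable_mul_of_memLp hβl.memLp (h.lower 0).memLp
  refine ⟨_, hi12.add hi3, ?_, hg, ?_⟩
  · have := ((h.upper 0).memLp.sub (h.lower 0).memLp).sub (memLp_wave_mul a hf1.memLp)
    refine this.ae_eq (Eventually.of_forall fun s => ?_)
    simp only [Pi.sub_apply, Pi.add_apply]
    rw [hg s]
    ring
  · simp only [Pi.add_apply]
    rw [integral_add hi12 hi3, integral_sub hi1s hi2,
      (h.upper 0).integral_mul_eq_zero hβu, hβl.integral_mul_eq_zero (h.lower 0), sub_zero,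
      add_zero, integral_finsetSum _ fun k _ => hi1 k, Finset.sum_div]
    refine (norm_sum_le _ _).trans (Finset.sum_le_sum fun k _ => ?_)
    -- only the upper part of the modulated function pairs with the lower Hardy function `μ_k`
    have e : ∫ s, wave a s * (ρ k s * (dens ε ρ s : ℂ)⁻¹ * (1 + β s)) * μ k s =
        ∫ s, B' k s * μ k s := by
      simp only [hAB', add_mul]
      rw [integral_add (integrable_mul_of_memLp (hA' k).memLp (hμl k).memLp)
        (integrable_mul_of_memLp (hB' k).memLp (hμl k).memLp),
        (hA' k).integral_mul_eq_zero (hμl k), zero_add]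
    rw [e]
    refine (norm_integral_mul_le (hB' k).memLp (hμl k).memLp).trans ?_
    calc _ ≤ D k / (1 + |a|) * (c⁻¹ * ((K + 2 * R) * E) / (1 + |a|)) :=
          mul_le_mul (hB'' k ha) (hμ k) (l2norm_nonneg _) (by have := hD0 k; positivity)
      _ = _ := by rw [div_mul_div_comm, sq]

end nonpos

/-! ### Reconstruction at Lebesgue points -/

/-- At a point of differentiability of the primitive, averages over left neighbourhoods converge. -/
theorem tendsto_average_left {K : ℝ → ℂ} (hK : ∀ a b, IntervalIntegrable K volume a b) {κ : ℂ}
    {x : ℝ} (h : HasDerivAt (fun y => ∫ t in (0 : ℝ)..y, K t) κ x) :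
    Tendsto (fun t : ℝ => (t : ℂ)⁻¹ * ∫ ξ in (x - t)..x, K ξ) (𝓝[>] 0) (𝓝 κ) := by
  have hneg : Tendsto (fun t : ℝ => -t) (𝓝[>] 0) (𝓝[≠] 0) := by
    refine tendsto_nhdsWithin_iff.2 ⟨?_, ?_⟩
    · have : Tendsto (fun t : ℝ => -t) (𝓝 0) (𝓝 (-0)) := continuous_neg.tendsto 0
      rw [neg_zero] at this
      exact this.mono_left nhdsWithin_le_nhds
    · filter_upwards [self_mem_nhdsWithin] with t ht
      have ht : 0 < t := ht
      simp [ht.ne']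
  refine ((hasDerivAt_iff_tendsto_slope_zero.1 h).comp hneg).congr fun t => ?_
  simp only [Function.comp_apply]
  rw [← sub_eq_add_neg, intervalIntegral.integral_interval_sub_left (hK _ _) (hK _ _),
    intervalIntegral.integral_symm (x - t) x, Complex.real_smul]
  push_cast
  rw [inv_neg, neg_mul_neg]

/-- The limit defining the potential, at a Lebesgue point of the transform `Rf`: on the negative half
line the transform of `m_0` is minus that of the jump `n_0 - m_0`, that is, `-(Rf (ξ - a) + 𝓕 g ξ)`
with a continuous `𝓕 g`. -/
theorem IsRowSolution.tendsto_mul_lowerExt {ε : ℝ} {ρ : Fin 2 → ℝ → ℂ} {a : ℝ} {j : Fin 3}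
    {m n : Fin 3 → ℝ → ℂ} (h : IsRowSolution ε ρ a j m n) {F f g Rf : ℝ → ℂ}
    (hF : IsFourierPair (m 0) F) (hf : IsH1 f) (hRf : IsFourierPair f Rf) (hg : Integrable g)
    (hg2 : MemLp g 2 volume) (hd : ∀ s, n 0 s - m 0 s = wave a s * f s + g s)
    (hL : HasDerivAt (fun y => ∫ t in (0 : ℝ)..y, Rf t) (Rf (-a)) (-a)) {c : ℝ} (hc : 0 < c) :
    Tendsto (fun z => z * lowerExt F z) (lowerSectorAtInfinity c)
      (𝓝 (-(Rf (-a) + ∫ s, g s) / (2 * Real.pi * Complex.I))) := by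
  have hRi := hf.integrable_fourier hRf
  obtain ⟨G, hG⟩ := IsFourierPair.of_memLp (h.upper 0).memLp
  have hH : IsFourierPair (fun s => n 0 s - m 0 s) fun ξ => Rf (ξ - a) + 𝓕 g ξ := by
    refine ((hRf.cexp_mul a).add (IsFourierPair.of_integrable hg hg2)).congr
      (Eventually.of_forall fun s => (hd s).symm) EventuallyEq.rfl
  have hae : ∀ᵐ ξ : ℝ, ξ < 0 → F ξ = -(Rf (ξ - a) + 𝓕 g ξ) := by
    filter_upwards [hH.unique (hG.sub hF), (h.upper 0).fourier_eq_zero hG] with ξ h1 h2 h3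
    rw [h1, h2 h3]
    ring
  have hgc : Continuous (𝓕 g) := continuous_fourier hg
  have hg0 : 𝓕 g 0 = ∫ s, g s := by rw [IsFourierPair.fourier_eq_integral]; simp
  have h1 := tendsto_average_left (fun _ _ => hRi.intervalIntegrable) hL
  have h2 := tendsto_average_left (fun _ _ => hgc.intervalIntegrable _ _)
    (hgc.integral_hasStrictDerivAt 0 0).hasDerivAt
  rw [hg0] at h2
  refine AKNS.tendsto_mul_lowerExt ((h.lower_h1 0).integrable_fourier hF) ?_ hc
  refine (h1.add h2).neg.congr' ?_
  filter_upwards [self_mem_nhdsWithin] with t ht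
  have ht : 0 < t := ht
  have e1 : ∫ ξ in (-t)..0, F ξ = ∫ ξ in (-t)..0, -(Rf (ξ - a) + 𝓕 g ξ) := by
    refine intervalIntegral.integral_congr_ae' ?_ ?_
    · have h0 : ∀ᵐ ξ : ℝ, ξ ≠ 0 := by simp [ae_iff, measure_singleton]
      filter_upwards [hae, h0] with ξ h3 h4 h5
      exact h3 (lt_of_le_of_ne h5.2 h4)
    · exact Eventually.of_forall fun ξ hξ => by
        have := hξ.1.trans_le hξ.2
        linarith
  rw [e1, intervalIntegral.integral_neg, intervalIntegral.integral_add
    (hRi.comp_sub_right a).intervalIntegrable (hgc.intervalIntegrable _ _),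
    intervalIntegral.integral_comp_sub_right (fun ξ => Rf ξ), zero_sub, zero_sub,
    show -t - a = -a - t by ring]
  ring

/-! ### Continuous dependence on the parameter -/

theorem tendsto_l2norm_wave_sub {f : ℝ → ℂ} (hf : MemLp f 2 volume) (a : ℝ) :
    Tendsto (fun b => l2norm fun s => (wave a s - wave b s) * f s) (𝓝 a) (𝓝 0) := by
  have hb : ∀ b s, ‖wave a s - wave b s‖ ≤ 2 := fun b s =>
    (norm_sub_le _ _).trans (by rw [norm_wave, norm_wave]; norm_num)
  have hm : ∀ b, MemLp (fun s => (wave a s - wave b s) * f s) 2 volume := fun b =>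
    memLp_mul_bdd hf ((continuous_wave a).sub (continuous_wave b)).aestronglyMeasurable (hb b)
  have hsq : Tendsto (fun b => ∫ s, ‖(wave a s - wave b s) * f s‖ ^ 2) (𝓝 a)
      (𝓝 (∫ _ : ℝ, (0 : ℝ))) := by
    refine tendsto_integral_filter_of_dominated_convergence (fun s => 4 * ‖f s‖ ^ 2)
      (Eventually.of_forall fun b => ((hm b).1.norm.pow 2))
      (Eventually.of_forall fun b => Eventually.of_forall fun s => ?_)
      (((memLp_two_iff_integrable_sq_norm hf.1).1 hf).const_mul 4)
      (Eventually.of_forall fun s => ?_)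
    · rw [Real.norm_of_nonneg (by positivity), norm_mul, mul_pow]
      have := pow_le_pow_left₀ (norm_nonneg _) (hb b s) 2
      nlinarith [sq_nonneg ‖f s‖]
    · have hcont : Continuous fun b : ℝ => ‖(wave a s - wave b s) * f s‖ ^ 2 := by
        unfold wave
        fun_prop
      have := hcont.tendsto a
      simpa using this
  rw [integral_zero] at hsq
  have h2 := (Real.continuous_sqrt.tendsto 0).comp hsq
  rw [Real.sqrt_zero] at h2
  refine h2.congr fun b => ?_
  rw [Function.comp_apply, ← l2norm_sq (hm b), Real.sqrt_sq (l2norm_nonneg _)]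

theorem lowerExt_sub {F G : ℝ → ℂ} (hF : Integrable F) (hG : Integrable G) {z : ℂ}
    (hz : z.im ≤ 0) : lowerExt (fun ξ => F ξ - G ξ) z = lowerExt F z - lowerExt G z := by
  rw [lowerExt, lowerExt, lowerExt, ← integral_sub (integrableOn_lowerExt hF hz)
    (integrableOn_lowerExt hG hz)]
  simp only [mul_sub]

/-- At a fixed point of the lower half plane, the first column of the solution depends continuously
on the parameter. -/
theorem continuous_lowerExt_row {ε : ℝ} {ρ : Fin 2 → ℝ → ℂ} (hρ : ∀ k, IsH1 (ρ k))
    (hε : ε = 1 ∨ ε = -1) (hpos : ε = -1 → ∀ s, ∑ k, ‖ρ k s‖ ^ 2 < 1) {j : Fin 2}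
    {m n : ℝ → Fin 3 → ℝ → ℂ} {F : ℝ → ℝ → ℂ}
    (h : ∀ a, IsRowSolution ε ρ a j.succ (m a) (n a)) (hF : ∀ a, IsFourierPair (m a 0) (F a))
    {z : ℂ} (hz : z.im < 0) : Continuous fun a => lowerExt (F a) z := by
  obtain ⟨c, hc0, hc⟩ := exists_symV_coercive hρ hε hpos
  obtain ⟨K, hK0, hK⟩ := exists_lowerExt_bound hz
  refine continuous_iff_continuousAt.2 fun a => ?_
  -- freezing the solution at `a` leaves a residual that tends to zero in `L²`
  set w : Fin 2 → ℝ → ℂ := fun k s => m a k.succ s + if j = k then 1 else 0 with hw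
  set p : ℝ → ℂ := fun s => ∑ k, w k s * ρ k s with hp
  set q : Fin 2 → ℝ → ℂ := fun k s => ε * (conj (ρ k s) * m a 0 s) with hq
  have hp1 : IsH1 p := by
    refine IsH1.sum Finset.univ fun k _ => ?_
    simp only [hw, add_mul]
    exact (((h a).lower_h1 k.succ).mul (hρ k)).add ((hρ k).const_mul _)
  have hq1 : ∀ k, IsH1 (q k) := fun k => ((hρ k).star.mul ((h a).lower_h1 0)).const_mul _
  have hb : ∀ a b s, ‖wave a s - wave b s‖ ≤ 2 := fun a b s =>
    (norm_sub_le _ _).trans (by rw [norm_wave, norm_wave]; norm_num)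
  have hmem : ∀ (a b : ℝ) {f}, MemLp f 2 volume →
      MemLp (fun s => (wave a s - wave b s) * f s) 2 volume := fun a b f hf =>
    memLp_mul_bdd hf ((continuous_wave a).sub (continuous_wave b)).aestronglyMeasurable (hb a b)
  have hbound : ∀ b, l2norm (fun s => m b 0 s - m a 0 s) ≤
      c⁻¹ * (l2norm (fun s => (wave a s - wave b s) * p s) +
        ∑ k, l2norm fun s => (wave (-a) s - wave (-b) s) * q k s) := fun b => by
    have := toeplitz_bound hc0 (hc b) (m := fun l s => m b l s - m a l s)
      (b := fun k s => n b k s - n a k s)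
      (e := Fin.cases (fun s => (wave a s - wave b s) * p s)
        fun k s => (wave (-a) s - wave (-b) s) * q k s)
      (fun k => ((h b).lower k).sub ((h a).lower k))
      (fun k => ((h b).upper k).sub ((h a).upper k))
      (fun k => by
        induction k using Fin.cases with
        | zero => exact hmem a b hp1.memLp
        | succ k => exact hmem _ _ (hq1 k).memLp)
      (fun k s => by
        induction k using Fin.cases with
        | zero =>
          rw [sum_mul_symV_zero fun l => m b l s - m a l s]
          have h1 := (h b).jump_zero s
          have h2 := (h a).jump_zero s
          simp only [Fin.cases_zero, hp, hw, sub_mul, add_mul, ite_mul, one_mul, zero_mul,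
            Finset.sum_sub_distrib, Finset.sum_add_distrib, Finset.sum_ite_eq, Finset.mem_univ,
            if_true]
          linear_combination -h1 + h2
        | succ k =>
          rw [sum_mul_symV_succ fun l => m b l s - m a l s]
          have h1 := (h b).jump_succ k s
          have h2 := (h a).jump_succ k s
          simp only [Fin.cases_succ, hq]
          linear_combination -h1 + h2) 0
    rw [Fin.sum_univ_succ] at this
    simpa only [Fin.cases_zero, Fin.cases_succ] using this
  have hlim : Tendsto (fun b => l2norm (fun s => m b 0 s - m a 0 s)) (𝓝 a) (𝓝 0) := by
    refine squeeze_zero (fun b => l2norm_nonneg _) hbound ?_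
    have hn : Tendsto (fun b : ℝ => -b) (𝓝 a) (𝓝 (-a)) := continuous_neg.tendsto a
    have h2 : Tendsto (fun b => ∑ k, l2norm fun s => (wave (-a) s - wave (-b) s) * q k s) (𝓝 a)
        (𝓝 (∑ _k : Fin 2, 0)) := tendsto_finsetSum _ fun k _ =>
      (tendsto_l2norm_wave_sub (hq1 k).memLp (-a)).comp hn
    simpa using ((tendsto_l2norm_wave_sub hp1.memLp a).add h2).const_mul c⁻¹
  refine tendsto_iff_norm_sub_tendsto_zero.2 ?_
  refine squeeze_zero (fun b => norm_nonneg _) (fun b => ?_) (by simpa using hlim.const_mul K)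
  have hd := (hF b).sub (hF a)
  rw [← lowerExt_sub (((h b).lower_h1 0).integrable_fourier (hF b))
    (((h a).lower_h1 0).integrable_fourier (hF a)) hz.le, ← hd.l2norm_eq]
  exact hK _ hd.right

/-! ### Decay of the reconstructed potentials -/

/-- A crude bound, with `7 > 2π`. -/
theorem norm_dsym_one_le (a : ℝ) : ‖dsym 1 a‖ ≤ 7 * (1 + |a|) := by
  refine le_of_sq_le_sq ?_ (by positivity)
  have h3 : (2 * Real.pi * a) ^ 2 = (2 * Real.pi) ^ 2 * |a| ^ 2 := by rw [mul_pow, sq_abs]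
  have h4 : (2 * Real.pi) ^ 2 ≤ 49 := by nlinarith [Real.pi_gt_three, Real.pi_lt_d2]
  rw [normSq_dsym, h3]
  nlinarith [abs_nonneg a, mul_le_mul_of_nonneg_right h4 (sq_nonneg |a|)]

/-- The weight `ξ` is available on transforms of `H¹` functions, and `|a| / (1 + |a|)²` is square
integrable. -/
theorem memH01_of_bound {U R₁ R₂ f₁ f₂ : ℝ → ℂ} (hU : AEStronglyMeasurable U volume)
    (hf₁ : IsH1 f₁) (hf₂ : IsH1 f₂) (h₁ : IsFourierPair f₁ R₁) (h₂ : IsFourierPair f₂ R₂) {C : ℝ}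
    (hC : 0 ≤ C) (h : ∀ a, ‖U a‖ ≤ ‖R₁ (-a)‖ + ‖R₂ (-a)‖ + C / (1 + |a|) ^ 2) : MemH01 U := by
  have hB : ∀ {f R : ℝ → ℂ}, IsH1 f → IsFourierPair f R →
      MemLp (fun a => ‖dsym 1 (-a) * R (-a)‖) 2 volume := fun hf hR =>
    ((hf.memLp_dsym_mul hR 1).comp_measurePreserving (Measure.measurePreserving_neg volume)).norm
  have hBsum : MemLp (fun a => 2 * (‖dsym 1 (-a) * R₁ (-a)‖ + ‖dsym 1 (-a) * R₂ (-a)‖) +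
      7 * C * ‖(dsym 1 a)⁻¹‖) 2 volume :=
    (((hB hf₁ h₁).add (hB hf₂ h₂)).const_mul 2).add
      ((memLp_dsym_inv one_pos).norm.const_mul (7 * C))
  have key : ∀ a, (1 + |a|) * ‖U a‖ ≤ 2 * (‖dsym 1 (-a) * R₁ (-a)‖ + ‖dsym 1 (-a) * R₂ (-a)‖) +
      7 * C * ‖(dsym 1 a)⁻¹‖ := fun a => by
    have hpa : 0 < 1 + |a| := by positivity
    have h1 := one_add_abs_le_norm_dsym (-a)
    rw [abs_neg] at h1
    have h2 : (1 + |a|) * (C / (1 + |a|) ^ 2) ≤ 7 * C * ‖(dsym 1 a)⁻¹‖ := by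
      have h3 := norm_dsym_one_le a
      have h4 : 0 < ‖dsym 1 a‖ := norm_pos_iff.2 (dsym_ne_zero one_pos a)
      have e : (1 + |a|) * (C / (1 + |a|) ^ 2) = C * (1 + |a|)⁻¹ := by field_simp
      have h5 : (1 + |a|)⁻¹ ≤ 7 * ‖dsym 1 a‖⁻¹ := by
        rw [inv_le_iff_one_le_mul₀ hpa, mul_assoc, mul_left_comm, ← div_eq_inv_mul,
          le_div_iff₀ h4, one_mul]
        linarith
      rw [e, norm_inv]
      nlinarith [mul_le_mul_of_nonneg_left h5 hC]
    have h3 := mul_le_mul_of_nonneg_left (h a) hpa.le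
    rw [norm_mul, norm_mul]
    nlinarith [mul_le_mul_of_nonneg_right h1 (norm_nonneg (R₁ (-a))),
      mul_le_mul_of_nonneg_right h1 (norm_nonneg (R₂ (-a)))]
  refine ⟨hBsum.mono' hU (Eventually.of_forall fun a => ?_),
    hBsum.mono' (Complex.continuous_ofReal.aestronglyMeasurable.mul hU)
      (Eventually.of_forall fun a => ?_)⟩
  · nlinarith [key a, mul_nonneg (abs_nonneg a) (norm_nonneg (U a))]
  · rw [norm_mul, Complex.norm_real, Real.norm_eq_abs]
    nlinarith [key a, norm_nonneg (U a)]

theorem quasiMeasurePreserving_div_const {r : ℝ} (hr : r ≠ 0) :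
    Measure.QuasiMeasurePreserving (fun x : ℝ => x / r) volume volume := by
  simpa only [smul_eq_mul, div_eq_inv_mul] using
    Measure.quasiMeasurePreserving_smul (μ := (volume : Measure ℝ)) (inv_ne_zero hr)

theorem MemH01.comp_div {U : ℝ → ℂ} (hU : MemH01 U) {r : ℝ} (hr : r ≠ 0) :
    MemH01 fun x => U (x / r) := by
  have key : ∀ {f : ℝ → ℂ}, MemLp f 2 volume → MemLp (fun x => f (x / r)) 2 volume := by
    intro f hf
    have hm : AEStronglyMeasurable (fun x => f (x / r)) volume :=
      hf.1.comp_quasiMeasurePreserving (quasiMeasurePreserving_div_const hr)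
    exact (memLp_two_iff_integrable_sq_norm hm).2
      (((memLp_two_iff_integrable_sq_norm hf.1).1 hf).comp_div hr)
  refine ⟨key hU.1, ?_⟩
  refine ((key hU.2).const_mul (r : ℂ)).ae_eq (Eventually.of_forall fun x => ?_)
  have : (r : ℂ) ≠ 0 := by exact_mod_cast hr
  simp only []
  push_cast
  field_simp

theorem tendsto_lowerSectorAtInfinity_one :
    Tendsto (fun k : ℕ => -(((k : ℂ) + 1) * Complex.I)) atTop (lowerSectorAtInfinity 1) := by
  refine tendsto_inf.2 ⟨?_, tendsto_principal.2 (Eventually.of_forall fun k => ?_)⟩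
  · rw [← Metric.cobounded_eq_cocompact, ← tendsto_norm_atTop_iff_cobounded]
    refine Tendsto.congr (f₁ := fun k : ℕ => (k : ℝ) + 1) (fun k => ?_)
      (tendsto_atTop_add_const_right _ _ tendsto_natCast_atTop_atTop)
    rw [norm_neg, norm_mul, Complex.norm_I, mul_one]
    exact_mod_cast (Complex.norm_natCast (k + 1)).symm
  · have : (0 : ℝ) < (k : ℝ) + 1 := by positivity
    simp
    linarith

/-- Row `j` of the solution has a reconstructed potential for almost every parameter, and it belongs
to the weighted space. -/
theorem exists_potential {ε : ℝ} {ρ : Fin 2 → ℝ → ℂ} (hρ : ∀ k, IsH1 (ρ k))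
    (hε : ε = 1 ∨ ε = -1) (hpos : ε = -1 → ∀ s, ∑ k, ‖ρ k s‖ ^ 2 < 1) {j : Fin 2}
    {m n : ℝ → Fin 3 → ℝ → ℂ} {F : ℝ → ℝ → ℂ}
    (h : ∀ a, IsRowSolution ε ρ a j.succ (m a) (n a)) (hF : ∀ a, IsFourierPair (m a 0) (F a)) :
    ∃ U : ℝ → ℂ, (∀ᵐ a, ∀ c : ℝ, 0 < c → Tendsto (fun z => -2 * Complex.I * (z * lowerExt (F a) z))
      (lowerSectorAtInfinity c) (𝓝 (U a))) ∧ MemH01 U := by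
  obtain ⟨C₁, hC₁, hrem₁⟩ := exists_remainder_nonneg hρ hε hpos j
  obtain ⟨f, hf, C₂, hC₂, hrem₂⟩ := exists_remainder_nonpos hρ hε hpos j
  obtain ⟨R₁, hR₁⟩ := IsFourierPair.of_memLp (hρ j).memLp
  obtain ⟨R₂, hR₂⟩ := IsFourierPair.of_memLp hf.memLp
  have hleb : ∀ {k : ℝ → ℂ}, Integrable k →
      ∀ᵐ a : ℝ, HasDerivAt (fun y => ∫ t in (0 : ℝ)..y, k t) (k (-a)) (-a) := fun hk => by
    have := (Measure.measurePreserving_neg (volume : Measure ℝ)).quasiMeasurePreserving.ae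
      (_root_.LocallyIntegrable.ae_hasDerivAt_integral hk.locallyIntegrable)
    filter_upwards [this] with a ha using ha 0
  -- the value is chosen at every parameter with the bound, and is the limit at Lebesgue points
  have hex : ∀ a, ∃ u : ℂ,
      (HasDerivAt (fun y => ∫ t in (0 : ℝ)..y, R₁ t) (R₁ (-a)) (-a) →
        HasDerivAt (fun y => ∫ t in (0 : ℝ)..y, R₂ t) (R₂ (-a)) (-a) → ∀ c : ℝ, 0 < c →
        Tendsto (fun z => -2 * Complex.I * (z * lowerExt (F a) z)) (lowerSectorAtInfinity c)
          (𝓝 u)) ∧ ‖u‖ ≤ ‖R₁ (-a)‖ + ‖R₂ (-a)‖ + (C₁ + C₂) / (1 + |a|) ^ 2 := fun a => by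
    have key : ∀ {R g : ℝ → ℂ} {C : ℝ}, ‖∫ s, g s‖ ≤ C / (1 + |a|) ^ 2 →
        ‖(Real.pi : ℂ)⁻¹ * (R (-a) + ∫ s, g s)‖ ≤ ‖R (-a)‖ + C / (1 + |a|) ^ 2 := by
      intro R g C hg
      rw [norm_mul, norm_inv, Complex.norm_real, Real.norm_of_nonneg Real.pi_pos.le]
      have h1 : Real.pi⁻¹ ≤ 1 := inv_le_one_of_one_le₀ (by linarith [Real.pi_gt_three])
      calc _ ≤ 1 * ‖R (-a) + ∫ s, g s‖ := mul_le_mul_of_nonneg_right h1 (norm_nonneg _)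
        _ ≤ _ := by rw [one_mul]; exact (norm_add_le _ _).trans (add_le_add_right hg _)
    have hval : ∀ κ : ℂ, -2 * Complex.I * (-κ / (2 * Real.pi * Complex.I)) =
        (Real.pi : ℂ)⁻¹ * κ := fun κ => by
      have := Complex.I_ne_zero
      field_simp
    have hsq : 0 < (1 + |a|) ^ 2 := by positivity
    rcases le_total 0 a with ha | ha
    · obtain ⟨g, hgi, hg2, hd, hb⟩ := hrem₁ a ha _ _ (h a)
      refine ⟨(Real.pi : ℂ)⁻¹ * (R₁ (-a) + ∫ s, g s), fun hL _ c hc => ?_, ?_⟩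
      · rw [← hval]
        exact ((h a).tendsto_mul_lowerExt (hF a) (hρ j) hR₁ hgi hg2 hd hL hc).const_mul _
      · refine (key hb).trans ?_
        rw [add_div]
        have := div_nonneg hC₂ hsq.le
        linarith [norm_nonneg (R₂ (-a))]
    · obtain ⟨g, hgi, hg2, hd, hb⟩ := hrem₂ a ha _ _ (h a)
      refine ⟨(Real.pi : ℂ)⁻¹ * (R₂ (-a) + ∫ s, g s), fun _ hL c hc => ?_, ?_⟩
      · rw [← hval]
        exact ((h a).tendsto_mul_lowerExt (hF a) hf hR₂ hgi hg2 hd hL hc).const_mul _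
      · refine (key hb).trans ?_
        rw [add_div]
        have := div_nonneg hC₁ hsq.le
        linarith [norm_nonneg (R₁ (-a))]
  choose U hU hUb using hex
  have hlim : ∀ᵐ a, ∀ c : ℝ, 0 < c → Tendsto (fun z => -2 * Complex.I * (z * lowerExt (F a) z))
      (lowerSectorAtInfinity c) (𝓝 (U a)) := by
    filter_upwards [hleb ((hρ j).integrable_fourier hR₁), hleb (hf.integrable_fourier hR₂)]
      with a h1 h2 using hU a h1 h2
  refine ⟨U, hlim, memH01_of_bound ?_ (hρ j) hf hR₁ hR₂ (add_nonneg hC₁ hC₂) hUb⟩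
  -- `U` is an a.e. limit of functions that depend continuously on the parameter
  refine aestronglyMeasurable_of_tendsto_ae atTop
    (f := fun (k : ℕ) a => -2 * Complex.I * (-(((k : ℂ) + 1) * Complex.I) *
      lowerExt (F a) (-(((k : ℂ) + 1) * Complex.I)))) (fun k => ?_) ?_
  · refine Continuous.aestronglyMeasurable ?_
    have hz : (-(((k : ℂ) + 1) * Complex.I)).im < 0 := by
      have : (0 : ℝ) < (k : ℝ) + 1 := by positivity
      simp
      linarith
    exact continuous_const.mul (continuous_const.mul (continuous_lowerExt_row hρ hε hpos h hF hz))
  · filter_upwards [hlim] with a ha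
    exact (ha 1 one_pos).comp tendsto_lowerSectorAtInfinity_one

theorem rhpMatrix_apply_of_im_neg (F G : Fin 3 → Fin 3 → ℝ → ℂ) {z : ℂ} (hz : z.im < 0)
    {j k : Fin 3} (hjk : j ≠ k) : rhpMatrix F G z j k = lowerExt (F j k) z := by
  simp [rhpMatrix, hjk, not_lt.2 hz.le]

end AKNS

end

theorem proposition3p5 (ε : ℝ) (hε : ε = 1 ∨ ε = -1) (ρ₁ ρ₂ : ℝ → ℂ)
    (h₁ : AKNS.MemH1 ρ₁) (h₂ : AKNS.MemH1 ρ₂)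
    (hpos : ε = -1 → ∀ l : ℝ, ‖ρ₁ l‖ ^ 2 + ‖ρ₂ l‖ ^ 2 < 1) :
    (∀ x : ℝ, ∃ M : ℂ → Matrix (Fin 3) (Fin 3) ℂ, AKNS.IsRHPSolution ε ρ₁ ρ₂ x M ∧
      ∀ N : ℂ → Matrix (Fin 3) (Fin 3) ℂ, AKNS.IsRHPSolution ε ρ₁ ρ₂ x N →
        ∀ z : ℂ, z.im ≠ 0 → N z = M z) ∧
    ∀ M : ℝ → ℂ → Matrix (Fin 3) (Fin 3) ℂ, (∀ x : ℝ, AKNS.IsRHPSolution ε ρ₁ ρ₂ x (M x)) →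
      ∃ u v : ℝ → ℂ, (∀ᵐ x : ℝ, AKNS.IsReconstructed (M x) (u x) (v x)) ∧
        AKNS.MemH01 u ∧ AKNS.MemH01 v := by
  have hρ : ∀ k, AKNS.IsH1 ((![ρ₁, ρ₂] : Fin 2 → ℝ → ℂ) k) := fun k => by
    fin_cases k
    exacts [h₁.isH1, h₂.isH1]
  have hpos' : ε = -1 → ∀ s, ∑ k, ‖(![ρ₁, ρ₂] : Fin 2 → ℝ → ℂ) k s‖ ^ 2 < 1 := fun h s => by
    simpa [Fin.sum_univ_two] using hpos h s
  choose m n h using fun a j => AKNS.exists_rowSolution hρ hε hpos' a j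
  choose F hF using fun a j k => AKNS.IsFourierPair.of_memLp ((h a j).lower_h1 k).memLp
  choose G hG using fun a j k => AKNS.IsFourierPair.of_memLp ((h a j).upper_h1 k).memLp
  have hsol : ∀ x, AKNS.IsRHPSolution ε ρ₁ ρ₂ x
      (AKNS.rhpMatrix (F (x / Real.pi)) (G (x / Real.pi))) := fun x =>
    AKNS.isRHPSolution_rhpMatrix (h _) (hF _) (hG _)
  refine ⟨fun x => ⟨_, hsol x, fun N hN z hz => (hsol x).unique hN hz⟩, fun M hM => ?_⟩
  obtain ⟨U, hU, hU'⟩ := AKNS.exists_potential hρ hε hpos' (j := 0) (fun a => h a 1)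
    fun a => hF a 1 0
  obtain ⟨V, hV, hV'⟩ := AKNS.exists_potential hρ hε hpos' (j := 1) (fun a => h a 2)
    fun a => hF a 2 0
  refine ⟨fun x => U (x / Real.pi), fun x => V (x / Real.pi), ?_,
    hU'.comp_div Real.pi_ne_zero, hV'.comp_div Real.pi_ne_zero⟩
  have hq := AKNS.quasiMeasurePreserving_div_const Real.pi_ne_zero
  filter_upwards [hq.ae hU, hq.ae hV] with x hUx hVx
  have hentry : ∀ {c : ℝ} {j : Fin 3}, j ≠ 0 →
      ∀ᶠ z in AKNS.lowerSectorAtInfinity c, -2 * Complex.I *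
        (z * AKNS.lowerExt (F (x / Real.pi) j 0) z) = -2 * Complex.I * (z * M x z j 0) := by
    intro c j hj
    refine Filter.mem_inf_of_right (Filter.mem_principal.2 fun z hz => ?_)
    have hz : z.im < 0 := hz.1
    change _ = _
    rw [(hsol x).unique (hM x) hz.ne, AKNS.rhpMatrix_apply_of_im_neg _ _ hz hj]
  exact fun c hc => ⟨(hUx c hc).congr' (hentry (by decide)), (hVx c hc).congr' (hentry (by decide))⟩
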